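/- Let $\mathbb{T}^2=(\mathbb{R}/2\pi\mathbb{Z})^2$, and consider the inviscid incompressible porous media (IPM) equation $$\partial_t\theta+u\cdot\nabla\theta=0,\qquad u=M[\theta],\qquad \theta(\cdot,0)=\theta_0 ,$$ where $M=(M_1,M_2)$ is the Fourier multiplier on $\mathbb{T}^2$ with symbols $$\widehat{M}_1(k)=\frac{k_1k_2}{k_1^2+k_2^2},\qquad \widehat{M}_2(k)=\frac{-k_1^2}{k_1^2+k_2^2}\qquad(k\in\mathbb{Z}^2\setminus\{0\}),\qquad \widehat{M}(0)=0 .$$ **Theorem 6.10.** Let $s>2$ and let $\theta_0\in H^s(\mathbb{T}^2)$ be real-valued with zero mean on $\mathbb{T}^2$. Then there exist $T>0$ and a solution $\theta$ with $$\theta\in L^\infty(0,T;H^s(\mathbb{T}^2)) .$$ This solution is classical: $\theta\in C^1([0,T]\times\mathbb{T}^2)$, $u=M[\theta]$ is continuous on $[0,T]\times\mathbb{T}^2$, the equation holds at every point, $\theta(\cdot,0)=\theta_0$ almost everywhere, and $\theta(\cdot,t)$ has zero mean for every $t\in[0,T]$. It is also a weak solution, and it is unique: every weak solution on $[0,T)$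 with datum $\theta_0$ that belongs to $L^\infty(0,T;H^s(\mathbb{T}^2))$ equals $\theta$ almost everywhere in $(0,T)\times\mathbb{T}^2$. Here $\theta$ is a weak solution on $[0,T)$ with datum $\theta_0$ if $\theta$ and $u\theta$ are integrable on $(0,T)\times\mathbb{T}^2$, $u(\cdot,t)=M[\theta(\cdot,t)]$ for almost every $t\in(0,T)$, and $$\int_0^T\!\!\int_{\mathbb{T}^2}(\partial_t\phi+u\cdot\nabla\phi)\,\theta\,dx\,dt+\int_{\mathbb{T}^2}\phi(x,0)\,\theta_0(x)\,dx=0$$ for all smooth $\phi$ on $\mathbb{T}^2\times\mathbb{R}$ that vanish for all $t\ge T_1$, for some $T_1<T$. -/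

import Mathlib

open MeasureTheory Set
open scoped Real ContDiff

namespace IPM

noncomputable section

instance fact_two_pi_pos : Fact (0 < 2 * π) := ⟨Real.two_pi_pos⟩

/-- The torus `𝕋² = (ℝ/2πℤ)²`; its `volume` is the Lebesgue measure, of total mass `(2π)²`. -/
abbrev Torus : Type := Fin 2 → AddCircle (2 * π)

/-- The quotient map `ℝ² → 𝕋²`. -/
def proj (x : Fin 2 → ℝ) : Torus := fun i => (x i : AddCircle (2 * π))

/-- The Fourier coefficient `(2π)⁻² ∫ f(x) e^{-i k·x} dx` of a real function on `𝕋²`;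
`fourier n` is the character `x ↦ e^{i n x}` of `ℝ/2πℤ`. -/
def coeff (f : Torus → ℝ) (k : Fin 2 → ℤ) : ℂ :=
  (1 / (2 * π) ^ 2 : ℝ) * ∫ x : Torus, (f x : ℂ) * ∏ i, fourier (-(k i)) (x i)

/-- `|k|² = k₁² + k₂²`. -/
def normSq (k : Fin 2 → ℤ) : ℝ := (k 0 : ℝ) ^ 2 + (k 1 : ℝ) ^ 2

/-- Membership in the inhomogeneous Sobolev space `H^s(𝕋²)`, for `s ≥ 0`. -/
def MemHs (s : ℝ) (f : Torus → ℝ) : Prop :=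
  MemLp f 2 volume ∧ Summable fun k : Fin 2 → ℤ => (1 + normSq k) ^ s * ‖coeff f k‖ ^ 2

/-- The norm of `H^s(𝕋²)`. -/
def hsNorm (s : ℝ) (f : Torus → ℝ) : ℝ :=
  Real.sqrt (∑' k : Fin 2 → ℤ, (1 + normSq k) ^ s * ‖coeff f k‖ ^ 2)

/-- Membership in `L^∞(0,T; H^s(𝕋²))`. As `H^s(𝕋²)` is separable, strong measurability of
`t ↦ θ(t)` is joint measurability of `θ` on `(0,T) × 𝕋²`. -/
def MemLinftyHs (T s : ℝ) (θ : ℝ → Torus → ℝ) : Prop :=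
  AEStronglyMeasurable (fun p : ℝ × Torus => θ p.1 p.2)
    ((volume.restrict (Ioo 0 T)).prod volume) ∧
  ∃ C : ℝ, ∀ᵐ t ∂(volume.restrict (Ioo 0 T)), MemHs s (θ t) ∧ hsNorm s (θ t) ≤ C

/-- The partial derivative `∂f/∂x_j` on the torus. -/
def partialDeriv (j : Fin 2) (f : Torus → ℝ) (x : Torus) : ℝ :=
  deriv (fun h : ℝ => f (x + Pi.single j (h : AddCircle (2 * π)))) 0

/-- The Fourier symbol of the operator `M^ν` of the constitutive law `u = M^ν[θ]`.
At `k = 0` its value is `0` (the division by zero gives `0`). -/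
def symbol (ν : ℝ) (j : Fin 2) (k : Fin 2 → ℤ) : ℝ :=
  1 / (1 + ν * normSq k) *
    (![(k 0 : ℝ) * (k 1 : ℝ) / normSq k, -(k 0 : ℝ) ^ 2 / normSq k] j)

/-- The constitutive law `v = M^ν[f]` for an integrable `f`: the components of `v` are the
integrable functions whose Fourier coefficients are those of `f` multiplied by the symbol. -/
def IsVelocity (ν : ℝ) (f : Torus → ℝ) (v : Fin 2 → Torus → ℝ) : Prop :=
  ∀ j, Integrable (v j) volume ∧ ∀ k, coeff (v j) k = (symbol ν j k : ℂ) * coeff f k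

/-- Test functions for the problem on `[0,T)`: smooth on `ℝ × 𝕋²` and vanishing near and after
the time `T` (but not necessarily at the time `0`). -/
def IsTest (T : ℝ) (φ : ℝ → Torus → ℝ) : Prop :=
  ContDiff ℝ ∞ (fun p : ℝ × (Fin 2 → ℝ) => φ p.1 (proj p.2)) ∧
  ∃ T₁ < T, ∀ t, T₁ ≤ t → ∀ x, φ t x = 0

/-- `(θ, u)` is a weak solution on `𝕋² × [0,T)` of
`∂ₜθ + u·∇θ = 0`, `u = M^ν[θ]`, `θ(·,0) = θ₀`. -/
structure IsWeakSolution (ν T : ℝ) (θ₀ : Torus → ℝ)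
    (θ : ℝ → Torus → ℝ) (u : Fin 2 → ℝ → Torus → ℝ) : Prop where
  integrable : Integrable (fun p : ℝ × Torus => θ p.1 p.2)
    ((volume.restrict (Ioo 0 T)).prod volume)
  integrable_flux : ∀ j, Integrable (fun p : ℝ × Torus => u j p.1 p.2 * θ p.1 p.2)
    ((volume.restrict (Ioo 0 T)).prod volume)
  velocity : ∀ᵐ t ∂(volume.restrict (Ioo 0 T)), IsVelocity ν (θ t) (fun j => u j t)
  weak_eq : ∀ φ : ℝ → Torus → ℝ, IsTest T φ →
    (∫ t in Ioo 0 T, ∫ x : Torus,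
        (deriv (fun τ => φ τ x) t + ∑ j, u j t x * partialDeriv j (φ t) x) * θ t x)
      + ∫ x : Torus, φ 0 x * θ₀ x = 0

/-- `(θ, u)` is a classical solution on `𝕋² × [0,T]` of
`∂ₜθ + u·∇θ = 0`, `u = M^ν[θ]`, `θ(·,0) = θ₀`: the function `θ` is continuously differentiable
on `[0,T] × 𝕋²`, `u` is continuous there, and the equation holds at every point. The datum `θ₀`
is an element of a Lebesgue space, so it is attained almost everywhere on `𝕋²`. -/
structure IsClassicalSolution (ν T : ℝ) (θ₀ : Torus → ℝ)
    (θ : ℝ → Torus → ℝ) (u : Fin 2 → ℝ → Torus → ℝ) : Prop where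
  contDiffOn : ContDiffOn ℝ 1 (fun p : ℝ × (Fin 2 → ℝ) => θ p.1 (proj p.2)) (Icc 0 T ×ˢ univ)
  continuousOn : ∀ j, ContinuousOn (fun p : ℝ × Torus => u j p.1 p.2) (Icc 0 T ×ˢ univ)
  velocity : ∀ t ∈ Icc 0 T, IsVelocity ν (θ t) (fun j => u j t)
  eqn : ∀ t ∈ Icc 0 T, ∀ x : Torus,
    derivWithin (fun τ => θ τ x) (Icc 0 T) t + ∑ j, u j t x * partialDeriv j (θ t) x = 0
  initial : θ 0 =ᵐ[volume] θ₀

end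

end IPM

/-! In Fourier variables the equation is an infinite system of ordinary differential equations, `a'
k = bil a a k`, where `bil a a k` is the sum over `p` of `-i (M̂(p)·k) a p a (k-p)`. The symbol of
`M` is bounded by 1 and satisfies `M̂(p)·p = 0`, so the velocity is as regular as the scalar and
`M̂(p)·k = M̂(p)·(k-p)`. Since `s > 2 = 1 + d/2` in dimension `d = 2`, Cauchy-Schwarz puts `⟨k⟩ a k`
in `ℓ¹` for `a` in a ball of `H^s` (`InBall.summable_jap_mul`): gradient and velocity have
absolutely convergent Fourier series.

Two facts carry the estimates. Transport by a real divergence-free field is skew in `ℓ²`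
(`re_tsum_transport_eq_zero`), and commuting it with the weight `⟨k⟩^s` costs no derivative
(`abs_jap_rpow_sub_le`). Together they bound the derivative of the squared `H^s` norm by the cube of
that norm (`abs_re_sum_weight_bil_le`), so Galerkin truncations stay in one ball for a time
independent of the truncation (`exists_galerkin_inBall`). Mode by mode the truncations converge
along an ultrafilter, and a Taylor estimate with a uniform remainder shows that the limit is
differentiable and solves the full system (`exists_isCoeffSolutionAt`). The same skewness, applied
to a difference of two solutions, gives uniqueness by a Grönwall argument in `ℓ²`
(`eq_of_isCoeffSolutionAt`).

Summing the Fourier series gives a `C¹` function that solves the equation pointwise and, by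
integration by parts, weakly. Conversely, testing a weak solution against characters gives the
integrated system, so a weak solution bounded in `H^s` has the coefficients of a genuine trajectory
at almost every time (`IsWeakSolution.exists_isCoeffSolutionAt`). Uniqueness of trajectories and
completeness of the characters in `L²` finish the proof.

The construction lives on `(-T, T)`, which the two-sided energy bound allows; time 0 is then an
interior point and needs no one-sided calculus. -/

namespace IPM

/-! ### Weights on the frequency lattice. -/

/-- Frequencies of functions on the torus. -/
abbrev Mode : Type := Fin 2 → ℤ

/-- The Japanese bracket `⟨k⟩ = (1 + |k|²)^{1/2}`. -/
noncomputable def jap (k : Mode) : ℝ := Real.sqrt (1 + normSq k)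

lemma normSq_nonneg (k : Mode) : 0 ≤ normSq k := by unfold normSq; positivity

lemma normSq_neg (k : Mode) : normSq (-k) = normSq k := by simp [normSq]

lemma one_le_jap (k : Mode) : 1 ≤ jap k := by
  rw [jap, Real.one_le_sqrt]; linarith [normSq_nonneg k]

lemma jap_pos (k : Mode) : 0 < jap k := zero_lt_one.trans_le (one_le_jap k)

lemma jap_neg (k : Mode) : jap (-k) = jap k := by rw [jap, normSq_neg, jap]

lemma sq_jap (k : Mode) : jap k ^ 2 = 1 + normSq k :=
  Real.sq_sqrt (by linarith [normSq_nonneg k])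

/-- The bracket is the Euclidean length of the vector `(1, k)`; after squaring, what remains is
Cauchy-Schwarz for `p·q`. -/
lemma jap_add_le (p q : Mode) : jap (p + q) ≤ jap p + jap q := by
  have hp := jap_pos p
  have hq := jap_pos q
  rw [jap, Real.sqrt_le_left (by positivity)]
  have h1 := sq_jap p
  have h2 := sq_jap q
  have h3 : (p 0 : ℝ) * q 0 + p 1 * q 1 ≤ jap p * jap q := by
    apply le_of_sq_le_sq _ (by positivity)
    rw [mul_pow, h1, h2]
    unfold normSq
    nlinarith [sq_nonneg ((p 0 : ℝ) * q 1 - p 1 * q 0), sq_nonneg (p 0 : ℝ), sq_nonneg (p 1 : ℝ),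
      sq_nonneg (q 0 : ℝ), sq_nonneg (q 1 : ℝ)]
  have : 1 + normSq (p + q) ≤ jap p ^ 2 + jap q ^ 2 + 2 * (jap p * jap q) := by
    rw [h1, h2]
    have : normSq (p + q) = normSq p + normSq q + 2 * ((p 0 : ℝ) * q 0 + p 1 * q 1) := by
      simp only [normSq, Pi.add_apply]; push_cast; ring
    linarith
  nlinarith

lemma abs_jap_add_sub_le (p q : Mode) : |jap (p + q) - jap q| ≤ jap p := by
  rw [abs_sub_le_iff]
  refine ⟨by linarith [jap_add_le p q], ?_⟩
  have := jap_add_le (-p) (p + q)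
  rw [neg_add_cancel_left, jap_neg] at this
  linarith

lemma abs_coord_le_jap (k : Mode) (j : Fin 2) : |(k j : ℝ)| ≤ jap k := by
  rw [jap]
  apply Real.abs_le_sqrt
  unfold normSq
  fin_cases j <;> simp <;> nlinarith [sq_nonneg (k 0 : ℝ), sq_nonneg (k 1 : ℝ)]

lemma one_add_normSq_rpow (s : ℝ) (k : Mode) : (1 + normSq k) ^ s = (jap k ^ s) ^ 2 := by
  rw [← sq_jap, ← Real.rpow_natCast, ← Real.rpow_natCast, ← Real.rpow_mul (jap_pos k).le,
    ← Real.rpow_mul (jap_pos k).le, mul_comm]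

lemma jap_rpow_pos (s : ℝ) (k : Mode) : 0 < jap k ^ s := Real.rpow_pos_of_pos (jap_pos k) s

lemma jap_rpow_le_one {s : ℝ} (hs : s ≤ 0) (k : Mode) : jap k ^ s ≤ 1 :=
  Real.rpow_le_one_of_one_le_of_nonpos (one_le_jap k) hs

lemma norm_le_jap (k : Mode) : ‖k‖ ≤ jap k := by
  rw [pi_norm_le_iff_of_nonneg (jap_pos k).le]
  intro j
  rw [Int.norm_eq_abs]
  exact abs_coord_le_jap k j

/-- Comparison with the lattice sum of `‖k‖^(-r)`, which converges as soon as `r` exceeds the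
dimension 2. The mode 0, where the comparison is void, is discarded. -/
lemma summable_jap_rpow {r : ℝ} (hr : 2 < r) : Summable fun k : Mode => jap k ^ (-r) := by
  refine Summable.of_norm_bounded_eventually (EisensteinSeries.summable_one_div_norm_rpow hr) ?_
  filter_upwards [(Set.finite_singleton (0 : Mode)).compl_mem_cofinite] with k hk
  have hk : k ≠ 0 := by simpa using hk
  rw [Real.norm_of_nonneg (jap_rpow_pos _ k).le]
  exact Real.rpow_le_rpow_of_nonpos (norm_pos_iff.2 hk) (norm_le_jap k) (by linarith)

lemma abs_rpow_sub_rpow_le {s x y m : ℝ} (hs : 1 ≤ s) (hx : 0 < x) (hy : 0 < y) (hxm : x ≤ m)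
    (hym : y ≤ m) : |x ^ s - y ^ s| ≤ s * m ^ (s - 1) * |x - y| := by
  have := Convex.norm_image_sub_le_of_norm_hasDerivWithin_le (f := fun z : ℝ => z ^ s)
    (f' := fun z => s * z ^ (s - 1)) (C := s * m ^ (s - 1)) (s := Ioc 0 m) (x := y) (y := x)
    (fun z hz => (Real.hasDerivAt_rpow_const (Or.inr hs)).hasDerivWithinAt)
    (fun z hz => by
      have h0 := hz.1
      rw [Real.norm_of_nonneg (by positivity)]
      gcongr
      exact hz.2) (convex_Ioc 0 m) ⟨hy, hym⟩ ⟨hx, hxm⟩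
  simpa [Real.norm_eq_abs] using this

lemma add_rpow_le_two_rpow_mul {r x y : ℝ} (hr : 0 ≤ r) (hx : 0 ≤ x) (hy : 0 ≤ y) :
    (x + y) ^ r ≤ 2 ^ r * (x ^ r + y ^ r) := by
  have h1 : (x + y) ^ r ≤ (2 * max x y) ^ r := by
    gcongr
    linarith [le_max_left x y, le_max_right x y]
  rw [Real.mul_rpow (by norm_num) (le_max_of_le_left hx)] at h1
  refine h1.trans ?_
  gcongr
  rcases max_choice x y with h | h <;> rw [h]
  · linarith [Real.rpow_nonneg hy r]
  · linarith [Real.rpow_nonneg hx r]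

/-- The commutator bound for the weights `⟨k⟩^s`. -/
lemma abs_jap_rpow_sub_le {s : ℝ} (hs : 1 ≤ s) (p q : Mode) :
    |jap (p + q) ^ s - jap q ^ s| ≤
      s * 2 ^ (s - 1) * (jap p ^ s + jap p * jap q ^ (s - 1)) := by
  have hp := jap_pos p
  have hq := jap_pos q
  refine (abs_rpow_sub_rpow_le hs (jap_pos _) hq (jap_add_le p q) (by linarith)).trans ?_
  have h1 : jap p ^ s = jap p * jap p ^ (s - 1) := by
    rw [← Real.rpow_one_add' hp.le (by linarith)]; congr 1; ring
  calc s * (jap p + jap q) ^ (s - 1) * |jap (p + q) - jap q|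
      ≤ s * (2 ^ (s - 1) * (jap p ^ (s - 1) + jap q ^ (s - 1))) * jap p := by
        gcongr
        · exact add_rpow_le_two_rpow_mul (by linarith) hp.le hq.le
        · exact abs_jap_add_sub_le p q
    _ = _ := by rw [h1]; ring

/-- The convolution bound for negative powers of the Japanese bracket. -/
lemma jap_rpow_neg_mul_le {s : ℝ} (hs : 0 ≤ s) (p k : Mode) :
    jap p ^ (-s) * jap (k - p) ^ (-s) ≤
      2 ^ s * jap k ^ (-s) * (jap p ^ (-s) + jap (k - p) ^ (-s)) := by
  have hp := jap_pos p
  have hq := jap_pos (k - p)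
  have hk := jap_pos k
  have h1 : jap k ^ s ≤ 2 ^ s * (jap p ^ s + jap (k - p) ^ s) := by
    refine le_trans ?_ (add_rpow_le_two_rpow_mul hs hp.le hq.le)
    gcongr
    simpa using jap_add_le p (k - p)
  rw [Real.rpow_neg hp.le, Real.rpow_neg hq.le, Real.rpow_neg hk.le]
  have h2 := jap_rpow_pos s p
  have h3 := jap_rpow_pos s (k - p)
  have h4 := jap_rpow_pos s k
  have h5 : 2 ^ s * (jap k ^ s)⁻¹ * ((jap p ^ s)⁻¹ + (jap (k - p) ^ s)⁻¹)
      = (2 ^ s * (jap p ^ s + jap (k - p) ^ s)) * (jap k ^ s)⁻¹ *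
        ((jap p ^ s)⁻¹ * (jap (k - p) ^ s)⁻¹) := by
    field_simp
    ring
  rw [h5]
  refine le_mul_of_one_le_left (by positivity) ?_
  rw [← div_eq_mul_inv, one_le_div h4]
  exact h1

/-! ### The symbol of the constitutive law. -/

lemma symbol_zero_zero (k : Mode) : symbol 0 0 k = (k 0 : ℝ) * k 1 / normSq k := by simp [symbol]

lemma symbol_zero_one (k : Mode) : symbol 0 1 k = -(k 0 : ℝ) ^ 2 / normSq k := by simp [symbol]

lemma symbol_zero_neg (j : Fin 2) (k : Mode) : symbol 0 j (-k) = symbol 0 j k := by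
  simp only [symbol, normSq_neg]
  fin_cases j <;> simp

lemma abs_symbol_le (j : Fin 2) (k : Mode) : |symbol 0 j k| ≤ 1 := by
  have h := normSq_nonneg k
  have h' : normSq k = (k 0 : ℝ) ^ 2 + (k 1 : ℝ) ^ 2 := rfl
  fin_cases j
  · simp only [Fin.zero_eta, symbol_zero_zero, abs_div, abs_of_nonneg h]
    refine div_le_one_of_le₀ ?_ h
    rw [abs_le, h']
    constructor <;> nlinarith [sq_nonneg ((k 0 : ℝ) + k 1), sq_nonneg ((k 0 : ℝ) - k 1),
      sq_nonneg (k 0 : ℝ), sq_nonneg (k 1 : ℝ)]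
  · simp only [Fin.mk_one, symbol_zero_one, abs_div, abs_of_nonneg h]
    refine div_le_one_of_le₀ ?_ h
    rw [abs_le, h']
    constructor <;> nlinarith [sq_nonneg (k 0 : ℝ), sq_nonneg (k 1 : ℝ)]

lemma sum_symbol_mul_self (k : Mode) : ∑ j, symbol 0 j k * (k j : ℝ) = 0 := by
  rw [Fin.sum_univ_two, symbol_zero_zero, symbol_zero_one]
  ring

/-- The symbol `M̂(p)·k` of the transport term. -/
noncomputable def transportSymbol (p k : Mode) : ℝ := ∑ j, symbol 0 j p * (k j : ℝ)

/-- Incompressibility, `M̂(p)·p = 0`. It lets the derivative be read on the output frequency or on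
the transported factor, whichever is convenient. -/
lemma transportSymbol_sub (p k : Mode) : transportSymbol p (k - p) = transportSymbol p k := by
  have := sum_symbol_mul_self p
  simp only [transportSymbol, Fin.sum_univ_two, Pi.sub_apply, Int.cast_sub] at this ⊢
  linarith

lemma transportSymbol_neg_left (p k : Mode) : transportSymbol (-p) k = transportSymbol p k := by
  simp only [transportSymbol, symbol_zero_neg]

lemma transportSymbol_neg_right (p k : Mode) :
    transportSymbol p (-k) = -transportSymbol p k := by
  simp [transportSymbol]

lemma abs_transportSymbol_le (p k : Mode) : |transportSymbol p k| ≤ 2 * jap k := by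
  rw [transportSymbol, Fin.sum_univ_two]
  refine (abs_add_le _ _).trans ?_
  rw [abs_mul, abs_mul]
  have h0 := mul_le_mul (abs_symbol_le 0 p) (abs_coord_le_jap k 0) (abs_nonneg _) zero_le_one
  have h1 := mul_le_mul (abs_symbol_le 1 p) (abs_coord_le_jap k 1) (abs_nonneg _) zero_le_one
  linarith

end IPM

namespace IPM

open scoped ComplexConjugate

/-! ### Trilinear sums -/

/-- The change of variables `(p, k) ↦ (p, k - p)`. -/
def shearEquiv : Mode × Mode ≃ Mode × Mode where
  toFun x := (x.1, x.2 - x.1)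
  invFun x := (x.1, x.2 + x.1)
  left_inv x := by simp
  right_inv x := by simp

/-- The change of variables `(p, k) ↦ (k - p, k)`. -/
def swapEquiv : Mode × Mode ≃ Mode × Mode where
  toFun x := (x.2 - x.1, x.2)
  invFun x := (x.2 - x.1, x.2)
  left_inv x := by simp
  right_inv x := by simp

/-- The change of variables `(p, k) ↦ (-p, k - p)`. -/
def reflectEquiv : Mode × Mode ≃ Mode × Mode where
  toFun x := (-x.1, x.2 - x.1)
  invFun x := (-x.1, x.2 - x.1)
  left_inv x := by simp
  right_inv x := by simp

lemma tsum_prod_swap {F : Type*} [NormedAddCommGroup F] [CompleteSpace F]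
    {f : Mode × Mode → F} (hf : Summable f) :
    ∑' x, f x = ∑' k, ∑' p, f (p, k) := by
  rw [← (Equiv.prodComm Mode Mode).tsum_eq]
  exact ((Equiv.prodComm Mode Mode).summable_iff.2 hf).tsum_prod

/-- Young's inequality for `ℓ¹ · ℓ² · ℓ²`: split the two `v` factors by the arithmetic-geometric
mean inequality, and undo the shift by the shear `(p, k) ↦ (p, k - p)`, under which both halves have
the same sum. -/
lemma summable_trilinear_and_le {c v : Mode → ℝ} (hc0 : ∀ k, 0 ≤ c k) (hv0 : ∀ k, 0 ≤ v k)
    (hc : Summable c) (hv : Summable fun k => v k ^ 2) :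
    Summable (fun x : Mode × Mode => c x.1 * (v (x.2 - x.1) * v x.2)) ∧
      ∑' x : Mode × Mode, c x.1 * (v (x.2 - x.1) * v x.2) ≤ (∑' k, c k) * ∑' k, v k ^ 2 := by
  have h1 : Summable fun x : Mode × Mode => c x.1 * v x.2 ^ 2 :=
    hc.mul_of_nonneg hv hc0 fun k => sq_nonneg _
  have h2 : Summable fun x : Mode × Mode => c x.1 * v (x.2 - x.1) ^ 2 :=
    shearEquiv.summable_iff.2 h1
  have h3 : Summable fun x : Mode × Mode =>
      (c x.1 * v (x.2 - x.1) ^ 2 + c x.1 * v x.2 ^ 2) / 2 := (h2.add h1).div_const 2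
  have hle : ∀ x : Mode × Mode, c x.1 * (v (x.2 - x.1) * v x.2) ≤
      (c x.1 * v (x.2 - x.1) ^ 2 + c x.1 * v x.2 ^ 2) / 2 := fun x => by
    nlinarith [mul_nonneg (hc0 x.1) (sq_nonneg (v (x.2 - x.1) - v x.2))]
  have hs : Summable (fun x : Mode × Mode => c x.1 * (v (x.2 - x.1) * v x.2)) :=
    Summable.of_nonneg_of_le
      (fun x => mul_nonneg (hc0 _) (mul_nonneg (hv0 _) (hv0 _))) hle h3
  refine ⟨hs, (hs.tsum_le_tsum hle h3).trans (le_of_eq ?_)⟩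
  have h4 : ∑' x : Mode × Mode, c x.1 * v (x.2 - x.1) ^ 2 =
      ∑' x : Mode × Mode, c x.1 * v x.2 ^ 2 :=
    shearEquiv.tsum_eq fun x : Mode × Mode => c x.1 * v x.2 ^ 2
  rw [tsum_div_const, h2.tsum_add h1, h4, hc.tsum_mul_tsum hv h1]
  ring

lemma summable_trilinear_swap_and_le {c v : Mode → ℝ} (hc0 : ∀ k, 0 ≤ c k) (hv0 : ∀ k, 0 ≤ v k)
    (hc : Summable c) (hv : Summable fun k => v k ^ 2) :
    Summable (fun x : Mode × Mode => c (x.2 - x.1) * (v x.1 * v x.2)) ∧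
      ∑' x : Mode × Mode, c (x.2 - x.1) * (v x.1 * v x.2) ≤ (∑' k, c k) * ∑' k, v k ^ 2 := by
  have h := summable_trilinear_and_le hc0 hv0 hc hv
  have h1 := swapEquiv.summable_iff.2 h.1
  have h2 := swapEquiv.tsum_eq fun x : Mode × Mode => c x.1 * (v (x.2 - x.1) * v x.2)
  simp only [swapEquiv, Equiv.coe_fn_mk, Function.comp_def, sub_sub_cancel] at h1 h2
  exact ⟨h1, h2.trans_le h.2⟩

/-- The sum giving the transport of `v` by `b`, tested against `v`, has zero real part. -/
lemma re_tsum_transport_eq_zero {b : Mode → ℂ} (hb : ∀ k, b (-k) = conj (b k)) (v : Mode → ℂ) :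
    (∑' x : Mode × Mode, (-Complex.I * transportSymbol x.1 x.2) *
      (b x.1 * (v (x.2 - x.1) * conj (v x.2)))).re = 0 := by
  set Z := ∑' x : Mode × Mode, (-Complex.I * transportSymbol x.1 x.2) *
      (b x.1 * (v (x.2 - x.1) * conj (v x.2))) with hZ
  -- The reflection `(p, k) ↦ (-p, k - p)` exchanges the two `v` factors and turns `b p` into its
  -- conjugate, while the symbol is unchanged; the factor `-i` then gives the sign.
  have h : conj Z = -Z := by
    rw [hZ, Complex.conj_tsum, ← tsum_neg, ← reflectEquiv.tsum_eq]
    refine tsum_congr fun x => ?_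
    simp only [reflectEquiv, Equiv.coe_fn_mk, map_mul, map_neg, Complex.conj_I, Complex.conj_ofReal,
      Complex.conj_conj, hb, sub_neg_eq_add, sub_add_cancel, transportSymbol_neg_left,
      transportSymbol_sub]
    ring
  have := congrArg Complex.re h
  simp only [Complex.conj_re, Complex.neg_re] at this
  linarith

lemma abs_transportSymbol_le_sub (p k : Mode) : |transportSymbol p k| ≤ 2 * jap (k - p) := by
  rw [← transportSymbol_sub]; exact abs_transportSymbol_le p (k - p)

/-- The absolute convergence behind the rearrangements of the transport sum: the derivative is put
on `v (k - p)`, and a spare weight is given to `v k` so that both factors are the same `ℓ²`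
sequence. -/
lemma summable_transport {b v : Mode → ℂ} (hb : Summable fun k => ‖b k‖)
    (hv : Summable fun k => (jap k * ‖v k‖) ^ 2) :
    Summable fun x : Mode × Mode => (-Complex.I * transportSymbol x.1 x.2) *
      (b x.1 * (v (x.2 - x.1) * conj (v x.2))) := by
  have h := (summable_trilinear_and_le (c := fun k => ‖b k‖) (v := fun k => jap k * ‖v k‖)
    (fun k => norm_nonneg _) (fun k => mul_nonneg (jap_pos k).le (norm_nonneg _)) hb hv).1
  refine Summable.of_norm_bounded (h.mul_left 2) fun x => ?_
  have h1 := abs_transportSymbol_le_sub x.1 x.2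
  have h2 := one_le_jap x.2
  simp only [norm_mul, norm_neg, Complex.norm_I, one_mul, Complex.norm_real, Real.norm_eq_abs,
    RCLike.norm_conj]
  calc |transportSymbol x.1 x.2| * (‖b x.1‖ * (‖v (x.2 - x.1)‖ * ‖v x.2‖))
      ≤ (2 * jap (x.2 - x.1)) * (‖b x.1‖ * (‖v (x.2 - x.1)‖ * (jap x.2 * ‖v x.2‖))) := by
        gcongr
        · have := jap_pos (x.2 - x.1); positivity
        · exact le_mul_of_one_le_left (norm_nonneg _) h2
    _ = _ := by ring

/-! ### Sobolev balls of sequences -/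

/-- The ball of radius `R` in the weighted space of Fourier coefficients of `H^s`. -/
def InBall (s R : ℝ) (a : Mode → ℂ) : Prop :=
  ∀ F : Finset Mode, ∑ k ∈ F, (jap k ^ s * ‖a k‖) ^ 2 ≤ R ^ 2

namespace InBall

variable {s R : ℝ} {a : Mode → ℂ}

lemma summable (h : InBall s R a) : Summable fun k => (jap k ^ s * ‖a k‖) ^ 2 :=
  summable_of_sum_le (fun k => sq_nonneg _) h

lemma tsum_le (h : InBall s R a) : ∑' k, (jap k ^ s * ‖a k‖) ^ 2 ≤ R ^ 2 :=
  Real.tsum_le_of_sum_le (fun k => sq_nonneg _) h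

lemma norm_le (h : InBall s R a) (hR : 0 ≤ R) (k : Mode) : ‖a k‖ ≤ R * jap k ^ (-s) := by
  have h1 := h {k}
  rw [Finset.sum_singleton] at h1
  have h2 : jap k ^ s * ‖a k‖ ≤ R := le_of_sq_le_sq h1 hR
  rw [Real.rpow_neg (jap_pos k).le, ← div_eq_mul_inv, le_div_iff₀ (jap_rpow_pos s k)]
  linarith

end InBall

/-- Wiener-algebra constant: the `ℓ²` norm of `⟨k⟩^{1-s}`. -/
noncomputable def wienerConst (s : ℝ) : ℝ := Real.sqrt (∑' k : Mode, jap k ^ (-(2 * s - 2)))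

lemma InBall.sum_jap_mul_le {s R : ℝ} {a : Mode → ℂ} (h : InBall s R a) (hR : 0 ≤ R)
    (F : Finset Mode) :
    ∑ k ∈ F, jap k * ‖a k‖ ≤ Real.sqrt (∑ k ∈ F, jap k ^ (-(2 * s - 2))) * R := by
  have h1 : ∀ k : Mode, jap k * ‖a k‖ = jap k ^ (1 - s) * (jap k ^ s * ‖a k‖) := fun k => by
    rw [← mul_assoc, ← Real.rpow_add (jap_pos k)]; simp
  have h2 : ∀ k : Mode, jap k ^ (-(2 * s - 2)) = (jap k ^ (1 - s)) ^ 2 := fun k => by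
    rw [← Real.rpow_natCast, ← Real.rpow_mul (jap_pos k).le]; congr 1; push_cast; ring
  simp_rw [h1, h2]
  refine (Real.sum_mul_le_sqrt_mul_sqrt F _ _).trans ?_
  gcongr
  exact (Real.sqrt_le_left hR).2 (h F)

/-- The embedding that fixes the threshold for `s`: Cauchy-Schwarz against `⟨k⟩^(1-s)`, which is
square summable exactly because `2s - 2 > 2`. -/
lemma InBall.summable_jap_mul {s R : ℝ} (hs : 2 < s) {a : Mode → ℂ} (h : InBall s R a)
    (hR : 0 ≤ R) :
    Summable (fun k => jap k * ‖a k‖) ∧ ∑' k, jap k * ‖a k‖ ≤ wienerConst s * R := by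
  have hsum := summable_jap_rpow (r := 2 * s - 2) (by linarith)
  have h0 : ∀ k, 0 ≤ jap k * ‖a k‖ := fun k => mul_nonneg (jap_pos k).le (norm_nonneg _)
  have h1 : ∀ F : Finset Mode, ∑ k ∈ F, jap k * ‖a k‖ ≤ wienerConst s * R := fun F => by
    refine (h.sum_jap_mul_le hR F).trans ?_
    unfold wienerConst
    gcongr
    exact hsum.sum_le_tsum F fun k _ => (jap_rpow_pos _ k).le
  exact ⟨summable_of_sum_le h0 h1, Real.tsum_le_of_sum_le h0 h1⟩

lemma InBall.summable_norm {s R : ℝ} (hs : 2 < s) {a : Mode → ℂ} (h : InBall s R a)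
    (hR : 0 ≤ R) : Summable fun k => ‖a k‖ :=
  Summable.of_nonneg_of_le (fun k => norm_nonneg _)
    (fun k => le_mul_of_one_le_left (norm_nonneg _) (one_le_jap k)) (h.summable_jap_mul hs hR).1

lemma InBall.summable_jap_mul_sq {s R : ℝ} (hs : 1 ≤ s) {a : Mode → ℂ} (h : InBall s R a) :
    Summable fun k => (jap k * ‖a k‖) ^ 2 := by
  refine Summable.of_nonneg_of_le (fun k => sq_nonneg _) (fun k => ?_) h.summable
  have := jap_pos k
  gcongr
  exact Real.self_le_rpow_of_one_le (one_le_jap k) hs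

/-! ### The bilinear term -/

/-- Fourier coefficients of `-M[f]·∇g` in terms of those of `f` and `g`. -/
noncomputable def bil (a b : Mode → ℂ) (k : Mode) : ℂ :=
  ∑' p, (-Complex.I * transportSymbol p k) * (a p * b (k - p))

/-- The sum of `⟨k⟩^{-s}`. -/
noncomputable def japSum (s : ℝ) : ℝ := ∑' k : Mode, jap k ^ (-s)

lemma japSum_nonneg (s : ℝ) : 0 ≤ japSum s := tsum_nonneg fun k => (jap_rpow_pos _ k).le

lemma norm_bil_term (a b : Mode → ℂ) (p k : Mode) :
    ‖(-Complex.I * transportSymbol p k) * (a p * b (k - p))‖ ≤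
      2 * jap k * (‖a p‖ * ‖b (k - p)‖) := by
  simp only [norm_mul, norm_neg, Complex.norm_I, one_mul, Complex.norm_real, Real.norm_eq_abs]
  gcongr
  exact abs_transportSymbol_le p k

lemma summable_jap_rpow_sub {s : ℝ} (hs : 2 < s) (k : Mode) :
    Summable (fun p : Mode => jap (k - p) ^ (-s)) :=
  (Equiv.subLeft k).summable_iff.2 (summable_jap_rpow hs)

lemma tsum_jap_rpow_sub (s : ℝ) (k : Mode) :
    ∑' p : Mode, jap (k - p) ^ (-s) = japSum s :=
  (Equiv.subLeft k).tsum_eq fun p : Mode => jap p ^ (-s)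

/-- Only a sup bound is asked of the first factor, so the estimate applies to a difference of two
solutions, for which no decay is quantified; `summable_bil_right` does the same for the second
factor. -/
lemma summable_bil_left {s A B : ℝ} (hs : 2 < s) {a b : Mode → ℂ} (ha : ∀ k, ‖a k‖ ≤ A)
    (hb : ∀ k, ‖b k‖ ≤ B * jap k ^ (-s)) (k : Mode) :
    Summable (fun p => (-Complex.I * transportSymbol p k) * (a p * b (k - p))) ∧
      ‖bil a b k‖ ≤ 2 * jap k * (A * B * japSum s) := by
  have hA : 0 ≤ A := (norm_nonneg _).trans (ha 0)
  have h1 : ∀ p, ‖(-Complex.I * transportSymbol p k) * (a p * b (k - p))‖ ≤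
      2 * jap k * (A * B) * jap (k - p) ^ (-s) := fun p => by
    refine (norm_bil_term a b p k).trans ?_
    have := jap_pos k
    calc 2 * jap k * (‖a p‖ * ‖b (k - p)‖)
        ≤ 2 * jap k * (A * (B * jap (k - p) ^ (-s))) := by gcongr; exacts [ha p, hb _]
      _ = _ := by ring
  have h2 := (summable_jap_rpow_sub hs k).mul_left (2 * jap k * (A * B))
  refine ⟨Summable.of_norm_bounded h2 h1, (tsum_of_norm_bounded h2.hasSum h1).trans ?_⟩
  rw [tsum_mul_left, tsum_jap_rpow_sub]
  exact le_of_eq (by ring)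

lemma summable_bil_right {s A B : ℝ} (hs : 2 < s) {a b : Mode → ℂ}
    (ha : ∀ k, ‖a k‖ ≤ A * jap k ^ (-s)) (hb : ∀ k, ‖b k‖ ≤ B) (k : Mode) :
    Summable (fun p => (-Complex.I * transportSymbol p k) * (a p * b (k - p))) ∧
      ‖bil a b k‖ ≤ 2 * jap k * (A * B * japSum s) := by
  have hB : 0 ≤ B := (norm_nonneg _).trans (hb 0)
  have h1 : ∀ p, ‖(-Complex.I * transportSymbol p k) * (a p * b (k - p))‖ ≤
      2 * jap k * (A * B) * jap p ^ (-s) := fun p => by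
    refine (norm_bil_term a b p k).trans ?_
    have := jap_pos k
    have h3 : 0 ≤ A * jap p ^ (-s) := (norm_nonneg _).trans (ha p)
    calc 2 * jap k * (‖a p‖ * ‖b (k - p)‖)
        ≤ 2 * jap k * ((A * jap p ^ (-s)) * B) := by gcongr; exacts [ha p, hb _]
      _ = _ := by ring
  have h2 := (summable_jap_rpow hs).mul_left (2 * jap k * (A * B))
  refine ⟨Summable.of_norm_bounded h2 h1, (tsum_of_norm_bounded h2.hasSum h1).trans ?_⟩
  rw [tsum_mul_left]
  exact le_of_eq (by rw [japSum]; ring)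

/-- The bilinear term loses one power of `⟨k⟩`. -/
lemma norm_bil_le_rpow {s A B : ℝ} (hs : 2 < s) {a b : Mode → ℂ}
    (ha : ∀ k, ‖a k‖ ≤ A * jap k ^ (-s)) (hb : ∀ k, ‖b k‖ ≤ B * jap k ^ (-s)) (k : Mode) :
    ‖bil a b k‖ ≤ 4 * 2 ^ s * (A * B * japSum s) * jap k ^ (1 - s) := by
  have hjk := jap_pos k
  have hA : 0 ≤ A := by
    have := (norm_nonneg _).trans (ha 0)
    exact nonneg_of_mul_nonneg_left this (jap_rpow_pos _ _)
  have hB : 0 ≤ B := by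
    have := (norm_nonneg _).trans (hb 0)
    exact nonneg_of_mul_nonneg_left this (jap_rpow_pos _ _)
  have h1 : ∀ p, ‖(-Complex.I * transportSymbol p k) * (a p * b (k - p))‖ ≤
      2 * jap k * (A * B) * (2 ^ s * jap k ^ (-s)) * (jap p ^ (-s) + jap (k - p) ^ (-s)) :=
    fun p => by
    refine (norm_bil_term a b p k).trans ?_
    have h3 : 0 ≤ A * jap p ^ (-s) := (norm_nonneg _).trans (ha p)
    calc 2 * jap k * (‖a p‖ * ‖b (k - p)‖)
        ≤ 2 * jap k * ((A * jap p ^ (-s)) * (B * jap (k - p) ^ (-s))) := by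
          gcongr; exacts [ha p, hb _]
      _ = 2 * jap k * (A * B) * (jap p ^ (-s) * jap (k - p) ^ (-s)) := by ring
      _ ≤ 2 * jap k * (A * B) *
          (2 ^ s * jap k ^ (-s) * (jap p ^ (-s) + jap (k - p) ^ (-s))) := by
          exact mul_le_mul_of_nonneg_left (jap_rpow_neg_mul_le (by linarith) p k) (by positivity)
      _ = _ := by ring
  have h2 := ((summable_jap_rpow hs).add (summable_jap_rpow_sub hs k)).mul_left
    (2 * jap k * (A * B) * (2 ^ s * jap k ^ (-s)))
  refine (tsum_of_norm_bounded h2.hasSum h1).trans ?_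
  rw [tsum_mul_left, (summable_jap_rpow hs).tsum_add (summable_jap_rpow_sub hs k),
    tsum_jap_rpow_sub]
  have h3 : jap k ^ (1 - s) = jap k * jap k ^ (-s) := by
    rw [sub_eq_add_neg, Real.rpow_add hjk, Real.rpow_one]
  rw [h3]
  exact le_of_eq (by rw [japSum]; ring)

lemma bil_self_sub_bil_self {s R : ℝ} (hs : 2 < s) {a b : Mode → ℂ}
    (ha : ∀ k, ‖a k‖ ≤ R * jap k ^ (-s)) (hb : ∀ k, ‖b k‖ ≤ R * jap k ^ (-s)) (k : Mode) :
    bil a a k - bil b b k = bil (fun p => a p - b p) a k + bil b (fun p => a p - b p) k := by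
  have hR : 0 ≤ R := by
    have := (norm_nonneg _).trans (ha 0)
    exact nonneg_of_mul_nonneg_left this (jap_rpow_pos _ _)
  have hle : ∀ {c : Mode → ℂ}, (∀ k, ‖c k‖ ≤ R * jap k ^ (-s)) → ∀ k, ‖c k‖ ≤ R := fun hc k =>
    (hc k).trans (mul_le_of_le_one_right hR (jap_rpow_le_one (by linarith) k))
  have hd : ∀ k, ‖a k - b k‖ ≤ R + R := fun k =>
    (norm_sub_le _ _).trans (add_le_add (hle ha k) (hle hb k))
  have h1 := (summable_bil_left hs (hle ha) ha k).1
  have h2 := (summable_bil_left hs (hle hb) hb k).1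
  have h3 := (summable_bil_left hs hd ha k).1
  have h4 := (summable_bil_right hs hb hd k).1
  unfold bil
  rw [← h1.tsum_sub h2, ← h3.tsum_add h4]
  exact tsum_congr fun p => by ring

/-- On a ball each mode of the nonlinearity is Lipschitz for the sup norm, with a constant growing
like `⟨k⟩`. This is harmless when one mode is followed at a time. -/
lemma norm_bil_self_sub_le {s R δ : ℝ} (hs : 2 < s) {a b : Mode → ℂ}
    (ha : ∀ k, ‖a k‖ ≤ R * jap k ^ (-s)) (hb : ∀ k, ‖b k‖ ≤ R * jap k ^ (-s))
    (hd : ∀ k, ‖a k - b k‖ ≤ δ) (k : Mode) :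
    ‖bil a a k - bil b b k‖ ≤ 4 * jap k * (R * japSum s) * δ := by
  rw [bil_self_sub_bil_self hs ha hb]
  refine (norm_add_le _ _).trans ?_
  have h1 := (summable_bil_left hs hd ha k).2
  have h2 := (summable_bil_right hs hb hd k).2
  linarith

/-! ### Energy estimates -/

/-- The constant of the `H^s` energy estimate. -/
noncomputable def energyConst (s : ℝ) : ℝ := 4 * (s * 2 ^ (s - 1)) * wienerConst s

lemma energyConst_nonneg {s : ℝ} (hs : 0 ≤ s) : 0 ≤ energyConst s := by
  unfold energyConst wienerConst; positivity

/-- The `H^s` energy estimate for trigonometric polynomials. -/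
lemma abs_re_sum_weight_bil_le {s : ℝ} (hs : 2 < s) {S : Finset Mode} {a : Mode → ℂ}
    (hsymm : ∀ k, a (-k) = conj (a k)) (hS : ∀ k ∉ S, a k = 0) :
    |(∑ k ∈ S, ((jap k ^ s) ^ 2 : ℝ) * (bil a a k * conj (a k))).re| ≤
      energyConst s * Real.sqrt (∑ k ∈ S, (jap k ^ s * ‖a k‖) ^ 2) *
        ∑ k ∈ S, (jap k ^ s * ‖a k‖) ^ 2 := by
  set N2 := ∑ k ∈ S, (jap k ^ s * ‖a k‖) ^ 2 with hN2
  have hN0 : 0 ≤ N2 := Finset.sum_nonneg fun k _ => sq_nonneg _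
  have hball : InBall s (Real.sqrt N2) a := fun F => by
    rw [Real.sq_sqrt hN0, hN2]
    have : ∑ k ∈ F, (jap k ^ s * ‖a k‖) ^ 2 = ∑ k ∈ F ∩ S, (jap k ^ s * ‖a k‖) ^ 2 := by
      refine (Finset.sum_subset Finset.inter_subset_left fun k hk hk' => ?_).symm
      rw [hS k fun h => hk' (Finset.mem_inter.2 ⟨hk, h⟩)]; simp
    rw [this]
    exact Finset.sum_le_sum_of_subset_of_nonneg Finset.inter_subset_right
      fun k _ _ => sq_nonneg _
  obtain ⟨hc, hcle⟩ := hball.summable_jap_mul hs (Real.sqrt_nonneg _)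
  have hv := hball.summable
  have hvle : ∑' k, (jap k ^ s * ‖a k‖) ^ 2 ≤ N2 := by
    simpa [Real.sq_sqrt hN0] using hball.tsum_le
  set W : Mode → ℝ := fun k => jap k ^ s with hW
  have hW0 : ∀ k, 0 < W k := fun k => jap_rpow_pos s k
  -- One of the two weights at `k` is written as its difference with the weight at `k - p`, plus the
  -- latter. `T1` is the commutator; `T2` transports the weighted sequence `W a` by `a` and pairs it
  -- with itself, so it drops out by skewness.
  let T1 : Mode × Mode → ℂ := fun x => (-Complex.I * transportSymbol x.1 x.2) *
    (a x.1 * (((W x.2 - W (x.2 - x.1) : ℝ) * a (x.2 - x.1)) * conj (W x.2 * a x.2)))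
  let T2 : Mode × Mode → ℂ := fun x => (-Complex.I * transportSymbol x.1 x.2) *
    (a x.1 * ((W (x.2 - x.1) * a (x.2 - x.1)) * conj (W x.2 * a x.2)))
  have hT2 : Summable T2 := by
    refine summable_transport (b := a) (v := fun k => W k * a k)
      (hball.summable_norm hs (Real.sqrt_nonneg _)) ?_
    refine summable_of_ne_finset_zero (s := S) fun k hk => ?_
    simp [hS k hk]
  have hT2re : (∑' x, T2 x).re = 0 := re_tsum_transport_eq_zero hsymm fun k => W k * a k
  set K := s * 2 ^ (s - 1) with hK
  have hK0 : 0 ≤ K := by positivity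
  obtain ⟨hA, hAle⟩ := summable_trilinear_and_le (c := fun k => jap k * ‖a k‖)
    (v := fun k => W k * ‖a k‖) (fun k => mul_nonneg (jap_pos k).le (norm_nonneg _))
    (fun k => mul_nonneg (hW0 k).le (norm_nonneg _)) hc hv
  obtain ⟨hB, hBle⟩ := summable_trilinear_swap_and_le (c := fun k => jap k * ‖a k‖)
    (v := fun k => W k * ‖a k‖) (fun k => mul_nonneg (jap_pos k).le (norm_nonneg _))
    (fun k => mul_nonneg (hW0 k).le (norm_nonneg _)) hc hv
  have hT1le : ∀ x, ‖T1 x‖ ≤ 2 * K *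
      ((jap x.1 * ‖a x.1‖) * ((W (x.2 - x.1) * ‖a (x.2 - x.1)‖) * (W x.2 * ‖a x.2‖)) +
      (jap (x.2 - x.1) * ‖a (x.2 - x.1)‖) * ((W x.1 * ‖a x.1‖) * (W x.2 * ‖a x.2‖))) := by
    rintro ⟨p, k⟩
    have hq := jap_pos (k - p)
    have h1 := abs_transportSymbol_le_sub p k
    have h2 : |W k - W (k - p)| ≤ K * (W p + jap p * jap (k - p) ^ (s - 1)) := by
      simpa using abs_jap_rpow_sub_le (by linarith : (1 : ℝ) ≤ s) p (k - p)
    have h3 : jap (k - p) * jap (k - p) ^ (s - 1) = W (k - p) := by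
      rw [← Real.rpow_one_add' hq.le (by linarith)]; simp [hW]
    -- The derivative on `a (k - p)` completes `⟨k-p⟩^(s-1)` to a full weight. In either resulting
    -- term one factor carries a single power of the bracket and goes into `ℓ¹`, and the other two
    -- carry `⟨·⟩^s` and go into `ℓ²`.
    have h4 : |transportSymbol p k| * |W k - W (k - p)| ≤
        2 * K * (jap (k - p) * W p + jap p * W (k - p)) := by
      refine (mul_le_mul h1 h2 (abs_nonneg _) (by positivity)).trans (le_of_eq ?_)
      rw [← h3]; ring
    simp only [T1, norm_mul, norm_neg, Complex.norm_I, one_mul, Complex.norm_real,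
      Real.norm_eq_abs, RCLike.norm_conj, abs_of_pos (hW0 k)]
    calc |transportSymbol p k| * (‖a p‖ * (|W k - W (k - p)| * ‖a (k - p)‖ * (W k * ‖a k‖)))
        = (|transportSymbol p k| * |W k - W (k - p)|) *
          (‖a p‖ * ‖a (k - p)‖ * (W k * ‖a k‖)) := by ring
      _ ≤ (2 * K * (jap (k - p) * W p + jap p * W (k - p))) *
          (‖a p‖ * ‖a (k - p)‖ * (W k * ‖a k‖)) := by
          refine mul_le_mul_of_nonneg_right h4 ?_
          have := hW0 k
          positivity
      _ = _ := by ring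
  have hsumB := (hA.add hB).mul_left (2 * K)
  have hT1 : Summable T1 := Summable.of_norm_bounded hsumB hT1le
  have hT1norm : ‖∑' x, T1 x‖ ≤ energyConst s * Real.sqrt N2 * N2 := by
    refine (tsum_of_norm_bounded hsumB.hasSum hT1le).trans ?_
    rw [tsum_mul_left, hA.tsum_add hB]
    have h5 : (∑' k, jap k * ‖a k‖) * ∑' k, (W k * ‖a k‖) ^ 2 ≤
        (wienerConst s * Real.sqrt N2) * N2 := by
      refine mul_le_mul hcle hvle (tsum_nonneg fun k => sq_nonneg _) ?_
      unfold wienerConst; positivity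
    calc _ ≤ 2 * K * ((wienerConst s * Real.sqrt N2) * N2 + (wienerConst s * Real.sqrt N2) * N2) := by
          gcongr
          · exact hAle.trans h5
          · exact hBle.trans h5
      _ = _ := by rw [energyConst, ← hK]; ring
  have hmain : ∑ k ∈ S, ((W k ^ 2 : ℝ) : ℂ) * (bil a a k * conj (a k)) = ∑' x, (T1 x + T2 x) := by
    have hT := hT1.add hT2
    rw [tsum_prod_swap hT, tsum_eq_sum (s := S)]
    · refine Finset.sum_congr rfl fun k _ => ?_
      rw [bil, mul_comm (∑' p, _) (conj (a k)), ← mul_assoc, ← tsum_mul_left]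
      refine tsum_congr fun p => ?_
      simp only [T1, T2, map_mul, Complex.conj_ofReal,
        Complex.ofReal_sub, Complex.ofReal_pow]
      ring
    · intro k hk
      simp [T1, T2, hS k hk]
  rw [hmain, hT1.tsum_add hT2, Complex.add_re, hT2re, add_zero]
  exact (Complex.abs_re_le_norm _).trans hT1norm

/-- The `ℓ²` norm is conserved by the transport of trigonometric polynomials. -/
lemma re_sum_bil_eq_zero {S : Finset Mode} {a : Mode → ℂ}
    (hsymm : ∀ k, a (-k) = conj (a k)) (hS : ∀ k ∉ S, a k = 0) :
    (∑ k ∈ S, bil a a k * conj (a k)).re = 0 := by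
  have hT : Summable fun x : Mode × Mode => (-Complex.I * transportSymbol x.1 x.2) *
      (a x.1 * (a (x.2 - x.1) * conj (a x.2))) := by
    refine summable_transport (summable_of_ne_finset_zero (s := S) fun k hk => ?_)
      (summable_of_ne_finset_zero (s := S) fun k hk => ?_) <;> simp [hS k hk]
  rw [← re_tsum_transport_eq_zero hsymm a, tsum_prod_swap hT, tsum_eq_sum (s := S)]
  · congr 1
    refine Finset.sum_congr rfl fun k _ => ?_
    rw [bil, ← tsum_mul_right]
    refine tsum_congr fun p => ?_
    ring
  · intro k hk
    simp [hS k hk]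

/-- The `ℓ²` estimate for the difference of two solutions. -/
lemma abs_re_tsum_bil_sub_le {s R : ℝ} (hs : 2 < s) (hR : 0 ≤ R) {a b : Mode → ℂ}
    (ha : InBall s R a) (hb : InBall s R b) (hsymm : ∀ k, b (-k) = conj (b k)) :
    |(∑' k, (bil a a k - bil b b k) * conj (a k - b k)).re| ≤
      2 * (wienerConst s * R) * ∑' k, ‖a k - b k‖ ^ 2 := by
  set w : Mode → ℂ := fun k => a k - b k with hw
  obtain ⟨hc, hcle⟩ := ha.summable_jap_mul hs hR
  have hw2 : Summable fun k => (jap k * ‖w k‖) ^ 2 := by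
    refine Summable.of_nonneg_of_le (fun k => sq_nonneg _) (fun k => ?_)
      (((ha.summable_jap_mul_sq (by linarith)).add
        (hb.summable_jap_mul_sq (by linarith))).mul_left 2)
    have := jap_pos k
    have h1 : jap k * ‖w k‖ ≤ jap k * ‖a k‖ + jap k * ‖b k‖ := by
      rw [← mul_add]; gcongr; exact norm_sub_le _ _
    calc (jap k * ‖w k‖) ^ 2 ≤ (jap k * ‖a k‖ + jap k * ‖b k‖) ^ 2 := by gcongr
      _ ≤ _ := by nlinarith [sq_nonneg (jap k * ‖a k‖ - jap k * ‖b k‖)]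
  have hw2' : Summable fun k => ‖w k‖ ^ 2 := by
    refine Summable.of_nonneg_of_le (fun k => sq_nonneg _) (fun k => ?_) hw2
    gcongr
    exact le_mul_of_one_le_left (norm_nonneg _) (one_le_jap k)
  -- With `w = a - b`, the nonlinearities differ by `bil w a + bil b w`. The first term has its
  -- derivative on `a`, which is controlled; the second is skew because `b` is the sequence of a
  -- real function.
  let T1 : Mode × Mode → ℂ := fun x => (-Complex.I * transportSymbol x.1 x.2) *
    (w x.1 * (a (x.2 - x.1) * conj (w x.2)))
  let T2 : Mode × Mode → ℂ := fun x => (-Complex.I * transportSymbol x.1 x.2) *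
    (b x.1 * (w (x.2 - x.1) * conj (w x.2)))
  have hT2 : Summable T2 := summable_transport (hb.summable_norm hs hR) hw2
  have hT2re : (∑' x, T2 x).re = 0 := re_tsum_transport_eq_zero hsymm w
  obtain ⟨hB, hBle⟩ := summable_trilinear_swap_and_le (c := fun k => jap k * ‖a k‖)
    (v := fun k => ‖w k‖) (fun k => mul_nonneg (jap_pos k).le (norm_nonneg _))
    (fun k => norm_nonneg _) hc hw2'
  have hT1le : ∀ x, ‖T1 x‖ ≤ 2 *
      ((jap (x.2 - x.1) * ‖a (x.2 - x.1)‖) * (‖w x.1‖ * ‖w x.2‖)) := by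
    rintro ⟨p, k⟩
    simp only [T1, norm_mul, norm_neg, Complex.norm_I, one_mul, Complex.norm_real,
      Real.norm_eq_abs, RCLike.norm_conj]
    calc |transportSymbol p k| * (‖w p‖ * (‖a (k - p)‖ * ‖w k‖))
        ≤ (2 * jap (k - p)) * (‖w p‖ * (‖a (k - p)‖ * ‖w k‖)) := by
          gcongr; exact abs_transportSymbol_le_sub p k
      _ = _ := by ring
  have hsumB := hB.mul_left 2
  have hT1 : Summable T1 := Summable.of_norm_bounded hsumB hT1le
  have hT1norm : ‖∑' x, T1 x‖ ≤ 2 * (wienerConst s * R) * ∑' k, ‖w k‖ ^ 2 := by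
    refine (tsum_of_norm_bounded hsumB.hasSum hT1le).trans ?_
    rw [tsum_mul_left, mul_assoc]
    gcongr
    refine hBle.trans ?_
    gcongr
  have hmain : ∑' k, (bil a a k - bil b b k) * conj (w k) = ∑' x, (T1 x + T2 x) := by
    have hT := hT1.add hT2
    have hpa := ha.norm_le hR
    have hpb := hb.norm_le hR
    have hle : ∀ {c : Mode → ℂ}, (∀ k, ‖c k‖ ≤ R * jap k ^ (-s)) → ∀ k, ‖c k‖ ≤ R := fun hc k =>
      (hc k).trans (mul_le_of_le_one_right hR (jap_rpow_le_one (by linarith) k))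
    have hd : ∀ k, ‖w k‖ ≤ R + R := fun k =>
      (norm_sub_le _ _).trans (add_le_add (hle hpa k) (hle hpb k))
    rw [tsum_prod_swap hT]
    refine tsum_congr fun k => ?_
    have h1 := (summable_bil_left hs hd hpa k).1
    have h2 := (summable_bil_right hs hpb hd k).1
    rw [bil_self_sub_bil_self hs hpa hpb, bil, bil, ← h1.tsum_add h2, ← tsum_mul_right]
    refine tsum_congr fun p => ?_
    simp only [T1, T2, hw]
    ring
  rw [hmain, hT1.tsum_add hT2, Complex.add_re, hT2re, add_zero]
  exact (Complex.abs_re_le_norm _).trans hT1norm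

end IPM

/-! ### Galerkin approximation and uniform energy bounds. -/

namespace IPM

open scoped ComplexConjugate Topology

lemma bil_neg {a b : Mode → ℂ} (ha : ∀ k, a (-k) = conj (a k)) (hb : ∀ k, b (-k) = conj (b k))
    (k : Mode) : bil a b (-k) = conj (bil a b k) := by
  rw [bil, bil, Complex.conj_tsum, ← (Equiv.neg Mode).tsum_eq]
  refine tsum_congr fun p => ?_
  have : -k - -p = -(k - p) := by abel
  simp only [Equiv.neg_apply, this, ha, hb, transportSymbol_neg_left, transportSymbol_neg_right,
    map_mul, map_neg, Complex.conj_I, Complex.conj_ofReal]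
  push_cast
  ring

/-- Global solvability of an autonomous equation with a compactly supported vector field. -/
lemma exists_hasDerivAt_of_hasCompactSupport {E : Type*} [NormedAddCommGroup E] [NormedSpace ℝ E]
    [CompleteSpace E] {g : E → E} (hg : ContDiff ℝ 1 g) (hc : HasCompactSupport g) (x₀ : E)
    {T : ℝ} (hT : 0 < T) :
    ∃ x : ℝ → E, x 0 = x₀ ∧ ∀ t ∈ Ioo (-T) T, HasDerivAt x (g (x t)) t := by
  obtain ⟨K, hK⟩ := ContDiff.lipschitzWith_of_hasCompactSupport hc hg one_ne_zero
  obtain ⟨L, hL⟩ := hc.exists_bound_of_continuous hg.continuous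
  have hL0 : 0 ≤ L := (norm_nonneg _).trans (hL 0)
  have h0 : (0 : ℝ) ∈ Icc (-T) T := ⟨by linarith, hT.le⟩
  -- A field bounded by `L` cannot move a point further than `L * T` in time `T`, so this radius
  -- allows the whole interval at once; the Lipschitz bound is global.
  have hpl : IsPicardLindelof (fun _ => g) (⟨0, h0⟩ : Icc (-T) T) x₀ (⟨L * T, by positivity⟩)
      0 ⟨L, hL0⟩ K :=
    IsPicardLindelof.of_time_independent (fun x _ => hL x) hK.lipschitzOnWith
      (by simp only [sub_zero, zero_sub, neg_neg, max_self, NNReal.coe_zero]; exact le_rfl)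
  obtain ⟨x, hx0, hx⟩ := hpl.exists_eq_forall_mem_Icc_hasDerivWithinAt₀
  exact ⟨x, hx0, fun t ht => (hx t (Ioo_subset_Icc_self ht)).hasDerivAt (Icc_mem_nhds ht.1 ht.2)⟩

section Galerkin

variable (S : Finset Mode)

/-- Extension by zero of a finite family of Fourier coefficients. -/
noncomputable def extendZero (x : S → ℂ) (k : Mode) : ℂ := if h : k ∈ S then x ⟨k, h⟩ else 0

variable {S}

lemma extendZero_of_mem (x : S → ℂ) {k : Mode} (h : k ∈ S) : extendZero S x k = x ⟨k, h⟩ :=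
  dif_pos h

lemma extendZero_of_notMem (x : S → ℂ) {k : Mode} (h : k ∉ S) : extendZero S x k = 0 :=
  dif_neg h

lemma contDiff_extendZero (k : Mode) : ContDiff ℝ ∞ fun x : S → ℂ => extendZero S x k := by
  by_cases h : k ∈ S
  · simp_rw [extendZero_of_mem _ h]; exact contDiff_apply ℝ ℂ _
  · simp_rw [extendZero_of_notMem _ h]; exact contDiff_const

/-- Projection onto the coefficients of real functions. -/
noncomputable def symmetrize (hS : ∀ k ∈ S, -k ∈ S) : (S → ℂ) →L[ℝ] (S → ℂ) :=
  ContinuousLinearMap.pi fun k => (1 / 2 : ℝ) •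
    (ContinuousLinearMap.proj (R := ℝ) (φ := fun _ : S => ℂ) k +
      (Complex.conjCLE : ℂ →L[ℝ] ℂ).comp
        (ContinuousLinearMap.proj (R := ℝ) (φ := fun _ : S => ℂ) ⟨-k.1, hS k.1 k.2⟩))

lemma symmetrize_apply (hS : ∀ k ∈ S, -k ∈ S) (x : S → ℂ) (k : S) :
    symmetrize hS x k = (1 / 2 : ℝ) • (x k + conj (x ⟨-k.1, hS k.1 k.2⟩)) := rfl

lemma symmetrize_eq_self_iff (hS : ∀ k ∈ S, -k ∈ S) (x : S → ℂ) :
    symmetrize hS x = x ↔ ∀ k, extendZero S x (-k) = conj (extendZero S x k) := by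
  constructor
  · intro h k
    by_cases hk : k ∈ S
    · have h1 := congrFun h ⟨-k, hS k hk⟩
      rw [symmetrize_apply] at h1
      simp only [neg_neg] at h1
      rw [extendZero_of_mem _ hk, extendZero_of_mem _ (hS k hk)]
      rw [Complex.real_smul] at h1
      push_cast at h1
      linear_combination -2 * h1
    · have hk' : -k ∉ S := fun h' => hk (by simpa using hS _ h')
      rw [extendZero_of_notMem _ hk, extendZero_of_notMem _ hk', map_zero]
  · intro h
    ext k
    have h1 := h k.1
    rw [extendZero_of_mem _ k.2, extendZero_of_mem _ (hS k.1 k.2)] at h1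
    rw [symmetrize_apply, h1, Complex.conj_conj, Complex.real_smul]
    push_cast
    ring

/-- Idempotence makes the defect `x - symmetrize hS x` constant along any flow whose field lies in
the range of the projection. -/
lemma symmetrize_symmetrize (hS : ∀ k ∈ S, -k ∈ S) (x : S → ℂ) :
    symmetrize hS (symmetrize hS x) = symmetrize hS x := by
  ext k
  rw [symmetrize_apply, symmetrize_apply, symmetrize_apply]
  simp only [neg_neg, Complex.real_smul, map_mul, map_add, Complex.conj_conj, Complex.conj_ofReal]
  push_cast
  ring

/-- The Galerkin vector field. -/
noncomputable def galerkinField (x : S → ℂ) (k : S) : ℂ := bil (extendZero S x) (extendZero S x) k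

lemma contDiff_galerkinField : ContDiff ℝ ∞ (galerkinField (S := S)) := by
  refine contDiff_pi.2 fun k => ?_
  have h : ∀ x : S → ℂ, galerkinField x k = ∑ p ∈ S, (-Complex.I * transportSymbol p k) *
      (extendZero S x p * extendZero S x (k - p)) := fun x =>
    tsum_eq_sum fun p hp => by simp [extendZero_of_notMem x hp]
  simp_rw [h]
  exact ContDiff.sum fun p _ =>
    contDiff_const.mul ((contDiff_extendZero p).mul (contDiff_extendZero _))

lemma hasDerivAt_sum_weight_normSq {a : ℝ → Mode → ℂ} {a' : Mode → ℂ} {t : ℝ} (S : Finset Mode)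
    (W : Mode → ℝ) (h : ∀ k ∈ S, HasDerivAt (fun τ => a τ k) (a' k) t) :
    HasDerivAt (fun τ => ∑ k ∈ S, (W k * ‖a τ k‖) ^ 2)
      (2 * (∑ k ∈ S, ((W k) ^ 2 : ℝ) * (a' k * conj (a t k))).re) t := by
  have h1 : ∀ k ∈ S, HasDerivAt (fun τ => (W k * ‖a τ k‖) ^ 2)
      (2 * (((W k) ^ 2 : ℝ) * (a' k * conj (a t k))).re) t := fun k hk => by
    have h2 := ((h k hk).norm_sq).const_mul (W k ^ 2)
    simp_rw [mul_pow]
    refine h2.congr_deriv ?_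
    rw [Complex.inner, Complex.re_ofReal_mul]
    ring
  refine (HasDerivAt.fun_sum h1).congr_deriv ?_
  rw [← Finset.mul_sum, Complex.re_sum]

/-- The truncated field is quadratic, so global solvability is not automatic. It is cut off outside
a ball; conservation of the `ℓ²` norm then shows that the solution never reaches the cut-off. -/
lemma exists_galerkin (hS : ∀ k ∈ S, -k ∈ S) {α : Mode → ℂ} (hα : ∀ k, α (-k) = conj (α k))
    (hαS : ∀ k ∉ S, α k = 0) {T : ℝ} (hT : 0 < T) :
    ∃ a : ℝ → Mode → ℂ, a 0 = α ∧ (∀ t, ∀ k ∉ S, a t k = 0) ∧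
      ∀ t ∈ Ioo (-T) T, (∀ k, a t (-k) = conj (a t k)) ∧
        ∀ k ∈ S, HasDerivAt (fun τ => a τ k) (bil (a t) (a t) k) t := by
  set R := Real.sqrt (∑ k ∈ S, (1 * ‖α k‖) ^ 2) with hR
  let B : ContDiffBump (0 : S → ℂ) := ⟨R + 1, R + 2, by positivity, by linarith⟩
  -- The outer projection keeps the solution among coefficients of real functions, where the
  -- skewness identity holds. There the projections act trivially and `g` is the cut-off Galerkin
  -- field.
  let g : (S → ℂ) → (S → ℂ) := fun x => B x • symmetrize hS (galerkinField (symmetrize hS x))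
  have hg : ContDiff ℝ 1 g := by
    refine B.contDiff.smul ?_
    exact (symmetrize hS).contDiff.comp ((contDiff_galerkinField.of_le (by exact_mod_cast le_top)).comp
      (symmetrize hS).contDiff)
  have hgc : HasCompactSupport g := B.hasCompactSupport.smul_right
  let x₀ : S → ℂ := fun k => α k
  have hx₀ : extendZero S x₀ = α := by
    ext k
    by_cases hk : k ∈ S
    · rw [extendZero_of_mem _ hk]
    · rw [extendZero_of_notMem _ hk, hαS k hk]
  obtain ⟨x, hx0, hx⟩ := exists_hasDerivAt_of_hasCompactSupport hg hgc x₀ hT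
  have h0 : (0 : ℝ) ∈ Ioo (-T) T := ⟨by linarith, hT⟩
  have hsymm : ∀ t ∈ Ioo (-T) T, symmetrize hS (x t) = x t := by
    have hd : ∀ t ∈ Ioo (-T) T, HasDerivAt (fun τ => x τ - symmetrize hS (x τ)) 0 t :=
      fun t ht => by
      have h1 := (hx t ht).sub ((symmetrize hS).hasFDerivAt.comp_hasDerivAt t (hx t ht))
      refine h1.congr_deriv ?_
      simp only [g, map_smul, symmetrize_symmetrize, sub_self]
    intro t ht
    have h1 := isOpen_Ioo.is_const_of_deriv_eq_zero isPreconnected_Ioo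
      (fun τ hτ => (hd τ hτ).differentiableAt.differentiableWithinAt)
      (fun τ hτ => (hd τ hτ).deriv) ht h0
    simp only [hx0] at h1
    rw [(symmetrize_eq_self_iff hS x₀).2 (by rw [hx₀]; exact hα), sub_self, sub_eq_zero] at h1
    exact h1.symm
  let a : ℝ → Mode → ℂ := fun t => extendZero S (x t)
  have hasymm : ∀ t ∈ Ioo (-T) T, ∀ k, a t (-k) = conj (a t k) := fun t ht =>
    (symmetrize_eq_self_iff hS (x t)).1 (hsymm t ht)
  have hzero : ∀ t, ∀ k ∉ S, a t k = 0 := fun t k hk => extendZero_of_notMem _ hk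
  have hfield : ∀ t ∈ Ioo (-T) T, g (x t) = B (x t) • galerkinField (x t) := fun t ht => by
    simp only [g, hsymm t ht]
    congr 1
    rw [symmetrize_eq_self_iff]
    intro k
    by_cases hk : k ∈ S
    · rw [extendZero_of_mem _ hk, extendZero_of_mem _ (hS k hk)]
      exact bil_neg (hasymm t ht) (hasymm t ht) k
    · have hk' : -k ∉ S := fun h' => hk (by simpa using hS _ h')
      rw [extendZero_of_notMem _ hk, extendZero_of_notMem _ hk', map_zero]
  have hderiv : ∀ t ∈ Ioo (-T) T, ∀ k ∈ S,
      HasDerivAt (fun τ => a τ k) (B (x t) * bil (a t) (a t) k) t := fun t ht k hk => by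
    have h1 := hasDerivAt_pi.1 (hx t ht) ⟨k, hk⟩
    rw [hfield t ht] at h1
    simp only [a, extendZero_of_mem _ hk]
    simpa [galerkinField, a, Complex.real_smul] using h1
  -- The cut-off multiplies the field by a real scalar, so it does not spoil the conservation law.
  have hcons : ∀ t ∈ Ioo (-T) T, ∑ k ∈ S, (1 * ‖a t k‖) ^ 2 = ∑ k ∈ S, (1 * ‖a 0 k‖) ^ 2 := by
    have hd : ∀ t ∈ Ioo (-T) T, HasDerivAt (fun τ => ∑ k ∈ S, (1 * ‖a τ k‖) ^ 2) 0 t :=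
      fun t ht => by
      refine (hasDerivAt_sum_weight_normSq S (fun _ => 1) (hderiv t ht)).congr_deriv ?_
      have h1 := re_sum_bil_eq_zero (hasymm t ht) (hzero t)
      simp only [one_pow, Complex.ofReal_one, one_mul, mul_assoc, ← Finset.mul_sum,
        Complex.re_ofReal_mul, h1, mul_zero]
    intro t ht
    exact isOpen_Ioo.is_const_of_deriv_eq_zero isPreconnected_Ioo
      (fun τ hτ => (hd τ hτ).differentiableAt.differentiableWithinAt)
      (fun τ hτ => (hd τ hτ).deriv) ht h0
  have ha0 : a 0 = α := by simp only [a, hx0, hx₀]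
  refine ⟨a, ha0, hzero, fun t ht => ⟨hasymm t ht, fun k hk => ?_⟩⟩
  -- The sup norm is at most the conserved `ℓ²` norm `R`, and the bump equals 1 up to radius `R +
  -- 1`.
  have hB : B (x t) = 1 := by
    refine B.one_of_mem_closedBall ?_
    rw [mem_closedBall_zero_iff, pi_norm_le_iff_of_nonneg (by positivity)]
    intro j
    have h1 : ‖x t j‖ ≤ R := by
      refine Real.le_sqrt_of_sq_le ?_
      rw [← ha0, ← hcons t ht]
      have h2 := Finset.single_le_sum (f := fun k => (1 * ‖a t k‖) ^ 2)
        (fun k _ => sq_nonneg _) j.2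
      simpa [a, extendZero_of_mem _ j.2] using h2
    exact h1.trans (by simp [B])
  have := hderiv t ht k hk
  rwa [hB, Complex.ofReal_one, one_mul] at this

end Galerkin

/-- A quadratic-type differential inequality gives a bound for a time depending only on the
initial size. -/
lemma le_of_abs_deriv_le {E : ℝ → ℝ} {E' : ℝ → ℝ} {C M T : ℝ} (hC : 0 ≤ C) (hT0 : 0 < T)
    (hE : ∀ t ∈ Ioo (-T) T, HasDerivAt E (E' t) t) (hE0 : ∀ t, 0 ≤ E t) (hM : E 0 ≤ M)
    (hle : ∀ t ∈ Ioo (-T) T, |E' t| ≤ 2 * (C * Real.sqrt (E t) * E t))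
    (hT : C * T ≤ 1 / (2 * Real.sqrt (M + 1))) {t : ℝ} (ht : t ∈ Ioo (-T) T) :
    E t ≤ 4 * (M + 1) := by
  have h0 : (0 : ℝ) ∈ Ioo (-T) T := ⟨by linarith, hT0⟩
  have hp : ∀ τ, 0 < E τ + 1 := fun τ => by linarith [hE0 τ]
  -- The inequality `|E'| ≤ 2 C E^(3/2)` says that `(E + 1)^(-1/2)` has slope at most `C`; the added
  -- 1 avoids division by zero. Over time `T` this quantity loses at most half of its guaranteed
  -- initial size.
  have hy : ∀ τ ∈ Ioo (-T) T, HasDerivWithinAt (fun τ => (Real.sqrt (E τ + 1))⁻¹)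
      (-(E' τ / (2 * Real.sqrt (E τ + 1))) / Real.sqrt (E τ + 1) ^ 2) (Ioo (-T) T) τ :=
    fun τ hτ => ((((hE τ hτ).add_const 1).sqrt (hp τ).ne').inv
      (Real.sqrt_pos.2 (hp τ)).ne').hasDerivWithinAt
  have hb : ∀ τ ∈ Ioo (-T) T,
      ‖-(E' τ / (2 * Real.sqrt (E τ + 1))) / Real.sqrt (E τ + 1) ^ 2‖ ≤ C := fun τ hτ => by
    have hs := Real.sqrt_pos.2 (hp τ)
    rw [norm_div, norm_neg, norm_div, Real.norm_eq_abs, Real.norm_of_nonneg (by positivity),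
      Real.norm_of_nonneg (by positivity), div_div, div_le_iff₀ (by positivity)]
    refine (hle τ hτ).trans ?_
    have h1 : Real.sqrt (E τ) ≤ Real.sqrt (E τ + 1) := Real.sqrt_le_sqrt (by linarith)
    have h2 : E τ ≤ Real.sqrt (E τ + 1) ^ 2 := by rw [Real.sq_sqrt (hp τ).le]; linarith
    have h3 : C * Real.sqrt (E τ) * E τ ≤ C * Real.sqrt (E τ + 1) * Real.sqrt (E τ + 1) ^ 2 := by
      gcongr; exact hE0 τ
    linarith
  have h1 := Convex.norm_image_sub_le_of_norm_hasDerivWithin_le hy hb (convex_Ioo _ _) h0 ht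
  have h2 : |t - 0| ≤ T := by rw [sub_zero, abs_le]; exact ⟨ht.1.le, ht.2.le⟩
  have hM1 : 0 < M + 1 := by linarith [hE0 0]
  have hsM := Real.sqrt_pos.2 hM1
  have h3 : (Real.sqrt (M + 1))⁻¹ ≤ (Real.sqrt (E 0 + 1))⁻¹ := by
    have := Real.sqrt_pos.2 (hp 0)
    gcongr
  rw [Real.norm_eq_abs, Real.norm_eq_abs] at h1
  have h4 : C * |t - 0| ≤ C * T := by gcongr
  have h5 : 1 / (2 * Real.sqrt (M + 1)) ≤ (Real.sqrt (E t + 1))⁻¹ := by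
    have h6 := (abs_le.1 h1).1
    have h7 : (Real.sqrt (M + 1))⁻¹ = 2 * (1 / (2 * Real.sqrt (M + 1))) := by
      field_simp
    linarith
  rw [← one_div, one_div_le_one_div (by positivity) (Real.sqrt_pos.2 (hp t))] at h5
  have h8 : E t + 1 ≤ (2 * Real.sqrt (M + 1)) ^ 2 := by
    rw [← Real.sq_sqrt (hp t).le]; gcongr
  rw [mul_pow, Real.sq_sqrt hM1.le] at h8
  linarith

/-- Galerkin approximations with a uniform bound in `H^s`, on a uniform time interval. -/
lemma exists_galerkin_inBall {s : ℝ} (hs : 2 < s) {S : Finset Mode} (hS : ∀ k ∈ S, -k ∈ S)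
    {α : Mode → ℂ} (hα : ∀ k, α (-k) = conj (α k)) {M T : ℝ} (hM : ∀ F : Finset Mode,
      ∑ k ∈ F, (jap k ^ s * ‖α k‖) ^ 2 ≤ M) (hT0 : 0 < T)
    (hT : energyConst s * T ≤ 1 / (2 * Real.sqrt (M + 1))) :
    ∃ a : ℝ → Mode → ℂ, (∀ k ∈ S, a 0 k = α k) ∧ (∀ t, ∀ k ∉ S, a t k = 0) ∧
      ∀ t ∈ Ioo (-T) T, (∀ k, a t (-k) = conj (a t k)) ∧
        InBall s (Real.sqrt (4 * (M + 1))) (a t) ∧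
        ∀ k ∈ S, HasDerivAt (fun τ => a τ k) (bil (a t) (a t) k) t := by
  classical
  obtain ⟨a, ha0, hzero, ha⟩ := exists_galerkin hS (α := fun k => if k ∈ S then α k else 0)
    (fun k => by
      have : -k ∈ S ↔ k ∈ S := ⟨fun h => by simpa using hS _ h, hS k⟩
      by_cases hk : k ∈ S <;> simp [this, hk, hα]) (fun k hk => if_neg hk) hT0
  refine ⟨a, fun k hk => by simp [ha0, hk], hzero, fun t ht => ⟨(ha t ht).1, fun F => ?_, (ha t ht).2⟩⟩
  have hM0 : 0 ≤ M := by simpa using hM ∅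
  rw [Real.sq_sqrt (by positivity)]
  have h1 : ∑ k ∈ F, (jap k ^ s * ‖a t k‖) ^ 2 ≤ ∑ k ∈ S, (jap k ^ s * ‖a t k‖) ^ 2 := by
    have : ∑ k ∈ F, (jap k ^ s * ‖a t k‖) ^ 2 = ∑ k ∈ F ∩ S, (jap k ^ s * ‖a t k‖) ^ 2 := by
      refine (Finset.sum_subset Finset.inter_subset_left fun k hk hk' => ?_).symm
      rw [hzero t k fun h => hk' (Finset.mem_inter.2 ⟨hk, h⟩)]; simp
    rw [this]
    exact Finset.sum_le_sum_of_subset_of_nonneg Finset.inter_subset_right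
      fun k _ _ => sq_nonneg _
  refine h1.trans ?_
  refine le_of_abs_deriv_le (E := fun t => ∑ k ∈ S, (jap k ^ s * ‖a t k‖) ^ 2)
    (energyConst_nonneg (by linarith)) hT0
    (fun τ hτ => hasDerivAt_sum_weight_normSq S (fun k => jap k ^ s) (ha τ hτ).2)
    (fun τ => Finset.sum_nonneg fun k _ => sq_nonneg _) ?_ (fun τ hτ => ?_) hT ht
  · refine le_trans (le_of_eq (Finset.sum_congr rfl fun k hk => ?_)) (hM S)
    simp [ha0, hk]
  · rw [abs_mul, abs_two]
    gcongr
    exact abs_re_sum_weight_bil_le hs (ha τ hτ).1 (hzero τ)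

end IPM

/-! ### Passage to the limit and uniqueness in Fourier variables. -/

namespace IPM

open scoped ComplexConjugate Topology
open Filter

/-- The bilinear term is continuous for pointwise convergence of bounded sequences. -/
lemma tendsto_bil {ι : Type*} {l : Filter ι} {s R : ℝ} (hs : 2 < s) (hR : 0 ≤ R)
    {a : ι → Mode → ℂ} {b : Mode → ℂ} (ha : ∀ᶠ i in l, ∀ k, ‖a i k‖ ≤ R * jap k ^ (-s))
    (h : ∀ k, Tendsto (fun i => a i k) l (𝓝 (b k))) (k : Mode) :
    Tendsto (fun i => bil (a i) (a i) k) l (𝓝 (bil b b k)) := by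
  refine tendsto_tsum_of_dominated_convergence
    (bound := fun p => 2 * jap k * (R * R) * jap p ^ (-s))
    ((summable_jap_rpow hs).mul_left _) (fun p => ((h p).mul (h _)).const_mul _) ?_
  filter_upwards [ha] with i hi p
  refine (norm_bil_term _ _ p k).trans ?_
  have := jap_pos k
  have h1 := jap_rpow_pos (-s) p
  have h2 : ‖a i (k - p)‖ ≤ R :=
    (hi _).trans (mul_le_of_le_one_right hR (jap_rpow_le_one (by linarith) _))
  calc 2 * jap k * (‖a i p‖ * ‖a i (k - p)‖)
      ≤ 2 * jap k * ((R * jap p ^ (-s)) * R) := by gcongr; exact hi p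
    _ = _ := by ring

/-- A trajectory solving the equation for the Fourier coefficients, at the time `t`. -/
structure IsCoeffSolutionAt (s R : ℝ) (a : ℝ → Mode → ℂ) (t : ℝ) : Prop where
  symm : ∀ k, a t (-k) = conj (a t k)
  inBall : InBall s R (a t)
  hasDerivAt : ∀ k, HasDerivAt (fun τ => a τ k) (bil (a t) (a t) k) t

/-- The second order Taylor estimate for solutions in a ball. -/
lemma norm_sub_sub_le_of_hasDerivAt {s R T : ℝ} (hs : 2 < s) (hR : 0 ≤ R) {a : ℝ → Mode → ℂ}
    {S : Finset Mode} (hzero : ∀ t, ∀ k ∉ S, a t k = 0)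
    (hball : ∀ t ∈ Ioo (-T) T, InBall s R (a t))
    (hd : ∀ t ∈ Ioo (-T) T, ∀ k ∈ S, HasDerivAt (fun τ => a τ k) (bil (a t) (a t) k) t)
    {k : Mode} (hk : k ∈ S) {t t' : ℝ} (ht : t ∈ Ioo (-T) T) (ht' : t' ∈ Ioo (-T) T) :
    ‖a t k - a t' k - (t - t') * bil (a t') (a t') k‖ ≤
      (4 * jap k * (R * japSum s) * (4 * 2 ^ s * (R * R * japSum s))) * |t - t'| ^ 2 := by
  have hJ := japSum_nonneg s
  have hjk := jap_pos k
  have hb : ∀ τ ∈ Ioo (-T) T, ∀ k, ‖a τ k‖ ≤ R * jap k ^ (-s) :=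
    fun τ hτ => (hball τ hτ).norm_le hR
  set C := 4 * 2 ^ s * (R * R * japSum s) with hC
  have hC0 : 0 ≤ C := by positivity
  -- One Lipschitz constant serves every mode, because the bound on `bil` decays like `⟨k⟩^(1-s) ≤
  -- 1`. All modes are needed, since a single mode of `bil` involves all of them.
  have hlip : ∀ τ ∈ Ioo (-T) T, ∀ k, ‖a τ k - a t' k‖ ≤ C * |τ - t'| := fun τ hτ k => by
    by_cases hk : k ∈ S
    · refine Convex.norm_image_sub_le_of_norm_hasDerivWithin_le
        (fun σ hσ => (hd σ hσ k hk).hasDerivWithinAt) (fun σ hσ => ?_) (convex_Ioo _ _) ht' hτ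
      refine (norm_bil_le_rpow hs (hb σ hσ) (hb σ hσ) k).trans ?_
      exact mul_le_of_le_one_right hC0 (jap_rpow_le_one (by linarith) k)
    · rw [hzero _ k hk, hzero _ k hk, sub_zero, norm_zero]; positivity
  have hsub : uIcc t' t ⊆ Ioo (-T) T := ordConnected_Ioo.uIcc_subset ht' ht
  -- After subtracting the linear part at `t'`, the derivative is a difference of nonlinearities,
  -- hence of size `|τ - t'|`; the mean value inequality gives a quadratic remainder.
  have h1 := Convex.norm_image_sub_le_of_norm_hasDerivWithin_le (s := uIcc t' t)
    (f := fun τ => a τ k - (τ : ℂ) * bil (a t') (a t') k)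
    (f' := fun τ => bil (a τ) (a τ) k - bil (a t') (a t') k)
    (C := (4 * jap k * (R * japSum s) * C) * |t - t'|)
    (fun τ hτ => by
      have h2 := (hd τ (hsub hτ) k hk).sub
        ((HasDerivAt.ofReal_comp (hasDerivAt_id τ)).mul_const (bil (a t') (a t') k))
      simp only [id_eq, Complex.ofReal_one, one_mul] at h2
      exact h2.hasDerivWithinAt)
    (fun τ hτ => by
      refine (norm_bil_self_sub_le hs (hb τ (hsub hτ)) (hb t' ht') (hlip τ (hsub hτ)) k).trans ?_
      rw [mul_assoc (4 * jap k * (R * japSum s))]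
      exact mul_le_mul_of_nonneg_left (mul_le_mul_of_nonneg_left (abs_sub_left_of_mem_uIcc hτ) hC0)
        (by positivity))
    (convex_uIcc _ _) left_mem_uIcc right_mem_uIcc
  calc _ = ‖a t k - (t : ℂ) * bil (a t') (a t') k - (a t' k - (t' : ℂ) * bil (a t') (a t') k)‖ := by
        congr 1; ring
    _ ≤ _ := h1
    _ = _ := by rw [Real.norm_eq_abs]; ring

/-- Local existence for the equation of the Fourier coefficients. -/
theorem exists_isCoeffSolutionAt {s : ℝ} (hs : 2 < s) {α : Mode → ℂ}
    (hα : ∀ k, α (-k) = conj (α k)) (hsum : Summable fun k => (jap k ^ s * ‖α k‖) ^ 2) :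
    ∃ T R : ℝ, 0 < T ∧ 0 ≤ R ∧ ∃ a : ℝ → Mode → ℂ, a 0 = α ∧
      ∀ t ∈ Ioo (-T) T, IsCoeffSolutionAt s R a t := by
  set M := ∑' k, (jap k ^ s * ‖α k‖) ^ 2 with hM
  have hM0 : 0 ≤ M := tsum_nonneg fun k => sq_nonneg _
  have hMF : ∀ F : Finset Mode, ∑ k ∈ F, (jap k ^ s * ‖α k‖) ^ 2 ≤ M := fun F =>
    hsum.sum_le_tsum F fun k _ => sq_nonneg _
  -- This is the time allowed by `le_of_abs_deriv_le`; the added 1 in the denominator covers a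
  -- vanishing energy constant.
  set T := 1 / (2 * Real.sqrt (M + 1)) / (energyConst s + 1) with hTdef
  have hC := energyConst_nonneg (by linarith : 0 ≤ s)
  have hT0 : 0 < T := by positivity
  have hT : energyConst s * T ≤ 1 / (2 * Real.sqrt (M + 1)) := by
    rw [hTdef, mul_div_assoc', div_le_iff₀ (by positivity), mul_comm]
    gcongr
    linarith
  set R := Real.sqrt (4 * (M + 1)) with hRdef
  have hR : 0 ≤ R := Real.sqrt_nonneg _
  let S : ℕ → Finset Mode := fun N => Finset.Icc (fun _ => -(N : ℤ)) (fun _ => (N : ℤ))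
  have hSneg : ∀ N, ∀ k ∈ S N, -k ∈ S N := fun N k hk => by
    simp only [S, Finset.mem_Icc, Pi.le_def, Pi.neg_apply] at hk ⊢
    exact ⟨fun i => neg_le_neg (hk.2 i), fun i => neg_le.1 (hk.1 i)⟩
  have hSev : ∀ k : Mode, ∀ᶠ N in (hyperfilter ℕ : Filter ℕ), k ∈ S N := fun k => by
    refine Nat.hyperfilter_le_atTop ?_
    have : ∀ᶠ N : ℕ in atTop, ∀ i : Fin 2, |k i| ≤ (N : ℤ) := by
      rw [eventually_all]
      intro i
      filter_upwards [eventually_ge_atTop (k i).natAbs] with N hN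
      rw [abs_le]
      omega
    filter_upwards [this] with N hN
    simp only [S, Finset.mem_Icc, Pi.le_def]
    exact ⟨fun i => (abs_le.1 (hN i)).1, fun i => (abs_le.1 (hN i)).2⟩
  choose A hA0 hAzero hA using fun N => exists_galerkin_inBall hs (hSneg N) hα hMF hT0 hT
  have hAb : ∀ N, ∀ t ∈ Ioo (-T) T, ∀ k, ‖A N t k‖ ≤ R * jap k ^ (-s) := fun N t ht =>
    (hA N t ht).2.1.norm_le hR
  -- Each mode stays in a compact disc, so it has a limit along a fixed ultrafilter for all times
  -- and modes simultaneously, with no extraction of subsequences. Outside the time interval the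
  -- value 0 is arbitrary.
  have hex : ∀ t k, ∃ z : ℂ, t ∈ Ioo (-T) T →
      Tendsto (fun N => A N t k) (hyperfilter ℕ) (𝓝 z) := fun t k => by
    by_cases ht : t ∈ Ioo (-T) T
    · have hcomp := isCompact_closedBall (0 : ℂ) (R * jap k ^ (-s))
      obtain ⟨z, -, hz⟩ := hcomp.ultrafilter_le_nhds ((hyperfilter ℕ).map fun N => A N t k)
        (show Tendsto (fun N => A N t k) (hyperfilter ℕ) _ from tendsto_principal.2
          (Eventually.of_forall fun N => mem_closedBall_zero_iff.2 (hAb N t ht k)))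
      exact ⟨z, fun _ => hz⟩
    · exact ⟨0, fun h => absurd h ht⟩
  choose a ha using hex
  have hball : ∀ t ∈ Ioo (-T) T, InBall s R (a t) := fun t ht F =>
    le_of_tendsto (tendsto_finsetSum F fun k _ => (((ha t k ht).norm).const_mul _).pow 2)
      (Eventually.of_forall fun N => (hA N t ht).2.1 F)
  have h0 : (0 : ℝ) ∈ Ioo (-T) T := ⟨by linarith, hT0⟩
  refine ⟨T, R, hT0, hR, a, ?_, fun t ht => ⟨fun k => ?_, hball t ht, fun k => ?_⟩⟩
  · ext k
    refine tendsto_nhds_unique (ha 0 k h0) (tendsto_const_nhds.congr' ?_)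
    filter_upwards [hSev k] with N hN
    exact (hA0 N k hN).symm
  · refine tendsto_nhds_unique (ha t (-k) ht) ?_
    refine ((Complex.continuous_conj.tendsto _).comp (ha t k ht)).congr fun N => ?_
    exact ((hA N t ht).1 k).symm
  · set C := 4 * jap k * (R * japSum s) * (4 * 2 ^ s * (R * R * japSum s)) with hCdef
    -- The Taylor remainder has a constant independent of `N`, so the estimate survives pointwise
    -- limits and yields the derivative of the limit directly.
    have hest : ∀ τ ∈ Ioo (-T) T, ‖a τ k - a t k - (τ - t) * bil (a t) (a t) k‖ ≤
        C * |τ - t| ^ 2 := fun τ hτ => by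
      refine le_of_tendsto (((ha τ k hτ).sub (ha t k ht)).sub
        ((tendsto_bil hs hR (Eventually.of_forall fun N => hAb N t ht)
          (fun p => ha t p ht) k).const_mul _)).norm ?_
      filter_upwards [hSev k] with N hN
      exact norm_sub_sub_le_of_hasDerivAt hs hR (hAzero N) (fun τ hτ => (hA N τ hτ).2.1)
        (fun τ hτ => (hA N τ hτ).2.2) hN hτ ht
    rw [hasDerivAt_iff_isLittleO]
    have hO : (fun τ => a τ k - a t k - (τ - t) • bil (a t) (a t) k) =O[𝓝 t]
        fun τ => (τ - t) ^ 2 := by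
      refine Asymptotics.IsBigO.of_bound C ?_
      filter_upwards [Ioo_mem_nhds ht.1 ht.2] with τ hτ
      rw [Complex.real_smul, norm_pow, Real.norm_eq_abs]
      push_cast
      exact hest τ hτ
    refine hO.trans_isLittleO ?_
    have h2 : (fun τ : ℝ => (τ - t) ^ 2) = fun τ => (τ - t) * (τ - t) := by ext; ring
    rw [h2]
    refine (Asymptotics.isLittleO_one_iff ℝ |>.2 ?_).mul_isBigO (Asymptotics.isBigO_refl _ _)
      |>.congr_right fun τ => one_mul _
    have : Tendsto (fun τ : ℝ => τ - t) (𝓝 t) (𝓝 (t - t)) := tendsto_id.sub_const t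
    rwa [sub_self] at this

/-- Uniqueness for the equation of the Fourier coefficients. -/
theorem eq_of_isCoeffSolutionAt {s R T : ℝ} (hs : 2 < s) (hR : 0 ≤ R) {a b : ℝ → Mode → ℂ}
    (ha : ∀ t ∈ Ioo 0 T, IsCoeffSolutionAt s R a t) (hb : ∀ t ∈ Ioo 0 T, IsCoeffSolutionAt s R b t)
    (hac : ∀ k, ContinuousOn (fun t => a t k) (Ico 0 T))
    (hbc : ∀ k, ContinuousOn (fun t => b t k) (Ico 0 T)) (h0 : a 0 = b 0)
    (h0ball : InBall s R (a 0)) {t : ℝ} (ht : t ∈ Ioo 0 T) : a t = b t := by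
  have hT : 0 < T := ht.1.trans ht.2
  have hA : ∀ t ∈ Ico 0 T, InBall s R (a t) := fun t ht => by
    rcases ht.1.eq_or_lt with h | h
    · rwa [← h]
    · exact (ha t ⟨h, ht.2⟩).inBall
  have hB : ∀ t ∈ Ico 0 T, InBall s R (b t) := fun t ht => by
    rcases ht.1.eq_or_lt with h | h
    · rwa [← h, ← h0]
    · exact (hb t ⟨h, ht.2⟩).inBall
  have hd : ∀ t ∈ Ico 0 T, ∀ k, ‖a t k - b t k‖ ≤ 2 * R * jap k ^ (-s) := fun t ht k => by
    refine (norm_sub_le _ _).trans ?_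
    have := (hA t ht).norm_le hR k
    have := (hB t ht).norm_le hR k
    linarith
  set C := 4 * 2 ^ s * (R * R * japSum s) with hC
  have hC0 : 0 ≤ C := by have := japSum_nonneg s; positivity
  have hbil : ∀ t ∈ Ioo 0 T, ∀ k, ‖bil (a t) (a t) k - bil (b t) (b t) k‖ ≤
      2 * C * jap k ^ (1 - s) := fun t ht k => by
    refine (norm_sub_le _ _).trans ?_
    have h1 := (hA t (Ioo_subset_Ico_self ht)).norm_le hR
    have h2 := (hB t (Ioo_subset_Ico_self ht)).norm_le hR
    have := norm_bil_le_rpow hs h1 h1 k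
    have := norm_bil_le_rpow hs h2 h2 k
    linarith
  let E : ℝ → ℝ := fun t => ∑' k, ‖a t k - b t k‖ ^ 2
  let e' : Mode → ℝ → ℝ := fun k t =>
    2 * ((bil (a t) (a t) k - bil (b t) (b t) k) * conj (a t k - b t k)).re
  have hder : ∀ k, ∀ t ∈ Ioo 0 T, HasDerivAt (fun t => ‖a t k - b t k‖ ^ 2) (e' k t) t :=
    fun k t ht => by
    refine (((ha t ht).hasDerivAt k).sub ((hb t ht).hasDerivAt k)).norm_sq.congr_deriv ?_
    rw [Complex.inner, Pi.sub_apply]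
  have hsq : ∀ t ∈ Ico 0 T, ∀ k, ‖‖a t k - b t k‖ ^ 2‖ ≤ (2 * R) ^ 2 * jap k ^ (-(2 * s)) :=
    fun t ht k => by
    have h1 : jap k ^ (-(2 * s)) = (jap k ^ (-s)) ^ 2 := by
      rw [← Real.rpow_natCast, ← Real.rpow_mul (jap_pos k).le]; congr 1; push_cast; ring
    rw [Real.norm_of_nonneg (sq_nonneg _), h1, ← mul_pow]
    gcongr
    exact hd t ht k
  have hsumsq : Summable fun k : Mode => (2 * R) ^ 2 * jap k ^ (-(2 * s)) :=
    (summable_jap_rpow (by linarith)).mul_left _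
  have hEc : ContinuousOn E (Ico 0 T) :=
    continuousOn_tsum (fun k => ((hac k).sub (hbc k)).norm.pow 2) hsumsq fun k t ht => hsq t ht k
  -- Decay `⟨k⟩^(1-s)` for the difference of nonlinearities and `⟨k⟩^(-s)` for that of the solutions
  -- give a summable bound uniform in time, as `2s - 1 > 2`; hence `E` may be differentiated term by
  -- term.
  have hprod : ∀ t ∈ Ioo 0 T, ∀ k,
      ‖(bil (a t) (a t) k - bil (b t) (b t) k) * conj (a t k - b t k)‖ ≤
        (2 * C * (2 * R)) * jap k ^ (-(2 * s - 1)) := fun t ht k => by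
    have h1 : jap k ^ (-(2 * s - 1)) = jap k ^ (1 - s) * jap k ^ (-s) := by
      rw [← Real.rpow_add (jap_pos k)]; congr 1; ring
    rw [norm_mul, RCLike.norm_conj, h1]
    refine (mul_le_mul (hbil t ht k) (hd t (Ioo_subset_Ico_self ht) k) (norm_nonneg _)
      (mul_nonneg (by positivity) (jap_rpow_pos _ k).le)).trans (le_of_eq (by ring))
  have hsum1 : Summable fun k : Mode => (2 * C * (2 * R)) * jap k ^ (-(2 * s - 1)) :=
    (summable_jap_rpow (by linarith)).mul_left _
  have hEd : ∀ t ∈ Ioo 0 T, HasDerivAt E (∑' k, e' k t) t := fun t ht => by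
    refine hasDerivAt_tsum_of_isPreconnected (hsum1.mul_left 2) isOpen_Ioo isPreconnected_Ioo
      hder (fun k τ hτ => ?_) ht
      (Summable.of_norm_bounded hsumsq (hsq t (Ioo_subset_Ico_self ht))) ht
    rw [norm_mul, Real.norm_ofNat]
    gcongr
    exact (Complex.abs_re_le_norm _).trans (hprod τ hτ k)
  set L := 4 * (wienerConst s * R) with hL
  have hle : ∀ t ∈ Ioo 0 T, ∑' k, e' k t ≤ L * E t := fun t ht => by
    have h1 := abs_re_tsum_bil_sub_le hs hR (ha t ht).inBall (hb t ht).inBall (hb t ht).symm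
    have h2 : Summable fun k => (bil (a t) (a t) k - bil (b t) (b t) k) * conj (a t k - b t k) :=
      Summable.of_norm_bounded hsum1 (hprod t ht)
    have h3 : ∑' k, e' k t = 2 * (∑' k,
        (bil (a t) (a t) k - bil (b t) (b t) k) * conj (a t k - b t k)).re := by
      rw [Complex.re_tsum h2, tsum_mul_left]
    rw [h3]
    have := (le_abs_self _).trans h1
    simp only [E]
    linarith
  -- Grönwall's argument. Continuity on `[0, T)` brings in the common datum, although the equation
  -- is used only on `(0, T)`.
  have hanti : AntitoneOn (fun t => E t * Real.exp (-L * t)) (Ico 0 T) := by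
    have hD : ∀ t ∈ Ioo 0 T, HasDerivAt (fun t => E t * Real.exp (-L * t))
        ((∑' k, e' k t) * Real.exp (-L * t) + E t * (Real.exp (-L * t) * (-L))) t := fun t ht => by
      refine (hEd t ht).mul ?_
      simpa using ((hasDerivAt_id t).const_mul (-L)).exp
    refine antitoneOn_of_deriv_nonpos (convex_Ico 0 T) ?_ ?_ ?_
    · exact hEc.mul (by fun_prop)
    · rw [interior_Ico]
      exact fun t ht => (hD t ht).differentiableAt.differentiableWithinAt
    · rw [interior_Ico]
      intro t ht
      rw [(hD t ht).deriv]
      have := mul_le_mul_of_nonneg_right (hle t ht) (Real.exp_pos (-L * t)).le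
      linarith
  have h1 := hanti ⟨le_rfl, hT⟩ (Ioo_subset_Ico_self ht) ht.1.le
  have hE0 : E 0 = 0 := by simp [E, h0]
  simp only [hE0, zero_mul] at h1
  have h2 : E t ≤ 0 := nonpos_of_mul_nonpos_left h1 (Real.exp_pos _)
  ext k
  have hs2 : Summable fun k => ‖a t k - b t k‖ ^ 2 :=
    Summable.of_norm_bounded hsumsq (hsq t (Ioo_subset_Ico_self ht))
  have h3 := hs2.le_tsum k fun _ _ => sq_nonneg _
  have h4 : ‖a t k - b t k‖ ^ 2 = 0 := le_antisymm (h3.trans h2) (sq_nonneg _)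
  exact sub_eq_zero.1 (norm_eq_zero.1 (pow_eq_zero_iff two_ne_zero |>.1 h4))

end IPM

namespace IPM

open scoped ComplexConjugate Topology
open Filter

/-! ### Characters of the torus -/

/-- The character `x ↦ e^{i k·x}`. -/
noncomputable def char (k : Mode) : C(Torus, ℂ) where
  toFun x := ∏ i, fourier (k i) (x i)
  continuous_toFun := by fun_prop

lemma char_apply (k : Mode) (x : Torus) : char k x = ∏ i, fourier (k i) (x i) := rfl

lemma char_neg (k : Mode) (x : Torus) : char (-k) x = conj (char k x) := by
  simp only [char_apply, Pi.neg_apply, fourier_neg, map_prod]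

lemma char_add (k l : Mode) (x : Torus) : char (k + l) x = char k x * char l x := by
  simp only [char_apply, Pi.add_apply, fourier_add, Finset.prod_mul_distrib]

lemma char_zero : char 0 = 1 := by
  ext x; simp [char_apply]

lemma norm_char (k : Mode) (x : Torus) : ‖char k x‖ = 1 := by
  rw [char_apply, norm_prod]
  exact Finset.prod_eq_one fun i _ => Circle.norm_coe _

lemma char_proj (k : Mode) (y : Fin 2 → ℝ) :
    char k (proj y) = Complex.exp (Complex.I * ∑ i, (k i : ℂ) * y i) := by
  rw [Finset.mul_sum, Complex.exp_sum, char_apply]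
  refine Finset.prod_congr rfl fun i _ => ?_
  rw [proj, fourier_coe_apply]
  congr 1
  have := Real.pi_ne_zero
  push_cast
  field_simp

lemma integral_char (k : Mode) :
    ∫ x : Torus, char k x = if k = 0 then ((2 * π) ^ 2 : ℝ) else 0 := by
  have h1 : ∀ n : ℤ, ∫ x : AddCircle (2 * π), fourier n x = if n = 0 then ((2 * π : ℝ) : ℂ) else 0 := by
    intro n
    split_ifs with h
    · subst h
      simp [measureReal_def, AddCircle.measure_univ, Real.pi_pos.le]
    · have h2 := integral_eq_zero_of_add_right_eq_neg (μ := (volume : Measure (AddCircle (2 * π))))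
        (fourier_add_half_inv_index (T := 2 * π) h Real.two_pi_pos)
      exact h2
  simp only [char_apply]
  rw [integral_fintype_prod_volume_eq_prod (fun i x => (fourier (k i) x : ℂ)), Fin.prod_univ_two,
    h1, h1]
  by_cases h : k = 0
  · simp [h]; ring
  · rw [if_neg h]
    have : k 0 ≠ 0 ∨ k 1 ≠ 0 := by
      by_contra! hc
      exact h (by ext i; fin_cases i <;> simp [hc.1, hc.2])
    rcases this with h' | h' <;> simp [h']

lemma coeff_eq (f : Torus → ℝ) (k : Mode) :
    coeff f k = (1 / (2 * π) ^ 2 : ℝ) * ∫ x, (f x : ℂ) * char (-k) x := rfl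

lemma integral_mul_char_neg (f : Torus → ℝ) (k : Mode) :
    ∫ x, (f x : ℂ) * char (-k) x = ((2 * π) ^ 2 : ℝ) * coeff f k := by
  rw [coeff_eq, ← mul_assoc, ← Complex.ofReal_mul, mul_one_div_cancel (by positivity)]
  simp

lemma coeff_neg (f : Torus → ℝ) (k : Mode) : coeff f (-k) = conj (coeff f k) := by
  rw [coeff_eq, coeff_eq, map_mul, Complex.conj_ofReal, ← integral_conj]
  congr 2
  ext x
  rw [map_mul, Complex.conj_ofReal, ← char_neg]

lemma integral_eq_coeff_zero (f : Torus → ℝ) :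
    ((∫ x, f x : ℝ) : ℂ) = ((2 * π) ^ 2 : ℝ) * coeff f 0 := by
  rw [← integral_mul_char_neg, neg_zero, char_zero]
  simp only [ContinuousMap.one_apply, mul_one]
  exact integral_complex_ofReal.symm

/-! ### Absolutely convergent Fourier series -/

/-- The sum of a Fourier series. -/
noncomputable def trig (c : Mode → ℂ) (x : Torus) : ℂ := ∑' k, c k * char k x

lemma norm_mul_char (c : Mode → ℂ) (k : Mode) (x : Torus) : ‖c k * char k x‖ = ‖c k‖ := by
  rw [norm_mul, norm_char, mul_one]

lemma summable_mul_char {c : Mode → ℂ} (hc : Summable fun k => ‖c k‖) (x : Torus) :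
    Summable fun k => c k * char k x :=
  Summable.of_norm (by simpa only [norm_mul_char] using hc)

lemma continuous_trig {c : Mode → ℂ} (hc : Summable fun k => ‖c k‖) : Continuous (trig c) :=
  continuous_tsum (fun k => continuous_const.mul (char k).continuous) hc
    fun k x => (norm_mul_char c k x).le

lemma conj_trig {c : Mode → ℂ} (hc : ∀ k, c (-k) = conj (c k)) (x : Torus) :
    conj (trig c x) = trig c x := by
  rw [trig, Complex.conj_tsum, ← (Equiv.neg Mode).tsum_eq]
  refine tsum_congr fun k => ?_
  simp only [Equiv.neg_apply, map_mul, hc, char_neg, Complex.conj_conj]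

lemma ofReal_re_trig {c : Mode → ℂ} (hc : ∀ k, c (-k) = conj (c k)) (x : Torus) :
    ((trig c x).re : ℂ) = trig c x := Complex.conj_eq_iff_re.1 (conj_trig hc x)

/-- Absolute convergence permits termwise integration, and orthogonality of the characters keeps one
term. The symmetry of `c` makes the sum real, so taking the real part loses nothing. -/
lemma coeff_re_trig {c : Mode → ℂ} (hc : Summable fun k => ‖c k‖)
    (hsymm : ∀ k, c (-k) = conj (c k)) (k : Mode) : coeff (fun x => (trig c x).re) k = c k := by
  have h1 : ∫ x, ((trig c x).re : ℂ) * char (-k) x = ((2 * π) ^ 2 : ℝ) * c k := by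
    have h2 : ∀ x, ((trig c x).re : ℂ) * char (-k) x = ∑' l, c l * char (l - k) x := fun x => by
      rw [ofReal_re_trig hsymm, trig, ← tsum_mul_right]
      refine tsum_congr fun l => ?_
      rw [sub_eq_add_neg, char_add, mul_assoc]
    simp_rw [h2]
    rw [← integral_tsum_of_summable_integral_norm]
    · rw [tsum_eq_single k]
      · rw [sub_self, integral_const_mul, integral_char, if_pos rfl, mul_comm]
      · intro l hl
        rw [integral_const_mul, integral_char, if_neg (sub_ne_zero.2 hl), Complex.ofReal_zero, mul_zero]
    · exact fun l => (continuous_const.mul (char _).continuous).integrable_of_hasCompactSupport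
        (HasCompactSupport.of_compactSpace _)
    · simp only [norm_mul, norm_char, mul_one, integral_const, smul_eq_mul]
      exact hc.mul_left _
  rw [coeff_eq, h1, ← mul_assoc, ← Complex.ofReal_mul, one_div_mul_cancel (by positivity)]
  simp

/-- The convolution of absolutely summable sequences is that of the product of the functions. -/
lemma trig_mul_trig {c d : Mode → ℂ} (hc : Summable fun k => ‖c k‖)
    (hd : Summable fun k => ‖d k‖) (x : Torus) :
    trig c x * trig d x = trig (fun k => ∑' p, c p * d (k - p)) x := by
  have h0 : Summable fun y : Mode × Mode => (c y.1 * char y.1 x) * (d y.2 * char y.2 x) :=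
    summable_mul_of_summable_norm (f := fun k => c k * char k x) (g := fun k => d k * char k x)
      (by simpa only [norm_mul_char] using hc)
      (by simpa only [norm_mul_char] using hd)
  have h1 := shearEquiv.summable_iff.2 h0
  have h2 : trig c x * trig d x =
      ∑' y : Mode × Mode, (c y.1 * char y.1 x) * (d y.2 * char y.2 x) :=
    tsum_mul_tsum_of_summable_norm (f := fun k => c k * char k x) (g := fun k => d k * char k x)
      (by simpa only [norm_mul_char] using hc) (by simpa only [norm_mul_char] using hd)
  rw [h2, ← shearEquiv.tsum_eq]
  simp only [shearEquiv, Equiv.coe_fn_mk, Function.comp_def] at h1 ⊢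
  rw [tsum_prod_swap h1, trig]
  refine tsum_congr fun k => ?_
  rw [← tsum_mul_right]
  refine tsum_congr fun p => ?_
  have h2 : char k x = char p x * char (k - p) x := by rw [← char_add, add_sub_cancel]
  rw [h2]
  ring

lemma summable_norm_conv {c d : Mode → ℂ} (hc : Summable fun k => ‖c k‖)
    (hd : Summable fun k => ‖d k‖) :
    (∀ k, Summable fun p => c p * d (k - p)) ∧
    (Summable fun k => ‖∑' p, c p * d (k - p)‖) ∧
      ∑' k, ‖∑' p, c p * d (k - p)‖ ≤ (∑' k, ‖c k‖) * ∑' k, ‖d k‖ := by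
  have h0 : Summable fun y : Mode × Mode => ‖c y.1‖ * ‖d y.2‖ :=
    hc.mul_of_nonneg hd (fun k => norm_nonneg _) fun k => norm_nonneg _
  have h1 : Summable fun y : Mode × Mode => ‖c y.1‖ * ‖d (y.2 - y.1)‖ :=
    shearEquiv.summable_iff.2 h0
  have h2 := (Equiv.prodComm Mode Mode).summable_iff.2 h1
  have h3 : ∀ k, Summable fun p => ‖c p‖ * ‖d (k - p)‖ := fun k => h2.prod_factor k
  have h4 : ∀ k, Summable fun p => ‖c p * d (k - p)‖ := fun k => by
    simpa only [norm_mul] using h3 k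
  have h5 : ∀ k, ‖∑' p, c p * d (k - p)‖ ≤ ∑' p, ‖c p‖ * ‖d (k - p)‖ := fun k => by
    simpa only [norm_mul] using norm_tsum_le_tsum_norm (h4 k)
  have h6 : Summable fun k => ∑' p, ‖c p‖ * ‖d (k - p)‖ := h2.prod
  have h7 : Summable fun k => ‖∑' p, c p * d (k - p)‖ :=
    Summable.of_nonneg_of_le (fun k => norm_nonneg _) h5 h6
  refine ⟨fun k => (h4 k).of_norm, h7, (h7.tsum_le_tsum h5 h6).trans (le_of_eq ?_)⟩
  rw [← tsum_prod_swap (f := fun y : Mode × Mode => ‖c y.1‖ * ‖d (y.2 - y.1)‖) h1,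
    hc.tsum_mul_tsum hd h0]
  exact shearEquiv.tsum_eq fun y : Mode × Mode => ‖c y.1‖ * ‖d y.2‖

/-! ### Differentiation of Fourier series -/

/-- The differential of `y ↦ i k·y`. -/
noncomputable def phaseCLM (k : Mode) : (Fin 2 → ℝ) →L[ℝ] ℂ :=
  ∑ i, (ContinuousLinearMap.proj (R := ℝ) (φ := fun _ : Fin 2 => ℝ) i).smulRight
    (Complex.I * (k i : ℂ))

lemma phaseCLM_apply (k : Mode) (y : Fin 2 → ℝ) :
    phaseCLM k y = Complex.I * ∑ i, (k i : ℂ) * y i := by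
  simp [phaseCLM, Fin.sum_univ_two, Complex.real_smul]
  ring

lemma norm_phaseCLM_le (k : Mode) : ‖phaseCLM k‖ ≤ 2 * jap k := by
  have := jap_pos k
  refine ContinuousLinearMap.opNorm_le_bound _ (by positivity) fun y => ?_
  rw [phaseCLM_apply, norm_mul, Complex.norm_I, one_mul, Fin.sum_univ_two]
  refine (norm_add_le _ _).trans ?_
  have h : ∀ i, ‖(k i : ℂ) * y i‖ ≤ jap k * ‖y‖ := fun i => by
    rw [norm_mul, Complex.norm_intCast, Complex.norm_real]
    exact mul_le_mul (abs_coord_le_jap k i) (norm_le_pi_norm y i) (norm_nonneg _) this.le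
  linarith [h 0, h 1]

lemma hasFDerivAt_char_proj (k : Mode) (y : Fin 2 → ℝ) :
    HasFDerivAt (fun z => char k (proj z)) (char k (proj y) • phaseCLM k) y := by
  have h : (fun z => char k (proj z)) = fun z => Complex.exp (phaseCLM k z) := by
    ext z; rw [char_proj, phaseCLM_apply]
  rw [h]
  have h2 := (phaseCLM k).hasFDerivAt (x := y) |>.cexp
  rwa [char_proj, ← phaseCLM_apply]

/-- The Fourier coefficients of `∂_j f`. -/
noncomputable def dcoef (j : Fin 2) (c : Mode → ℂ) (k : Mode) : ℂ := Complex.I * (k j : ℂ) * c k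

lemma norm_dcoef_le (j : Fin 2) (c : Mode → ℂ) (k : Mode) : ‖dcoef j c k‖ ≤ jap k * ‖c k‖ := by
  rw [dcoef, norm_mul, norm_mul, Complex.norm_I, one_mul, Complex.norm_intCast]
  gcongr
  exact abs_coord_le_jap k j

lemma dcoef_neg {c : Mode → ℂ} (hc : ∀ k, c (-k) = conj (c k)) (j : Fin 2) (k : Mode) :
    dcoef j c (-k) = conj (dcoef j c k) := by
  simp [dcoef, hc]

lemma hasFDerivAt_trig_proj {c : Mode → ℂ} (hc : Summable fun k => jap k * ‖c k‖)
    (y : Fin 2 → ℝ) :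
    HasFDerivAt (fun z => trig c (proj z))
      (∑ j, (ContinuousLinearMap.proj (R := ℝ) (φ := fun _ : Fin 2 => ℝ) j).smulRight
        (trig (dcoef j c) (proj y))) y := by
  have hc' : Summable fun k => ‖c k‖ := Summable.of_nonneg_of_le (fun k => norm_nonneg _)
    (fun k => le_mul_of_one_le_left (norm_nonneg _) (one_le_jap k)) hc
  have hb : ∀ k z, ‖c k • (char k (proj z) • phaseCLM k)‖ ≤ 2 * (jap k * ‖c k‖) := fun k z => by
    rw [norm_smul, norm_smul, norm_char, one_mul]
    have := mul_le_mul_of_nonneg_left (norm_phaseCLM_le k) (norm_nonneg (c k))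
    linarith
  have h := hasFDerivAt_tsum (hc.mul_left 2)
    (fun k z => (hasFDerivAt_char_proj k z).const_mul (c k)) hb
    (summable_mul_char hc' (proj y)) y
  refine h.congr_fderiv ?_
  ext z
  have hs : Summable fun k => c k • (char k (proj y) • phaseCLM k) :=
    Summable.of_norm_bounded (hc.mul_left 2) (fun k => hb k y)
  have hd : ∀ j, Summable fun k => dcoef j c k * char k (proj y) := fun j =>
    summable_mul_char (Summable.of_nonneg_of_le (fun k => norm_nonneg _) (norm_dcoef_le j c) hc) _
  have h1 : (∑' k, c k • (char k (proj y) • phaseCLM k)) z =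
      ∑' k, (c k • (char k (proj y) • phaseCLM k)) z :=
    (ContinuousLinearMap.apply ℝ ℂ z).map_tsum hs
  rw [h1, sum_apply, Fin.sum_univ_two]
  simp only [ContinuousLinearMap.smulRight_apply, ContinuousLinearMap.proj_apply,
    Complex.real_smul]
  rw [trig, trig, ← tsum_mul_left, ← tsum_mul_left,
    ← ((hd 0).mul_left _).tsum_add ((hd 1).mul_left _)]
  refine tsum_congr fun k => ?_
  simp only [smul_apply, phaseCLM_apply, smul_eq_mul, Fin.sum_univ_two, dcoef]
  ring

lemma proj_surjective : Function.Surjective proj := fun x => by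
  choose y hy using fun i => QuotientAddGroup.mk_surjective (x i)
  exact ⟨y, funext hy⟩

lemma proj_add (y z : Fin 2 → ℝ) : proj (y + z) = proj y + proj z := rfl

lemma proj_single (j : Fin 2) (h : ℝ) : proj (Pi.single j h) = Pi.single j (h : AddCircle (2 * π)) := by
  ext i
  by_cases hi : i = j
  · subst hi; simp [proj]
  · simp [proj, Pi.single_eq_of_ne hi]

lemma continuous_proj : Continuous proj :=
  continuous_pi fun i => continuous_quotient_mk'.comp (continuous_apply i)

lemma isOpenQuotientMap_proj : IsOpenQuotientMap proj :=
  IsOpenQuotientMap.piMap fun _ => QuotientAddGroup.isOpenQuotientMap_mk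

lemma hasDerivAt_of_hasFDerivAt_proj {F : Type*} [NormedAddCommGroup F] [NormedSpace ℝ F]
    {f : Torus → F} {y : Fin 2 → ℝ} {L : (Fin 2 → ℝ) →L[ℝ] F}
    (h : HasFDerivAt (fun z => f (proj z)) L y) (j : Fin 2) :
    HasDerivAt (fun h : ℝ => f (proj y + Pi.single j (h : AddCircle (2 * π))))
      (L (Pi.single j 1)) 0 := by
  have h1 : HasDerivAt (fun h : ℝ => y + h • (Pi.single j 1 : Fin 2 → ℝ)) (Pi.single j 1) 0 := by
    simpa using ((hasDerivAt_id (0 : ℝ)).smul_const (Pi.single j 1 : Fin 2 → ℝ)).const_add y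
  have h2 := HasFDerivAt.comp_hasDerivAt (0 : ℝ) (by simpa using h) h1
  refine h2.congr_of_eventuallyEq (Eventually.of_forall fun t => ?_)
  simp only [Function.comp_apply]
  rw [proj_add, ← proj_single]
  congr 3
  ext i
  by_cases hi : i = j
  · subst hi; simp
  · simp [Pi.single_eq_of_ne hi]

lemma hasDerivAt_trig {c : Mode → ℂ} (hc : Summable fun k => jap k * ‖c k‖) (j : Fin 2)
    (x : Torus) :
    HasDerivAt (fun h : ℝ => trig c (x + Pi.single j (h : AddCircle (2 * π))))
      (trig (dcoef j c) x) 0 := by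
  obtain ⟨y, rfl⟩ := proj_surjective x
  refine (hasDerivAt_of_hasFDerivAt_proj (hasFDerivAt_trig_proj hc y) j).congr_deriv ?_
  rw [sum_apply, Finset.sum_eq_single j]
  · simp
  · intro i _ hi
    simp [Pi.single_eq_of_ne hi]
  · simp

/-! ### Completeness of the trigonometric system -/

/-- The star subalgebra of trigonometric polynomials. -/
noncomputable def charSubalgebra : StarSubalgebra ℂ C(Torus, ℂ) where
  toSubalgebra := Algebra.adjoin ℂ (range char)
  star_mem' := by
    change Algebra.adjoin ℂ (range char) ≤ star (Algebra.adjoin ℂ (range char))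
    refine Algebra.adjoin_le ?_
    rintro _ ⟨n, rfl⟩
    refine Algebra.subset_adjoin ⟨-n, ?_⟩
    ext1 x
    simp only [char_neg, starRingEnd_apply, ContinuousMap.star_apply]

lemma charSubalgebra_coe :
    -- The characters are closed under multiplication, so the algebra they generate is already their
    -- linear span.
    Subalgebra.toSubmodule charSubalgebra.toSubalgebra = Submodule.span ℂ (range char) := by
  apply Algebra.adjoin_eq_span_of_subset
  refine .trans (fun x ↦ Submonoid.closure_induction (fun _ ↦ id) ⟨0, char_zero⟩ ?_)
    Submodule.subset_span
  rintro _ _ _ _ ⟨m, rfl⟩ ⟨n, rfl⟩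
  exact ⟨m + n, by ext z; exact char_add m n z⟩

lemma char_single_one (i : Fin 2) (z : Torus) : char (Pi.single i 1) z = fourier 1 (z i) := by
  rw [char_apply, Fin.prod_univ_two]
  fin_cases i <;> simp

lemma charSubalgebra_separatesPoints : charSubalgebra.SeparatesPoints := by
  intro x y hxy
  rw [Ne, funext_iff, not_forall] at hxy
  obtain ⟨i, hi⟩ := hxy
  refine ⟨_, ⟨char (Pi.single i 1), Algebra.subset_adjoin ⟨Pi.single i 1, rfl⟩, rfl⟩, ?_⟩
  dsimp only
  rw [char_single_one, char_single_one, fourier_one, fourier_one, Ne]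
  contrapose hi
  exact AddCircle.injective_toCircle Real.two_pi_pos.ne' (Subtype.ext hi)

lemma span_char_closure_eq_top :
    (Submodule.span ℂ (range char)).topologicalClosure = ⊤ := by
  rw [← charSubalgebra_coe]
  exact congr_arg (Subalgebra.toSubmodule <| StarSubalgebra.toSubalgebra ·)
    (ContinuousMap.starSubalgebra_topologicalClosure_eq_top_of_separatesPoints _
      charSubalgebra_separatesPoints)

/-- By Stone-Weierstrass the trigonometric polynomials are uniformly dense in the continuous
functions, hence dense in `L²`; a function orthogonal to a dense subspace vanishes. -/
lemma ae_eq_zero_of_coeff_eq_zero {f : Torus → ℝ} (hf : MemLp f 2 volume)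
    (h : ∀ k, coeff f k = 0) : f =ᵐ[volume] 0 := by
  have hf' : MemLp (fun x => (f x : ℂ)) 2 volume := hf.ofReal
  have hdense : Dense ((Submodule.map
      (ContinuousMap.toLp (E := ℂ) 2 (volume : Measure Torus) ℂ).toLinearMap
      (Submodule.span ℂ (range char)) : Submodule ℂ (Lp ℂ 2 (volume : Measure Torus))) :
        Set (Lp ℂ 2 (volume : Measure Torus))) := by
    have h1 : Dense (Submodule.span ℂ (range char) : Set C(Torus, ℂ)) :=
      Submodule.dense_iff_topologicalClosure_eq_top.2 span_char_closure_eq_top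
    exact (ContinuousMap.toLp_denseRange ℂ (volume : Measure Torus) ℂ (by norm_num)).dense_image
      (ContinuousMap.toLp 2 (volume : Measure Torus) ℂ).continuous h1
  have h2 : hf'.toLp = 0 := by
    refine hdense.eq_zero_of_inner_right ℂ fun v hv => ?_
    obtain ⟨g, hg, rfl⟩ := hv
    induction hg using Submodule.span_induction with
    | mem g hg =>
      obtain ⟨k, rfl⟩ := hg
      have h3 := integral_mul_char_neg f k
      rw [h k, mul_zero] at h3
      rw [L2.inner_def, ← h3]
      refine integral_congr_ae ?_
      filter_upwards [hf'.coeFn_toLp, ContinuousMap.coeFn_toLp (p := 2) (𝕜 := ℂ)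
        (volume : Measure Torus) (char k)] with x hx1 hx2
      rw [hx1]
      erw [hx2]
      rw [char_neg, RCLike.inner_apply]
    | zero => simp
    | add g₁ g₂ _ _ h₁ h₂ => 
      simp only [ContinuousLinearMap.coe_coe] at h₁ h₂ ⊢
      rw [map_add, inner_add_left, h₁, h₂, add_zero]
    | smul c g _ hg => 
      simp only [ContinuousLinearMap.coe_coe] at hg ⊢
      rw [map_smul, inner_smul_left, hg, mul_zero]
  have h4 := (Lp.eq_zero_iff_ae_eq_zero.1 h2)
  filter_upwards [h4, hf'.coeFn_toLp] with x hx1 hx2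
  rw [hx2] at hx1
  exact Complex.ofReal_eq_zero.1 hx1

lemma ae_eq_of_coeff_eq {f g : Torus → ℝ} (hf : MemLp f 2 volume) (hg : MemLp g 2 volume)
    (h : ∀ k, coeff f k = coeff g k) : f =ᵐ[volume] g := by
  have h1 : (f - g) =ᵐ[volume] 0 := by
    refine ae_eq_zero_of_coeff_eq_zero (hf.sub hg) fun k => ?_
    have h2 : ∀ {f : Torus → ℝ}, MemLp f 2 volume →
        Integrable (fun x => (f x : ℂ) * char (-k) x) volume := fun {f} hf => by
      refine ((hf.integrable (by norm_num)).ofReal (𝕜 := ℂ)).mul_bdd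
        (c := 1) (char (-k)).continuous.aestronglyMeasurable (Eventually.of_forall fun x => ?_)
      rw [norm_char]
    have h3 : ∫ x, (((f - g) x : ℝ) : ℂ) * char (-k) x =
        (∫ x, (f x : ℂ) * char (-k) x) - ∫ x, (g x : ℂ) * char (-k) x := by
      rw [← integral_sub (h2 hf) (h2 hg)]
      refine integral_congr_ae (Eventually.of_forall fun x => ?_)
      simp only [Pi.sub_apply, Complex.ofReal_sub]
      ring
    rw [coeff_eq, h3, integral_mul_char_neg, integral_mul_char_neg, h k, sub_self, mul_zero]
  filter_upwards [h1] with x hx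
  simpa [sub_eq_zero] using hx

end IPM

/-! ### Regularity of the reconstructed scalar and velocity. -/

namespace IPM

open scoped ComplexConjugate Topology
open Filter

/-- The tail is estimated by Cauchy-Schwarz rather than by a pointwise majorant. The bound depends
on the ball but not on `c`, which gives uniform convergence along trajectories, including for one
derivative. -/
lemma InBall.norm_trig_sub_sum_le {s R : ℝ} (hs : 2 < s) (hR : 0 ≤ R) {c m : Mode → ℂ}
    (hc : InBall s R c) (hm : ∀ k, ‖m k‖ ≤ jap k) (F : Finset Mode) (x : Torus) :
    ‖trig (fun k => m k * c k) x - ∑ k ∈ F, m k * c k * char k x‖ ≤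
      Real.sqrt (∑' k : {k // k ∉ F}, jap (k : Mode) ^ (-(2 * s - 2))) * R := by
  have h0 : ∀ k, ‖m k * c k * char k x‖ ≤ jap k * ‖c k‖ := fun k => by
    rw [norm_mul_char (fun k => m k * c k), norm_mul]
    exact mul_le_mul_of_nonneg_right (hm k) (norm_nonneg _)
  have h1 : Summable fun k => m k * c k * char k x :=
    Summable.of_norm_bounded (hc.summable_jap_mul hs hR).1 h0
  have h2 : trig (fun k => m k * c k) x - ∑ k ∈ F, m k * c k * char k x =
      ∑' k : {k // k ∉ F}, m k * c k * char (k : Mode) x := by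
    rw [trig, ← h1.sum_add_tsum_subtype_compl F, add_sub_cancel_left]
  have hsum : Summable fun k : {k // k ∉ F} => jap (k : Mode) ^ (-(2 * s - 2)) :=
    (summable_jap_rpow (r := 2 * s - 2) (by linarith)).subtype _
  have h4 : Summable fun k : {k // k ∉ F} => jap (k : Mode) * ‖c k‖ :=
    (hc.summable_jap_mul hs hR).1.subtype _
  rw [h2]
  refine (tsum_of_norm_bounded h4.hasSum fun k => h0 k).trans ?_
  refine Real.tsum_le_of_sum_le (fun k => mul_nonneg (jap_pos _).le (norm_nonneg _)) fun G => ?_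
  have h5 := hc.sum_jap_mul_le hR (G.map (Function.Embedding.subtype _))
  rw [Finset.sum_map, Finset.sum_map] at h5
  refine h5.trans ?_
  gcongr
  exact hsum.sum_le_tsum G fun k _ => (jap_rpow_pos _ _).le

/-- Fourier series of trajectories in a ball of `H^s`, `s > 2`, with at most one derivative, are
jointly continuous. -/
lemma continuousOn_trig {s R : ℝ} (hs : 2 < s) (hR : 0 ≤ R) {I : Set ℝ} {a : ℝ → Mode → ℂ}
    {m : Mode → ℂ} (hm : ∀ k, ‖m k‖ ≤ jap k) (hball : ∀ t ∈ I, InBall s R (a t))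
    (hcont : ∀ k, ContinuousOn (fun t => a t k) I) :
    ContinuousOn (fun p : ℝ × Torus => trig (fun k => m k * a p.1 k) p.2) (I ×ˢ univ) := by
  have hu : TendstoUniformlyOn
      (fun (F : Finset Mode) (p : ℝ × Torus) => ∑ k ∈ F, m k * a p.1 k * char k p.2)
      (fun p : ℝ × Torus => trig (fun k => m k * a p.1 k) p.2) atTop (I ×ˢ univ) := by
    rw [Metric.tendstoUniformlyOn_iff]
    intro ε hε
    have h1 := tendsto_tsum_compl_atTop_zero fun k : Mode => jap k ^ (-(2 * s - 2))
    have h2 : Tendsto (fun F : Finset Mode =>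
        Real.sqrt (∑' k : {k // k ∉ F}, jap (k : Mode) ^ (-(2 * s - 2))) * R) atTop (𝓝 0) := by
      simpa using h1.sqrt.mul_const R
    filter_upwards [h2.eventually (gt_mem_nhds hε)] with F hF p hp
    rw [dist_eq_norm]
    exact ((hball p.1 hp.1).norm_trig_sub_sum_le hs hR hm F p.2).trans_lt hF
  refine hu.continuousOn (Frequently.of_forall fun F => ?_)
  refine continuousOn_finsetSum _ fun k _ => ?_
  refine (continuousOn_const.mul ((hcont k).comp continuousOn_fst fun p hp => hp.1)).mul ?_
  exact ((char k).continuous.comp continuous_snd).continuousOn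

/-- The Fourier coefficients of `M_j[f]`. -/
noncomputable def scoef (j : Fin 2) (c : Mode → ℂ) (k : Mode) : ℂ := (symbol 0 j k : ℂ) * c k

lemma norm_scoef_le (j : Fin 2) (c : Mode → ℂ) (k : Mode) : ‖scoef j c k‖ ≤ ‖c k‖ := by
  rw [scoef, norm_mul, Complex.norm_real]
  exact mul_le_of_le_one_left (norm_nonneg _) (abs_symbol_le j k)

lemma scoef_neg {c : Mode → ℂ} (hc : ∀ k, c (-k) = conj (c k)) (j : Fin 2) (k : Mode) :
    scoef j c (-k) = conj (scoef j c k) := by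
  rw [scoef, scoef, hc, symbol_zero_neg, map_mul, Complex.conj_ofReal]

lemma sum_dcoef_scoef (c : Mode → ℂ) (k : Mode) : ∑ j, dcoef j (scoef j c) k = 0 := by
  have h : ((∑ j, symbol 0 j k * (k j : ℝ) : ℝ) : ℂ) = 0 := by
    rw [sum_symbol_mul_self, Complex.ofReal_zero]
  rw [Fin.sum_univ_two] at h ⊢
  push_cast at h
  simp only [dcoef, scoef]
  linear_combination (Complex.I * c k) * h

section Series

variable {s R : ℝ} {c : Mode → ℂ}

lemma InBall.summable_dcoef (hs : 2 < s) (hR : 0 ≤ R) (hc : InBall s R c) (j : Fin 2) :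
    Summable fun k => ‖dcoef j c k‖ :=
  Summable.of_nonneg_of_le (fun k => norm_nonneg _) (norm_dcoef_le j c)
    (hc.summable_jap_mul hs hR).1

lemma InBall.scoef (hc : InBall s R c) (j : Fin 2) : InBall s R (scoef j c) := fun F => by
  refine le_trans (Finset.sum_le_sum fun k _ => ?_) (hc F)
  have := jap_rpow_pos s k
  gcongr
  exact norm_scoef_le j c k

lemma InBall.tsum_norm_le (hs : 2 < s) (hR : 0 ≤ R) (hc : InBall s R c) :
    ∑' k, ‖c k‖ ≤ wienerConst s * R :=
  ((hc.summable_norm hs hR).tsum_le_tsum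
    (fun k => le_mul_of_one_le_left (norm_nonneg _) (one_le_jap k))
      (hc.summable_jap_mul hs hR).1).trans (hc.summable_jap_mul hs hR).2

lemma InBall.bil_eq (hs : 2 < s) (hR : 0 ≤ R) (hc : InBall s R c) (k : Mode) :
    bil c c k = -∑ j, ∑' p, IPM.scoef j c p * dcoef j c (k - p) := by
  have h := fun j => (summable_norm_conv ((hc.scoef j).summable_norm hs hR)
    (hc.summable_dcoef hs hR j)).1 k
  rw [Fin.sum_univ_two, ← (h 0).tsum_add (h 1), ← tsum_neg, bil]
  refine tsum_congr fun p => ?_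
  rw [← transportSymbol_sub, transportSymbol, Fin.sum_univ_two]
  simp only [IPM.scoef, dcoef]
  push_cast
  ring

/-- `bil c c` is a sum of convolutions of the velocity coefficients with the gradient coefficients,
and both are in `ℓ¹`. -/
lemma InBall.summable_norm_bil (hs : 2 < s) (hR : 0 ≤ R) (hc : InBall s R c) :
    (Summable fun k => ‖bil c c k‖) ∧
      ∑' k, ‖bil c c k‖ ≤ 2 * ((wienerConst s * R) * (wienerConst s * R)) := by
  have h := fun j => (summable_norm_conv ((hc.scoef j).summable_norm hs hR)
    (hc.summable_dcoef hs hR j)).2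
  have hle : ∀ k, ‖bil c c k‖ ≤ ‖∑' p, IPM.scoef 0 c p * dcoef 0 c (k - p)‖ +
      ‖∑' p, IPM.scoef 1 c p * dcoef 1 c (k - p)‖ := fun k => by
    rw [hc.bil_eq hs hR, norm_neg, Fin.sum_univ_two]
    exact norm_add_le _ _
  have hW : 0 ≤ wienerConst s * R := by unfold wienerConst; positivity
  have hj : ∀ j, ∑' k, ‖∑' p, IPM.scoef j c p * dcoef j c (k - p)‖ ≤
      (wienerConst s * R) * (wienerConst s * R) := fun j => by
    refine (h j).2.trans (mul_le_mul ((hc.scoef j).tsum_norm_le hs hR) ?_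
      (tsum_nonneg fun k => norm_nonneg _) hW)
    exact ((hc.summable_dcoef hs hR j).tsum_le_tsum (norm_dcoef_le j c)
      (hc.summable_jap_mul hs hR).1).trans (hc.summable_jap_mul hs hR).2
  have hs' := (h 0).1.add (h 1).1
  have hsum : Summable fun k => ‖bil c c k‖ :=
    Summable.of_nonneg_of_le (fun k => norm_nonneg _) hle hs'
  refine ⟨hsum, (hsum.tsum_le_tsum hle hs').trans ?_⟩
  rw [(h 0).1.tsum_add (h 1).1]
  linarith [hj 0, hj 1]

lemma InBall.trig_bil (hs : 2 < s) (hR : 0 ≤ R) (hc : InBall s R c) (x : Torus) :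
    trig (bil c c) x = -∑ j, trig (IPM.scoef j c) x * trig (dcoef j c) x := by
  have h1 := fun j => (hc.scoef j).summable_norm hs hR
  have h2 := hc.summable_dcoef hs hR
  have h3 := fun j => summable_mul_char (summable_norm_conv (h1 j) (h2 j)).2.1 x
  rw [Fin.sum_univ_two, trig_mul_trig (h1 0) (h2 0), trig_mul_trig (h1 1) (h2 1), trig, trig, trig,
    ← (h3 0).tsum_add (h3 1), ← tsum_neg]
  refine tsum_congr fun k => ?_
  rw [hc.bil_eq hs hR, Fin.sum_univ_two]
  ring

end Series

section Trajectory

variable {s R T : ℝ} {a : ℝ → Mode → ℂ}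

lemma continuousOn_coeff (ha : ∀ t ∈ Ioo (-T) T, IsCoeffSolutionAt s R a t) (k : Mode) :
    ContinuousOn (fun t => a t k) (Ioo (-T) T) := fun t ht =>
  ((ha t ht).hasDerivAt k).continuousAt.continuousWithinAt

lemma continuousOn_theta (hs : 2 < s) (hR : 0 ≤ R)
    (ha : ∀ t ∈ Ioo (-T) T, IsCoeffSolutionAt s R a t) :
    ContinuousOn (fun p : ℝ × Torus => trig (a p.1) p.2) (Ioo (-T) T ×ˢ univ) := by
  have := continuousOn_trig hs hR (m := fun _ => 1) (by simpa using one_le_jap)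
    (fun t ht => (ha t ht).inBall) (continuousOn_coeff ha)
  simpa only [one_mul] using this

lemma continuousOn_grad (hs : 2 < s) (hR : 0 ≤ R)
    (ha : ∀ t ∈ Ioo (-T) T, IsCoeffSolutionAt s R a t) (j : Fin 2) :
    ContinuousOn (fun p : ℝ × Torus => trig (dcoef j (a p.1)) p.2) (Ioo (-T) T ×ˢ univ) :=
  continuousOn_trig hs hR (m := fun k => Complex.I * (k j : ℂ))
    (fun k => by simpa using abs_coord_le_jap k j)
    (fun t ht => (ha t ht).inBall) (continuousOn_coeff ha)

lemma continuousOn_velocity (hs : 2 < s) (hR : 0 ≤ R)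
    (ha : ∀ t ∈ Ioo (-T) T, IsCoeffSolutionAt s R a t) (j : Fin 2) :
    ContinuousOn (fun p : ℝ × Torus => trig (scoef j (a p.1)) p.2) (Ioo (-T) T ×ˢ univ) :=
  continuousOn_trig hs hR (m := fun k => (symbol 0 j k : ℂ))
    (fun k => by
      rw [Complex.norm_real]
      exact (abs_symbol_le j k).trans (one_le_jap k))
    (fun t ht => (ha t ht).inBall) (continuousOn_coeff ha)

lemma continuousOn_trig_bil (hs : 2 < s) (hR : 0 ≤ R)
    (ha : ∀ t ∈ Ioo (-T) T, IsCoeffSolutionAt s R a t) :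
    ContinuousOn (fun p : ℝ × Torus => trig (bil (a p.1) (a p.1)) p.2) (Ioo (-T) T ×ˢ univ) := by
  have h : ContinuousOn (fun p : ℝ × Torus => -∑ j, trig (scoef j (a p.1)) p.2 *
      trig (dcoef j (a p.1)) p.2) (Ioo (-T) T ×ˢ univ) :=
    (continuousOn_finsetSum _ fun j _ =>
      (continuousOn_velocity hs hR ha j).mul (continuousOn_grad hs hR ha j)).neg
  exact h.congr fun p hp => (ha p.1 hp.1).inBall.trig_bil hs hR p.2

lemma continuousOn_bil (hs : 2 < s) (hR : 0 ≤ R)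
    (ha : ∀ t ∈ Ioo (-T) T, IsCoeffSolutionAt s R a t) (k : Mode) :
    ContinuousOn (fun t => bil (a t) (a t) k) (Ioo (-T) T) := fun t ht => by
  refine tendsto_bil hs hR ?_ (fun k => continuousOn_coeff ha k t ht) k
  filter_upwards [self_mem_nhdsWithin] with τ hτ
  exact (ha τ hτ).inBall.norm_le hR

/-- The modewise majorant `⟨k⟩^(1-s)` of the time derivative is summable only for `s > 3`. For `s >
2` the time-uniform `ℓ¹` bound on `bil` is used instead, to dominate the partial sums under the time
integral. -/
lemma trig_sub_trig_eq_integral (hs : 2 < s) (hR : 0 ≤ R)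
    (ha : ∀ t ∈ Ioo (-T) T, IsCoeffSolutionAt s R a t) {t t₀ : ℝ} (ht₀ : t₀ ∈ Ioo (-T) T)
    (ht : t ∈ Ioo (-T) T) (x : Torus) :
    trig (a t) x - trig (a t₀) x = ∫ τ in t₀..t, trig (bil (a τ) (a τ)) x := by
  have hsub : uIcc t₀ t ⊆ Ioo (-T) T := ordConnected_Ioo.uIcc_subset ht₀ ht
  have hint : ∀ k, IntervalIntegrable (fun τ => bil (a τ) (a τ) k * char k x) volume t₀ t :=
    fun k => (((continuousOn_bil hs hR ha k).mono hsub).mul continuousOn_const).intervalIntegrable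
  have h1 : ∀ F : Finset Mode, ∑ k ∈ F, (a t k * char k x - a t₀ k * char k x) =
      ∫ τ in t₀..t, ∑ k ∈ F, bil (a τ) (a τ) k * char k x := fun F => by
    rw [intervalIntegral.integral_finsetSum fun k _ => hint k]
    refine Finset.sum_congr rfl fun k _ => ?_
    refine (intervalIntegral.integral_eq_sub_of_hasDerivAt (f := fun τ => a τ k * char k x)
      (fun τ hτ => ((ha τ (hsub hτ)).hasDerivAt k).mul_const _) (hint k)).symm
  have h2 : Tendsto (fun F : Finset Mode => ∑ k ∈ F, (a t k * char k x - a t₀ k * char k x)) atTop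
      (𝓝 (trig (a t) x - trig (a t₀) x)) :=
    ((summable_mul_char ((ha t ht).inBall.summable_norm hs hR) x).hasSum.sub
      (summable_mul_char ((ha t₀ ht₀).inBall.summable_norm hs hR) x).hasSum)
  have h3 : Tendsto (fun F : Finset Mode => ∫ τ in t₀..t, ∑ k ∈ F, bil (a τ) (a τ) k * char k x)
      atTop (𝓝 (∫ τ in t₀..t, trig (bil (a τ) (a τ)) x)) := by
    refine intervalIntegral.tendsto_integral_filter_of_dominated_convergence
      (fun _ => 2 * ((wienerConst s * R) * (wienerConst s * R)))
      (Eventually.of_forall fun F => ?_) (Eventually.of_forall fun F => ?_)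
      intervalIntegrable_const ?_
    · exact (intervalIntegrable_iff.1
        (IntervalIntegrable.sum F fun k _ => hint k)).aestronglyMeasurable.congr
        (Eventually.of_forall fun τ => by simp)
    · refine Eventually.of_forall fun τ hτ => ?_
      have hb := (ha τ (hsub (uIoc_subset_uIcc hτ))).inBall.summable_norm_bil hs hR
      refine (norm_sum_le _ _).trans ?_
      simp only [norm_mul, norm_char, mul_one]
      exact (hb.1.sum_le_tsum F fun k _ => norm_nonneg _).trans hb.2
    · refine Eventually.of_forall fun τ hτ => ?_
      have hb := (ha τ (hsub (uIoc_subset_uIcc hτ))).inBall.summable_norm_bil hs hR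
      exact (summable_mul_char hb.1 x).hasSum
  simp_rw [h1] at h2
  exact tendsto_nhds_unique h2 h3

lemma hasDerivAt_trig_time (hs : 2 < s) (hR : 0 ≤ R)
    (ha : ∀ t ∈ Ioo (-T) T, IsCoeffSolutionAt s R a t) {t : ℝ} (ht : t ∈ Ioo (-T) T) (x : Torus) :
    HasDerivAt (fun τ => trig (a τ) x) (trig (bil (a t) (a t)) x) t := by
  have hc : ContinuousOn (fun τ => trig (bil (a τ) (a τ)) x) (Ioo (-T) T) :=
    ContinuousOn.comp (g := fun p : ℝ × Torus => trig (bil (a p.1) (a p.1)) p.2)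
      (f := fun τ => (τ, x)) (continuousOn_trig_bil hs hR ha) (by fun_prop)
      fun τ hτ => ⟨hτ, mem_univ _⟩
  have hmem : Ioo (-T) T ∈ 𝓝 t := Ioo_mem_nhds ht.1 ht.2
  set g : ℝ → ℂ := fun σ => trig (bil (a σ) (a σ)) x with hg
  have hm : StronglyMeasurableAtFilter g (𝓝 t) volume :=
    hc.stronglyMeasurableAtFilter isOpen_Ioo t ht
  have hi : IntervalIntegrable g volume t t := IntervalIntegrable.refl
  have h1 : HasDerivAt (fun τ => ∫ σ in t..τ, g σ) (g t) t :=
    intervalIntegral.integral_hasDerivAt_right hi hm (hc.continuousAt hmem)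
  refine (h1.const_add (trig (a t) x)).congr_of_eventuallyEq ?_
  filter_upwards [hmem] with τ hτ
  rw [← trig_sub_trig_eq_integral hs hR ha ht hτ, add_sub_cancel]

/-- The scalar with Fourier coefficients `a`. -/
noncomputable def scalarOf (a : ℝ → Mode → ℂ) (t : ℝ) (x : Torus) : ℝ := (trig (a t) x).re

/-- The velocity of the scalar with Fourier coefficients `a`. -/
noncomputable def velocityOf (a : ℝ → Mode → ℂ) (j : Fin 2) (t : ℝ) (x : Torus) : ℝ :=
  (trig (scoef j (a t)) x).re

/-- The spatial derivative of the scalar with Fourier coefficients `a`. -/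
noncomputable def gradOf (a : ℝ → Mode → ℂ) (j : Fin 2) (t : ℝ) (x : Torus) : ℝ :=
  (trig (dcoef j (a t)) x).re

lemma continuousOn_scalarOf (hs : 2 < s) (hR : 0 ≤ R)
    (ha : ∀ t ∈ Ioo (-T) T, IsCoeffSolutionAt s R a t) :
    ContinuousOn (fun p : ℝ × Torus => scalarOf a p.1 p.2) (Ioo (-T) T ×ˢ univ) :=
  Complex.continuous_re.comp_continuousOn (continuousOn_theta hs hR ha)

lemma continuousOn_velocityOf (hs : 2 < s) (hR : 0 ≤ R)
    (ha : ∀ t ∈ Ioo (-T) T, IsCoeffSolutionAt s R a t) (j : Fin 2) :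
    ContinuousOn (fun p : ℝ × Torus => velocityOf a j p.1 p.2) (Ioo (-T) T ×ˢ univ) :=
  Complex.continuous_re.comp_continuousOn (continuousOn_velocity hs hR ha j)

lemma continuousOn_gradOf (hs : 2 < s) (hR : 0 ≤ R)
    (ha : ∀ t ∈ Ioo (-T) T, IsCoeffSolutionAt s R a t) (j : Fin 2) :
    ContinuousOn (fun p : ℝ × Torus => gradOf a j p.1 p.2) (Ioo (-T) T ×ˢ univ) :=
  Complex.continuous_re.comp_continuousOn (continuousOn_grad hs hR ha j)

lemma hasDerivAt_scalarOf_single (hs : 2 < s) (hR : 0 ≤ R) {t : ℝ}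
    (ha : IsCoeffSolutionAt s R a t) (j : Fin 2) (x : Torus) :
    HasDerivAt (fun h : ℝ => scalarOf a t (x + Pi.single j (h : AddCircle (2 * π))))
      (gradOf a j t x) 0 :=
  Complex.reCLM.hasFDerivAt.comp_hasDerivAt (0 : ℝ)
    (hasDerivAt_trig (ha.inBall.summable_jap_mul hs hR).1 j x)

lemma partialDeriv_scalarOf (hs : 2 < s) (hR : 0 ≤ R) {t : ℝ}
    (ha : IsCoeffSolutionAt s R a t) (j : Fin 2) (x : Torus) :
    partialDeriv j (scalarOf a t) x = gradOf a j t x :=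
  (hasDerivAt_scalarOf_single hs hR ha j x).deriv

lemma hasDerivAt_velocityOf_single (hs : 2 < s) (hR : 0 ≤ R) {t : ℝ}
    (ha : IsCoeffSolutionAt s R a t) (i j : Fin 2) (x : Torus) :
    HasDerivAt (fun h : ℝ => velocityOf a i t (x + Pi.single j (h : AddCircle (2 * π))))
      (trig (dcoef j (scoef i (a t))) x).re 0 :=
  Complex.reCLM.hasFDerivAt.comp_hasDerivAt (0 : ℝ)
    (hasDerivAt_trig ((ha.inBall.scoef i).summable_jap_mul hs hR).1 j x)

lemma sum_trig_dcoef_scoef (hs : 2 < s) (hR : 0 ≤ R) {c : Mode → ℂ} (hc : InBall s R c)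
    (x : Torus) : ∑ j, trig (dcoef j (scoef j c)) x = 0 := by
  have h := fun j => summable_mul_char ((hc.scoef j).summable_dcoef hs hR j) x
  rw [Fin.sum_univ_two, trig, trig, ← (h 0).tsum_add (h 1)]
  refine (tsum_congr fun k => ?_).trans tsum_zero
  have := sum_dcoef_scoef c k
  rw [Fin.sum_univ_two] at this
  rw [← add_mul, this, zero_mul]

lemma hasDerivAt_scalarOf (hs : 2 < s) (hR : 0 ≤ R)
    (ha : ∀ t ∈ Ioo (-T) T, IsCoeffSolutionAt s R a t) {t : ℝ} (ht : t ∈ Ioo (-T) T) (x : Torus) :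
    HasDerivAt (fun τ => scalarOf a τ x) (-∑ j, velocityOf a j t x * gradOf a j t x) t := by
  refine (Complex.reCLM.hasFDerivAt.comp_hasDerivAt t
    (hasDerivAt_trig_time hs hR ha ht x)).congr_deriv ?_
  have hsymm := (ha t ht).symm
  rw [(ha t ht).inBall.trig_bil hs hR, ← Complex.ofReal_re (-∑ j, velocityOf a j t x * gradOf a j t x)]
  rw [Complex.reCLM_apply]
  congr 1
  push_cast
  congr 1
  refine Finset.sum_congr rfl fun j _ => ?_
  rw [velocityOf, gradOf, ofReal_re_trig (scoef_neg hsymm j), ofReal_re_trig (dcoef_neg hsymm j)]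

/-- Jointly continuous partial derivatives, in time and in space, on an open set give a strict
derivative, and its continuity gives class `C¹`. -/
lemma contDiffOn_scalarOf (hs : 2 < s) (hR : 0 ≤ R)
    (ha : ∀ t ∈ Ioo (-T) T, IsCoeffSolutionAt s R a t) :
    ContDiffOn ℝ 1 (fun p : ℝ × (Fin 2 → ℝ) => scalarOf a p.1 (proj p.2))
      (Ioo (-T) T ×ˢ univ) := by
  have hopen : IsOpen (Ioo (-T) T ×ˢ (univ : Set (Fin 2 → ℝ))) := isOpen_Ioo.prod isOpen_univ
  let f₁ : ℝ → (Fin 2 → ℝ) → ℝ →L[ℝ] ℝ := fun t y =>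
    ContinuousLinearMap.toSpanSingleton ℝ
      (-∑ j, velocityOf a j t (proj y) * gradOf a j t (proj y))
  let f₂ : ℝ → (Fin 2 → ℝ) → (Fin 2 → ℝ) →L[ℝ] ℝ := fun t y =>
    ∑ j, (gradOf a j t (proj y)) • ContinuousLinearMap.proj (R := ℝ) (φ := fun _ : Fin 2 => ℝ) j
  have hmaps : MapsTo (fun p : ℝ × (Fin 2 → ℝ) => (p.1, proj p.2)) (Ioo (-T) T ×ˢ univ)
      (Ioo (-T) T ×ˢ univ) := fun p hp => ⟨hp.1, mem_univ _⟩
  have hcp : Continuous fun p : ℝ × (Fin 2 → ℝ) => (p.1, proj p.2) :=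
    continuous_fst.prodMk (continuous_proj.comp continuous_snd)
  have hu := fun j => (continuousOn_velocityOf hs hR ha j).comp hcp.continuousOn hmaps
  have hg := fun j => (continuousOn_gradOf hs hR ha j).comp hcp.continuousOn hmaps
  have hf₁ : ContinuousOn (fun p : ℝ × (Fin 2 → ℝ) => f₁ p.1 p.2) (Ioo (-T) T ×ˢ univ) :=
    (ContinuousLinearMap.toSpanSingletonCLE (𝕜 := ℝ) (E := ℝ)).continuous.comp_continuousOn
      (continuousOn_finsetSum _ fun j _ => (hu j).mul (hg j)).neg
  have hf₂ : ContinuousOn (fun p : ℝ × (Fin 2 → ℝ) => f₂ p.1 p.2) (Ioo (-T) T ×ˢ univ) :=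
    continuousOn_finsetSum _ fun j _ => (hg j).smul continuousOn_const
  have hd : ∀ p ∈ Ioo (-T) T ×ˢ (univ : Set (Fin 2 → ℝ)),
      HasFDerivAt (fun p : ℝ × (Fin 2 → ℝ) => scalarOf a p.1 (proj p.2))
        ((f₁ p.1 p.2).coprod (f₂ p.1 p.2)) p := fun p hp => by
    have hev := hopen.mem_nhds hp
    refine (hasStrictFDerivAt_uncurry_coprod (𝕜 := ℝ) (u := p)
      (f := fun t y => scalarOf a t (proj y)) (f₁ := f₁) (f₂ := f₂) ?_ ?_
      (hf₁.continuousAt hev) (hf₂.continuousAt hev)).hasFDerivAt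
    · filter_upwards [hev] with v hv
      exact (hasDerivAt_scalarOf hs hR ha hv.1 (proj v.2)).hasFDerivAt
    · filter_upwards [hev] with v hv
      refine (Complex.reCLM.hasFDerivAt.comp v.2 (hasFDerivAt_trig_proj
        ((ha v.1 hv.1).inBall.summable_jap_mul hs hR).1 v.2)).congr_fderiv ?_
      ext z
      simp [f₂, Function.HasUncurry.uncurry, gradOf, mul_comm]
  rw [show (1 : WithTop ℕ∞) = 0 + 1 from (zero_add 1).symm,
    contDiffOn_succ_iff_fderiv_of_isOpen hopen]
  refine ⟨fun p hp => (hd p hp).differentiableAt.differentiableWithinAt, by simp, ?_⟩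
  rw [contDiffOn_zero]
  have hcop : ContinuousOn (fun p : ℝ × (Fin 2 → ℝ) => (f₁ p.1 p.2).coprod (f₂ p.1 p.2))
      (Ioo (-T) T ×ˢ univ) := by
    have : ∀ p : ℝ × (Fin 2 → ℝ), (f₁ p.1 p.2).coprod (f₂ p.1 p.2) =
        (f₁ p.1 p.2).comp (ContinuousLinearMap.fst ℝ ℝ (Fin 2 → ℝ)) +
          (f₂ p.1 p.2).comp (ContinuousLinearMap.snd ℝ ℝ (Fin 2 → ℝ)) := fun p => by
      ext <;> simp
    simp_rw [this]
    exact (hf₁.clm_comp continuousOn_const).add (hf₂.clm_comp continuousOn_const)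
  exact hcop.congr fun p hp => (hd p hp).fderiv

lemma isVelocity_velocityOf (hs : 2 < s) (hR : 0 ≤ R) {t : ℝ}
    (ha : IsCoeffSolutionAt s R a t) :
    IsVelocity 0 (scalarOf a t) fun j => velocityOf a j t := fun j => by
  have h1 := (ha.inBall.scoef j).summable_norm hs hR
  refine ⟨(Complex.continuous_re.comp (continuous_trig h1)).integrable_of_hasCompactSupport
    (HasCompactSupport.of_compactSpace _), fun k => ?_⟩
  have h2 : coeff (velocityOf a j t) k = scoef j (a t) k :=
    coeff_re_trig h1 (scoef_neg ha.symm j) k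
  have h3 : coeff (scalarOf a t) k = a t k :=
    coeff_re_trig (ha.inBall.summable_norm hs hR) ha.symm k
  rw [h2, h3, scoef]

end Trajectory

end IPM

namespace IPM

open scoped ComplexConjugate Topology
open Filter

/-! ### Calculus on the torus -/

lemma isOpenQuotientMap_prod_proj :
    IsOpenQuotientMap (Prod.map id proj : ℝ × (Fin 2 → ℝ) → ℝ × Torus) :=
  IsOpenQuotientMap.id.prodMap isOpenQuotientMap_proj

lemma continuous_of_continuous_proj {F : Type*} [TopologicalSpace F] {f : ℝ × Torus → F}
    (h : Continuous fun p : ℝ × (Fin 2 → ℝ) => f (p.1, proj p.2)) : Continuous f :=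
  isOpenQuotientMap_prod_proj.isQuotientMap.continuous_iff.2 h

/-- The integral of a derivative over the torus vanishes. -/
lemma integral_deriv_eq_zero {g g' : Torus → ℝ} (hg : Continuous g) (hg' : Continuous g')
    (j : Fin 2) (h : ∀ x, HasDerivAt (fun h : ℝ => g (x + Pi.single j (h : AddCircle (2 * π))))
      (g' x) 0) : ∫ x, g' x = 0 := by
  obtain ⟨C, hC⟩ := (HasCompactSupport.of_compactSpace g').exists_bound_of_continuous hg'
  have hint : ∀ {f : Torus → ℝ}, Continuous f → Integrable f volume := fun hf =>
    hf.integrable_of_hasCompactSupport (HasCompactSupport.of_compactSpace _)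
  have hder : ∀ x : Torus, ∀ r : ℝ,
      HasDerivAt (fun h : ℝ => g (x + Pi.single j (h : AddCircle (2 * π))))
        (g' (x + Pi.single j (r : AddCircle (2 * π)))) r := fun x r => by
    have h1 := h (x + Pi.single j (r : AddCircle (2 * π)))
    have h2 : HasDerivAt (fun h : ℝ => h - r) 1 r := (hasDerivAt_id r).sub_const r
    have h3 := HasDerivAt.scomp r (by rwa [sub_self]) h2
    rw [one_smul] at h3
    refine h3.congr_of_eventuallyEq (Eventually.of_forall fun t => ?_)
    simp only [Function.comp_apply]
    rw [add_assoc, ← Pi.single_add, ← AddCircle.coe_add, add_sub_cancel]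
  let F : ℝ → Torus → ℝ := fun h x => g (x + Pi.single j (h : AddCircle (2 * π)))
  let F' : ℝ → Torus → ℝ := fun h x => g' (x + Pi.single j (h : AddCircle (2 * π)))
  have hF : ∀ r, Continuous (F r) := fun r => by fun_prop
  have hF' : ∀ r, Continuous (F' r) := fun r => by fun_prop
  have h1 := hasDerivAt_integral_of_dominated_loc_of_deriv_le (μ := (volume : Measure Torus))
    (F := F) (F' := F') (x₀ := 0) (s := univ) (bound := fun _ => C) univ_mem
    (Eventually.of_forall fun r => (hF r).aestronglyMeasurable) (hint (hF 0))
    (hF' 0).aestronglyMeasurable (Eventually.of_forall fun x r _ => hC _) (integrable_const C)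
    (Eventually.of_forall fun x r _ => hder x r)
  -- By translation invariance this integral does not depend on `r`; its derivative at 0 is the
  -- integral in question.
  have h2 : (fun r : ℝ => ∫ x : Torus, g (x + Pi.single j (r : AddCircle (2 * π)))) =
      fun _ => ∫ x, g x := funext fun r => integral_add_right_eq_self g _
  have h3 : HasDerivAt (fun r => ∫ x, F r x) (∫ x, F' 0 x) 0 := h1.2
  simp only [F] at h3
  rw [h2] at h3
  have h4 := h3.unique (hasDerivAt_const _ _)
  simpa [F'] using h4

lemma IsTest.continuous {T : ℝ} {φ : ℝ → Torus → ℝ} (h : IsTest T φ) :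
    Continuous fun p : ℝ × Torus => φ p.1 p.2 :=
  continuous_of_continuous_proj h.1.continuous

/-- Test functions are continuously differentiable in time. -/
lemma IsTest.time_deriv {T : ℝ} {φ : ℝ → Torus → ℝ} (h : IsTest T φ) :
    (∀ t x, HasDerivAt (fun τ => φ τ x) (deriv (fun τ => φ τ x) t) t) ∧
      Continuous fun p : ℝ × Torus => deriv (fun τ => φ τ p.2) p.1 := by
  have hΦ := h.1
  have hd : ∀ (t : ℝ) (y : Fin 2 → ℝ), HasDerivAt (fun τ => φ τ (proj y))
      (fderiv ℝ (fun p : ℝ × (Fin 2 → ℝ) => φ p.1 (proj p.2)) (t, y) (1, 0)) t := fun t y => by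
    have h1 := (hΦ.differentiable (by simp) (t, y)).hasFDerivAt
    exact h1.comp_hasDerivAt t ((hasDerivAt_id t).prodMk (hasDerivAt_const t y))
  refine ⟨fun t x => ?_, continuous_of_continuous_proj ?_⟩
  · obtain ⟨y, rfl⟩ := proj_surjective x
    exact (hd t y).differentiableAt.hasDerivAt
  · have h2 : (fun p : ℝ × (Fin 2 → ℝ) => deriv (fun τ => φ τ (proj p.2)) p.1) =
        fun p => fderiv ℝ (fun p : ℝ × (Fin 2 → ℝ) => φ p.1 (proj p.2)) p (1, 0) :=
      funext fun p => (hd p.1 p.2).deriv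
    simp only [h2]
    exact (hΦ.continuous_fderiv (by simp)).clm_apply continuous_const

/-- Test functions are continuously differentiable in space. -/
lemma IsTest.partialDeriv {T : ℝ} {φ : ℝ → Torus → ℝ} (h : IsTest T φ) (j : Fin 2) :
    (∀ t x, HasDerivAt (fun h : ℝ => φ t (x + Pi.single j (h : AddCircle (2 * π))))
      (partialDeriv j (φ t) x) 0) ∧
      Continuous fun p : ℝ × Torus => IPM.partialDeriv j (φ p.1) p.2 := by
  have hΦ := h.1
  have hd : ∀ (t : ℝ) (y : Fin 2 → ℝ),
      HasDerivAt (fun h : ℝ => φ t (proj y + Pi.single j (h : AddCircle (2 * π))))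
      (fderiv ℝ (fun p : ℝ × (Fin 2 → ℝ) => φ p.1 (proj p.2)) (t, y) (0, Pi.single j 1)) 0 :=
    fun t y => by
    have h1 := (hΦ.differentiable (by simp) (t, y)).hasFDerivAt
    have h2 : HasFDerivAt (fun z : Fin 2 → ℝ => φ t (proj z)) _ y :=
      h1.comp y ((hasFDerivAt_const t y).prodMk (hasFDerivAt_id y))
    exact hasDerivAt_of_hasFDerivAt_proj h2 j
  refine ⟨fun t x => ?_, continuous_of_continuous_proj ?_⟩
  · obtain ⟨y, rfl⟩ := proj_surjective x
    exact (hd t y).differentiableAt.hasDerivAt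
  · have h2 : (fun p : ℝ × (Fin 2 → ℝ) => IPM.partialDeriv j (φ p.1) (proj p.2)) =
        fun p => fderiv ℝ (fun p : ℝ × (Fin 2 → ℝ) => φ p.1 (proj p.2)) p (0, Pi.single j 1) :=
      funext fun p => (hd p.1 p.2).deriv
    simp only [h2]
    exact (hΦ.continuous_fderiv (by simp)).clm_apply continuous_const

lemma integrable_prod_of_continuousOn {T : ℝ} {f : ℝ × Torus → ℝ}
    (hf : ContinuousOn f (Icc 0 T ×ˢ univ)) :
    Integrable f ((volume.restrict (Ioo 0 T)).prod volume) := by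
  have h1 : IntegrableOn f (Icc 0 T ×ˢ univ) (volume.prod volume) :=
    hf.integrableOn_compact (isCompact_Icc.prod isCompact_univ)
  have h2 := h1.mono_set (prod_mono_left (Ioo_subset_Icc_self (a := (0 : ℝ)) (b := T)))
  rwa [IntegrableOn, ← Measure.prod_restrict, Measure.restrict_univ] at h2

lemma integrable_of_continuous {f : Torus → ℝ} (hf : Continuous f) : Integrable f volume :=
  hf.integrable_of_hasCompactSupport (HasCompactSupport.of_compactSpace _)

/-! ### The classical solution is a weak solution. -/

section Weak

variable {s R T T' : ℝ} {a : ℝ → Mode → ℂ}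

/-- Integration by parts in space. -/
lemma integral_transport_eq (hs : 2 < s) (hR : 0 ≤ R) {t : ℝ} (ha : IsCoeffSolutionAt s R a t)
    {φ : ℝ → Torus → ℝ} {T : ℝ} (hφ : IsTest T φ) :
    ∫ x, (∑ j, velocityOf a j t x * partialDeriv j (φ t) x) * scalarOf a t x =
      ∫ x, φ t x * (-∑ j, velocityOf a j t x * gradOf a j t x) := by
  have hθ : Continuous (scalarOf a t) :=
    Complex.continuous_re.comp (continuous_trig (ha.inBall.summable_norm hs hR))
  have hu : ∀ j, Continuous (velocityOf a j t) := fun j =>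
    Complex.continuous_re.comp (continuous_trig ((ha.inBall.scoef j).summable_norm hs hR))
  have hg : ∀ j, Continuous (gradOf a j t) := fun j =>
    Complex.continuous_re.comp (continuous_trig (ha.inBall.summable_dcoef hs hR j))
  have hdu : ∀ j, Continuous fun x => (trig (dcoef j (scoef j (a t))) x).re := fun j =>
    Complex.continuous_re.comp (continuous_trig ((ha.inBall.scoef j).summable_dcoef hs hR j))
  have hφc : Continuous (φ t) := hφ.continuous.comp (Continuous.prodMk_right t)
  have hφd : ∀ j, Continuous (partialDeriv j (φ t)) := fun j =>
    (hφ.partialDeriv j).2.comp (Continuous.prodMk_right t)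
  -- The derivative in direction `j` of `u_j θ φ` integrates to zero. After summation over `j`, the
  -- terms with derivatives of the velocity cancel, the velocity being divergence free.
  have hdiv : ∀ j, ∫ x, ((trig (dcoef j (scoef j (a t))) x).re * scalarOf a t x +
      velocityOf a j t x * gradOf a j t x) * φ t x +
        velocityOf a j t x * scalarOf a t x * partialDeriv j (φ t) x = 0 := fun j => by
    refine integral_deriv_eq_zero (g := fun x => velocityOf a j t x * scalarOf a t x * φ t x)
      (((hu j).mul hθ).mul hφc)
      (((((hdu j).mul hθ).add ((hu j).mul (hg j))).mul hφc).add
        (((hu j).mul hθ).mul (hφd j))) j fun x => ?_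
    refine (((hasDerivAt_velocityOf_single hs hR ha j j x).mul
      (hasDerivAt_scalarOf_single hs hR ha j x)).mul ((hφ.partialDeriv j).1 t x)).congr_deriv ?_
    simp
  have hint : ∀ j, Integrable (fun x => ((trig (dcoef j (scoef j (a t))) x).re * scalarOf a t x +
      velocityOf a j t x * gradOf a j t x) * φ t x +
        velocityOf a j t x * scalarOf a t x * partialDeriv j (φ t) x) volume := fun j =>
    integrable_of_continuous (((((hdu j).mul hθ).add ((hu j).mul (hg j))).mul hφc).add (((hu j).mul hθ).mul (hφd j)))
  have hsum : ∫ x, ∑ j, (((trig (dcoef j (scoef j (a t))) x).re * scalarOf a t x +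
      velocityOf a j t x * gradOf a j t x) * φ t x +
        velocityOf a j t x * scalarOf a t x * partialDeriv j (φ t) x) = 0 := by
    rw [integral_finsetSum _ fun j _ => hint j]
    exact Finset.sum_eq_zero fun j _ => hdiv j
  rw [← sub_eq_zero, ← integral_sub, ← hsum]
  · refine integral_congr_ae (Eventually.of_forall fun x => ?_)
    have h0 := congrArg Complex.re (sum_trig_dcoef_scoef hs hR ha.inBall x)
    simp only [Fin.sum_univ_two, Complex.add_re, Complex.zero_re] at h0 ⊢
    linear_combination (-scalarOf a t x * φ t x) * h0
  · exact integrable_of_continuous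
      ((continuous_finsetSum _ fun j _ => (hu j).mul (hφd j)).mul hθ)
  · exact integrable_of_continuous
      (hφc.mul (continuous_finsetSum _ fun j _ => (hu j).mul (hg j)).neg)

lemma weak_eq_scalarOf (hs : 2 < s) (hR : 0 ≤ R)
    (ha : ∀ t ∈ Ioo (-T) T, IsCoeffSolutionAt s R a t) (hT' : 0 < T') (hTT' : T' < T)
    {φ : ℝ → Torus → ℝ} (hφ : IsTest T' φ) :
    (∫ t in Ioo 0 T', ∫ x, (deriv (fun τ => φ τ x) t +
      ∑ j, velocityOf a j t x * partialDeriv j (φ t) x) * scalarOf a t x) +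
        ∫ x, φ 0 x * scalarOf a 0 x = 0 := by
  have hsub : Icc 0 T' ⊆ Ioo (-T) T := fun t ht =>
    ⟨by linarith [ht.1, hT'], ht.2.trans_lt hTT'⟩
  have hsub2 : Icc 0 T' ×ˢ (univ : Set Torus) ⊆ Ioo (-T) T ×ˢ univ := prod_mono_left hsub
  have hθ := (continuousOn_scalarOf hs hR ha).mono hsub2
  have hu := fun j => (continuousOn_velocityOf hs hR ha j).mono hsub2
  have hg := fun j => (continuousOn_gradOf hs hR ha j).mono hsub2
  have hslice : ∀ {f : ℝ × Torus → ℝ}, ContinuousOn f (Icc 0 T' ×ˢ univ) → ∀ t ∈ Icc 0 T',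
      Continuous fun x => f (t, x) := fun {f} hf t ht =>
    hf.comp_continuous (Continuous.prodMk_right t) fun x => ⟨ht, mem_univ _⟩
  have hdt := hφ.time_deriv.2.continuousOn (s := Icc 0 T' ×ˢ univ)
  have hφc := hφ.continuous.continuousOn (s := Icc 0 T' ×ˢ univ)
  have hφd := fun j => (hφ.partialDeriv j).2.continuousOn (s := Icc 0 T' ×ˢ univ)
  -- After integration by parts in space the integrand becomes the time derivative of `φ θ`. Fubini
  -- and the fundamental theorem of calculus then leave only the contribution of time 0.
  let G : ℝ × Torus → ℝ := fun p => deriv (fun τ => φ τ p.2) p.1 * scalarOf a p.1 p.2 +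
    φ p.1 p.2 * (-∑ j, velocityOf a j p.1 p.2 * gradOf a j p.1 p.2)
  have hG : ContinuousOn G (Icc 0 T' ×ˢ univ) :=
    (hdt.mul hθ).add (hφc.mul (continuousOn_finsetSum _ fun j _ => (hu j).mul (hg j)).neg)
  have h1 : ∀ t ∈ Ioo 0 T', ∫ x, (deriv (fun τ => φ τ x) t +
      ∑ j, velocityOf a j t x * partialDeriv j (φ t) x) * scalarOf a t x = ∫ x, G (t, x) :=
    fun t ht => by
    have ht' := Ioo_subset_Icc_self ht
    have i1 : Integrable (fun x => deriv (fun τ => φ τ x) t * scalarOf a t x) volume :=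
      integrable_of_continuous (hslice (hdt.mul hθ) t ht')
    have i2 : Integrable (fun x => (∑ j, velocityOf a j t x * partialDeriv j (φ t) x) *
        scalarOf a t x) volume := integrable_of_continuous
      (hslice ((continuousOn_finsetSum Finset.univ fun j _ => (hu j).mul (hφd j)).mul hθ) t ht')
    have i3 : Integrable (fun x => φ t x * (-∑ j, velocityOf a j t x * gradOf a j t x)) volume :=
      integrable_of_continuous (hslice
      (hφc.mul (continuousOn_finsetSum Finset.univ fun j _ => (hu j).mul (hg j)).neg) t ht')
    simp only [G, add_mul]
    rw [integral_add i1 i2, integral_add i1 i3,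
      integral_transport_eq hs hR (ha t (hsub ht')) hφ]
  have hGint := integrable_prod_of_continuousOn hG
  rw [setIntegral_congr_fun measurableSet_Ioo h1, integral_integral_swap hGint]
  have h2 : ∀ x, ∫ t in Ioo 0 T', G (t, x) = -(φ 0 x * scalarOf a 0 x) := fun x => by
    rw [← integral_Ioc_eq_integral_Ioo, ← intervalIntegral.integral_of_le hT'.le]
    have hGx : ContinuousOn (fun t => G (t, x)) (Icc 0 T') :=
      ContinuousOn.comp (f := fun t => (t, x)) hG (by fun_prop) fun t ht => ⟨ht, mem_univ _⟩
    rw [intervalIntegral.integral_eq_sub_of_hasDerivAt (f := fun t => φ t x * scalarOf a t x)]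
    · obtain ⟨T₁, hT₁, hz⟩ := hφ.2
      rw [hz T' hT₁.le x, zero_mul, zero_sub]
    · intro t ht
      rw [uIcc_of_le hT'.le] at ht
      exact (hφ.time_deriv.1 t x).mul (hasDerivAt_scalarOf hs hR ha (hsub ht) x)
    · exact hGx.intervalIntegrable_of_Icc hT'.le
  simp_rw [h2]
  rw [integral_neg, neg_add_cancel]

end Weak

end IPM

namespace IPM

open scoped ComplexConjugate Topology
open Filter

/-! ### Weak solutions in terms of Fourier coefficients -/

lemma exists_lt_forall_ge_eq_zero {T : ℝ} (hT : 0 < T) {ψ : ℝ → ℝ} (hc : HasCompactSupport ψ)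
    (hsub : tsupport ψ ⊆ Ioo 0 T) : ∃ T₁ < T, 0 ≤ T₁ ∧ ∀ t, T₁ ≤ t → ψ t = 0 := by
  rcases (tsupport ψ).eq_empty_or_nonempty with h | h
  · exact ⟨0, hT, le_rfl, fun t _ => image_eq_zero_of_notMem_tsupport (by simp [h])⟩
  · obtain ⟨m, hm, hmax⟩ := hc.isCompact.exists_isGreatest h
    refine ⟨(m + T) / 2, by linarith [(hsub hm).2], by linarith [(hsub hm).1], fun t ht => ?_⟩
    refine image_eq_zero_of_notMem_tsupport fun hmem => ?_
    linarith [hmax hmem, (hsub hm).2]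

/-- The fundamental lemma of the calculus of variations, for the weak form of `f' = D`,
`f(0) = A`. -/
lemma ae_eq_add_integral_of_weak {T A : ℝ} {f D : ℝ → ℝ} (hT : 0 < T)
    (hf : IntegrableOn f (Ioo 0 T)) (hD : IntegrableOn D (Ioo 0 T))
    (h : ∀ η : ℝ → ℝ, ContDiff ℝ ∞ η → (∃ T₁ < T, ∀ t, T₁ ≤ t → η t = 0) →
      (∫ t in Ioo 0 T, (deriv η t * f t + η t * D t)) + η 0 * A = 0) :
    ∀ᵐ t ∂(volume.restrict (Ioo 0 T)), f t = A + ∫ τ in 0..t, D τ := by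
  have hDi : IntervalIntegrable D volume 0 T := by
    rw [intervalIntegrable_iff_integrableOn_Ioo_of_le hT.le]; exact hD
  set P : ℝ → ℝ := fun t => ∫ τ in 0..t, D τ with hP
  have hPac : AbsolutelyContinuousOnInterval P 0 T :=
    hDi.absolutelyContinuousOnInterval_intervalIntegral (by simp)
  have hPc : ContinuousOn P (Icc 0 T) := by
    have := hPac.continuousOn; rwa [uIcc_of_le hT.le] at this
  have hPi : IntegrableOn P (Ioo 0 T) :=
    (hPc.integrableOn_Icc).mono_set Ioo_subset_Icc_self
  have hci : IntegrableOn (fun t => f t - A - P t) (Ioo 0 T) :=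
    (hf.sub (integrable_const A)).sub hPi
  have hmain : ∀ ψ : ℝ → ℝ, ContDiff ℝ ∞ ψ → HasCompactSupport ψ → tsupport ψ ⊆ Ioo 0 T →
      ∫ t, ψ t • (f t - A - P t) = 0 := by
    intro ψ hψ hψc hψs
    obtain ⟨T₁, hT₁, hT₁0, hz⟩ := exists_lt_forall_ge_eq_zero hT hψc hψs
    -- The primitive is based at `T` so that it vanishes near `T`, as test functions must; it need
    -- not vanish at 0, and its value there brings in `A`.
    set η : ℝ → ℝ := fun t => ∫ τ in T..t, ψ τ with hη
    have hηd : ∀ t, HasDerivAt η (ψ t) t := fun t =>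
      intervalIntegral.integral_hasDerivAt_right (hψ.continuous.intervalIntegrable _ _)
        (hψ.continuous.stronglyMeasurableAtFilter _ _) hψ.continuous.continuousAt
    have hηderiv : deriv η = ψ := funext fun t => (hηd t).deriv
    have hηs : ContDiff ℝ ∞ η := by
      rw [contDiff_infty_iff_deriv, hηderiv]
      exact ⟨fun t => (hηd t).differentiableAt, hψ⟩
    have hηz : ∀ t, T₁ ≤ t → η t = 0 := fun t ht => by
      simp only [hη]
      rw [intervalIntegral.integral_congr (g := fun _ => (0 : ℝ)), intervalIntegral.integral_zero]
      intro τ hτ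
      exact hz τ ((le_min hT₁.le ht).trans hτ.1)
    have h1 := h η hηs ⟨T₁, hT₁, hηz⟩
    have hηac : AbsolutelyContinuousOnInterval η 0 T :=
      (hηs.of_le (by exact_mod_cast le_top)).contDiffOn.absolutelyContinuousOnInterval
    -- `D` is only integrable, so its primitive is only absolutely continuous, which is enough for
    -- integration by parts.
    have h2 := hηac.integral_mul_deriv_eq_deriv_mul hPac
    have h3 : ∫ t in 0..T, η t * deriv P t = ∫ t in 0..T, η t * D t := by
      refine intervalIntegral.integral_congr_ae ?_
      filter_upwards [hDi.ae_hasDerivAt_integral] with t ht hmem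
      rw [(ht (uIoc_subset_uIcc hmem) 0 (by simp)).deriv]
    have hP0 : P 0 = 0 := by simp [hP]
    rw [h3, hηz T hT₁.le, hP0, hηderiv] at h2
    have hη0 : η 0 = -∫ t in 0..T, ψ t := intervalIntegral.integral_symm _ _
    have hψb : ∃ C, ∀ t, ‖ψ t‖ ≤ C := hψc.exists_bound_of_continuous hψ.continuous
    obtain ⟨C, hC⟩ := hψb
    have hmulψ : ∀ {g : ℝ → ℝ}, IntegrableOn g (Ioo 0 T) →
        IntegrableOn (fun t => ψ t * g t) (Ioo 0 T) := fun hg =>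
      Integrable.bdd_mul (c := C) hg hψ.continuous.aestronglyMeasurable (Eventually.of_forall hC)
    have hmulη : IntegrableOn (fun t => η t * D t) (Ioo 0 T) := by
      have := hDi.continuousOn_mul (hηs.continuous.continuousOn (s := uIcc 0 T))
      rwa [intervalIntegrable_iff_integrableOn_Ioo_of_le hT.le] at this
    rw [hηderiv, integral_add (hmulψ hf) hmulη] at h1
    have h4 : ∫ t, ψ t • (f t - A - P t) = ∫ t in Ioo 0 T, ψ t • (f t - A - P t) := by
      refine (setIntegral_eq_integral_of_forall_compl_eq_zero fun t ht => ?_).symm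
      rw [image_eq_zero_of_notMem_tsupport fun hmem => ht (hψs hmem), zero_smul]
    have h5 : ∀ t, ψ t • (f t - A - P t) = ψ t * f t - ψ t * A - ψ t * P t := fun t => by
      rw [smul_eq_mul]; ring
    have hA : IntegrableOn (fun _ : ℝ => A) (Ioo 0 T) := integrable_const A
    have i1 := hmulψ hA
    rw [h4]
    simp_rw [h5]
    have i2 : IntegrableOn (fun t => ψ t * f t - ψ t * A) (Ioo 0 T) := (hmulψ hf).sub i1
    rw [integral_sub i2 (hmulψ hPi), integral_sub (hmulψ hf) i1,
      integral_mul_const]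
    have hconv : ∀ g : ℝ → ℝ, ∫ t in 0..T, g t = ∫ t in Ioo 0 T, g t := fun g => by
      rw [intervalIntegral.integral_of_le hT.le, integral_Ioc_eq_integral_Ioo]
    rw [hconv, hconv] at h2
    rw [hη0, hconv] at h1 h2
    linarith
  have h6 := isOpen_Ioo.ae_eq_zero_of_integral_contDiff_smul_eq_zero
    hci.locallyIntegrableOn hmain
  rw [ae_restrict_iff' measurableSet_Ioo]
  filter_upwards [h6] with t ht hmem
  linarith [ht hmem]

lemma contDiff_char_proj (k : Mode) : ContDiff ℝ ∞ fun y => char k (proj y) := by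
  have h : (fun z => char k (proj z)) = fun z => Complex.exp (phaseCLM k z) := by
    ext z; rw [char_proj, phaseCLM_apply]
  rw [h]
  exact (phaseCLM k).contDiff.cexp

lemma hasDerivAt_char (k : Mode) (j : Fin 2) (x : Torus) :
    HasDerivAt (fun h : ℝ => char k (x + Pi.single j (h : AddCircle (2 * π))))
      (Complex.I * (k j : ℂ) * char k x) 0 := by
  obtain ⟨y, rfl⟩ := proj_surjective x
  refine (hasDerivAt_of_hasFDerivAt_proj (hasFDerivAt_char_proj k y) j).congr_deriv ?_
  rw [smul_apply, phaseCLM_apply, smul_eq_mul, Finset.sum_eq_single j]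
  · simp; ring
  · intro i _ hi
    simp [Pi.single_eq_of_ne hi]
  · simp

/-- The transport term tested against a function of space. -/
noncomputable def fluxPairing (u : Fin 2 → ℝ → Torus → ℝ) (θ : ℝ → Torus → ℝ) (ψ : Torus → ℝ)
    (t : ℝ) : ℝ := ∫ x, (∑ j, u j t x * partialDeriv j ψ x) * θ t x

lemma isTest_mul {T : ℝ} {η : ℝ → ℝ} (hη : ContDiff ℝ ∞ η) (hz : ∃ T₁ < T, ∀ t, T₁ ≤ t → η t = 0)
    {ψ : Torus → ℝ} (hψ : ContDiff ℝ ∞ fun y => ψ (proj y)) :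
    IsTest T fun t x => η t * ψ x := by
  refine ⟨(hη.comp contDiff_fst).mul (hψ.comp contDiff_snd), ?_⟩
  obtain ⟨T₁, hT₁, h⟩ := hz
  exact ⟨T₁, hT₁, fun t ht x => by simp only [h t ht, zero_mul]⟩

section WeakCoeff

variable {T : ℝ} {θ₀ : Torus → ℝ} {θ : ℝ → Torus → ℝ} {u : Fin 2 → ℝ → Torus → ℝ}

lemma continuous_of_contDiff_proj {ψ : Torus → ℝ} (hψ : ContDiff ℝ ∞ fun y => ψ (proj y)) :
    Continuous ψ ∧ ∀ j, Continuous (partialDeriv j ψ) ∧ ∀ c : ℝ, ∀ x,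
      partialDeriv j (fun x => c * ψ x) x = c * partialDeriv j ψ x := by
  have hd : ∀ j (y : Fin 2 → ℝ),
      HasDerivAt (fun h : ℝ => ψ (proj y + Pi.single j (h : AddCircle (2 * π))))
      (fderiv ℝ (fun y => ψ (proj y)) y (Pi.single j 1)) 0 := fun j y =>
    hasDerivAt_of_hasFDerivAt_proj (hψ.differentiable (by simp) y).hasFDerivAt j
  have hq := isOpenQuotientMap_proj.isQuotientMap
  refine ⟨hq.continuous_iff.2 hψ.continuous, fun j => ⟨hq.continuous_iff.2 ?_, fun c x => ?_⟩⟩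
  · have h2 : partialDeriv j ψ ∘ proj = fun y => fderiv ℝ (fun y => ψ (proj y)) y (Pi.single j 1) :=
      funext fun y => (hd j y).deriv
    rw [h2]
    exact (hψ.continuous_fderiv (by simp)).clm_apply continuous_const
  · obtain ⟨y, rfl⟩ := proj_surjective x
    exact ((hd j y).const_mul c).deriv.trans (congrArg (c * ·) (hd j y).deriv.symm)

lemma IsWeakSolution.ae_integrable (h : IsWeakSolution 0 T θ₀ θ u) :
    ∀ᵐ t ∂(volume.restrict (Ioo 0 T)), Integrable (θ t) volume ∧
      ∀ j, Integrable (fun x => u j t x * θ t x) volume := by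
  have h1 := h.integrable.prod_right_ae
  have h2 := ae_all_iff.2 fun j => (h.integrable_flux j).prod_right_ae
  filter_upwards [h1, h2] with t ht1 ht2
  exact ⟨ht1, ht2⟩

lemma IsWeakSolution.integrableOn_fluxPairing (h : IsWeakSolution 0 T θ₀ θ u) {ψ : Torus → ℝ}
    (hψ : ContDiff ℝ ∞ fun y => ψ (proj y)) : IntegrableOn (fluxPairing u θ ψ) (Ioo 0 T) := by
  obtain ⟨-, hψd⟩ := continuous_of_contDiff_proj hψ
  have h1 : ∀ j, Integrable (fun p : ℝ × Torus => partialDeriv j ψ p.2 * (u j p.1 p.2 * θ p.1 p.2))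
      ((volume.restrict (Ioo 0 T)).prod volume) := fun j => by
    obtain ⟨C, hC⟩ := (HasCompactSupport.of_compactSpace _).exists_bound_of_continuous (hψd j).1
    exact Integrable.bdd_mul (c := C) (h.integrable_flux j)
      ((hψd j).1.comp continuous_snd).aestronglyMeasurable (Eventually.of_forall fun p => hC p.2)
  have h2 := (integrable_finsetSum Finset.univ fun j _ => h1 j).integral_prod_left
  refine h2.congr (Eventually.of_forall fun t => ?_)
  simp only [fluxPairing]
  refine integral_congr_ae (Eventually.of_forall fun x => ?_)
  simp only [Finset.sum_mul]
  exact Finset.sum_congr rfl fun j _ => by ring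

/-- The evolution of the integral of a weak solution against a function of space. -/
lemma IsWeakSolution.ae_integral_eq (h : IsWeakSolution 0 T θ₀ θ u) (hT : 0 < T) {ψ : Torus → ℝ}
    (hψ : ContDiff ℝ ∞ fun y => ψ (proj y)) :
    ∀ᵐ t ∂(volume.restrict (Ioo 0 T)),
      ∫ x, ψ x * θ t x = (∫ x, ψ x * θ₀ x) + ∫ τ in 0..t, fluxPairing u θ ψ τ := by
  obtain ⟨hψc, hψd⟩ := continuous_of_contDiff_proj hψ
  obtain ⟨C, hC⟩ := (HasCompactSupport.of_compactSpace ψ).exists_bound_of_continuous hψc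
  have hbd : ∀ {g f : Torus → ℝ}, Continuous g → Integrable f volume →
      Integrable (fun x => g x * f x) volume := fun {g f} hg hf => by
    obtain ⟨C, hC⟩ := (HasCompactSupport.of_compactSpace g).exists_bound_of_continuous hg
    exact Integrable.bdd_mul (c := C) hf hg.aestronglyMeasurable (Eventually.of_forall hC)
  refine ae_eq_add_integral_of_weak hT ?_ (h.integrableOn_fluxPairing hψ) fun η hη hz => ?_
  · exact (Integrable.bdd_mul (c := C) h.integrable
      (hψc.comp continuous_snd).aestronglyMeasurable
      (Eventually.of_forall fun p => hC p.2)).integral_prod_left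
  · have h1 := h.weak_eq _ (isTest_mul hη hz hψ)
    have h2 : ∀ᵐ t ∂(volume.restrict (Ioo 0 T)), ∫ x : Torus,
        (deriv (fun τ => η τ * ψ x) t + ∑ j, u j t x * partialDeriv j (fun x => η t * ψ x) x) *
          θ t x = deriv η t * (∫ x, ψ x * θ t x) + η t * fluxPairing u θ ψ t := by
      filter_upwards [h.ae_integrable] with t ht
      rw [fluxPairing, ← integral_const_mul, ← integral_const_mul, ← integral_add]
      · refine integral_congr_ae (Eventually.of_forall fun x => ?_)
        simp only [(hψd _).2]
        rw [deriv_mul_const (hη.differentiable (by simp) t), Fin.sum_univ_two, Fin.sum_univ_two]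
        ring
      · exact (hbd hψc ht.1).const_mul _
      · refine Integrable.const_mul ?_ _
        have := integrable_finsetSum Finset.univ fun j _ => hbd (hψd j).1 (ht.2 j)
        refine this.congr (Eventually.of_forall fun x => ?_)
        simp only [Finset.sum_mul]
        exact Finset.sum_congr rfl fun j _ => by ring
    rw [integral_congr_ae h2] at h1
    have h3 : η 0 * ∫ x, ψ x * θ₀ x = ∫ x, η 0 * ψ x * θ₀ x := by
      rw [← integral_const_mul]
      exact integral_congr_ae (Eventually.of_forall fun x => by ring)
    rw [h3]
    exact h1

end WeakCoeff

/-- The transport term in Fourier variables, for a velocity given by the constitutive law. -/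
lemma integral_flux_char_eq {s R : ℝ} (hs : 2 < s) (hR : 0 ≤ R) {f : Torus → ℝ}
    (hf : MemLp f 2 volume) (hball : InBall s R (coeff f)) {v : Fin 2 → Torus → ℝ}
    (hv : IsVelocity 0 f v) (k : Mode) :
    ∑ j, (Complex.I * ((-k) j : ℤ)) * ∫ x, ((v j x * f x : ℝ) : ℂ) * char (-k) x =
      ((2 * π) ^ 2 : ℝ) * bil (coeff f) (coeff f) k := by
  set b := coeff f with hb
  have hsum := hball.summable_norm hs hR
  have hsymm : ∀ k, b (-k) = conj (b k) := coeff_neg f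
  have hfae : f =ᵐ[volume] fun x => (trig b x).re := by
    refine ae_eq_of_coeff_eq hf ?_ fun k => (coeff_re_trig hsum hsymm k).symm
    exact (Complex.continuous_re.comp (continuous_trig hsum)).memLp_of_hasCompactSupport
      (HasCompactSupport.of_compactSpace _)
  have hmul : ∀ j l, Integrable (fun x => (v j x : ℂ) * char l x) volume := fun j l =>
    ((hv j).1.ofReal (𝕜 := ℂ)).mul_bdd (c := 1) (char l).continuous.aestronglyMeasurable
      (Eventually.of_forall fun x => (norm_char l x).le)
  -- Only `f` is expanded in its series: `v` is merely integrable and is known through its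
  -- coefficients, which appear once the sum is taken out of the integral.
  have h1 : ∀ j, ∫ x, ((v j x * f x : ℝ) : ℂ) * char (-k) x =
      ∑' q, b q * (((2 * π) ^ 2 : ℝ) * ((symbol 0 j (k - q) : ℂ) * b (k - q))) := fun j => by
    have h2 : ∫ x, ((v j x * f x : ℝ) : ℂ) * char (-k) x =
        ∫ x, ∑' q, b q * ((v j x : ℂ) * char (-(k - q)) x) := by
      refine integral_congr_ae ?_
      filter_upwards [hfae] with x hx
      have h3 : (f x : ℂ) = trig b x := by rw [hx, ofReal_re_trig hsymm]
      have h4 : ((v j x * f x : ℝ) : ℂ) * char (-k) x =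
          trig b x * ((v j x : ℂ) * char (-k) x) := by
        push_cast
        rw [h3]; ring
      rw [h4, trig, ← tsum_mul_right]
      refine tsum_congr fun q => ?_
      have h5 : -(k - q) = q + -k := by abel
      rw [h5, char_add]
      ring
    rw [h2, ← integral_tsum_of_summable_integral_norm]
    · refine tsum_congr fun q => ?_
      rw [integral_const_mul, integral_mul_char_neg, (hv j).2]
    · exact fun q => (hmul j _).const_mul _
    · simp only [norm_mul, norm_char, mul_one, integral_const_mul]
      exact hsum.mul_right _
  have h3 : ∀ j, Summable fun q => b q * ((symbol 0 j (k - q) : ℂ) * b (k - q)) := fun j =>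
    (summable_norm_conv (d := scoef j b) hsum ((hball.scoef j).summable_norm hs hR)).1 k
  have h4 : ∀ j, ∑' q, b q * (((2 * π) ^ 2 : ℝ) * ((symbol 0 j (k - q) : ℂ) * b (k - q))) =
      ((2 * π) ^ 2 : ℝ) * ∑' q, b q * ((symbol 0 j (k - q) : ℂ) * b (k - q)) := fun j => by
    rw [← tsum_mul_left]
    exact tsum_congr fun q => by ring
  simp_rw [h1, h4]
  have h5 : bil b b k = ∑' q,
      ((Complex.I * ((-k) 0 : ℤ)) * (b q * ((symbol 0 0 (k - q) : ℂ) * b (k - q))) +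
      (Complex.I * ((-k) 1 : ℤ)) * (b q * ((symbol 0 1 (k - q) : ℂ) * b (k - q)))) := by
    -- The substitution `p = k - q` moves the velocity to the frequency `k - q`, where the expansion
    -- above has it.
    rw [bil, ← (Equiv.subLeft k).tsum_eq]
    refine tsum_congr fun q => ?_
    simp only [Equiv.subLeft_apply, sub_sub_cancel]
    rw [transportSymbol, Fin.sum_univ_two]
    simp only [Pi.neg_apply]
    push_cast
    ring
  rw [h5, ((h3 0).mul_left _).tsum_add ((h3 1).mul_left _), tsum_mul_left, tsum_mul_left,
    Fin.sum_univ_two]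
  ring

end IPM

/-! ### From weak solutions to coefficient trajectories. -/

namespace IPM

open scoped ComplexConjugate Topology
open Filter

lemma sum_weight_eq (s : ℝ) (f : Torus → ℝ) (k : Mode) :
    (1 + normSq k) ^ s * ‖coeff f k‖ ^ 2 = (jap k ^ s * ‖coeff f k‖) ^ 2 := by
  rw [one_add_normSq_rpow, mul_pow]

lemma MemHs.summable {s : ℝ} {f : Torus → ℝ} (h : MemHs s f) :
    Summable fun k => (jap k ^ s * ‖coeff f k‖) ^ 2 := by
  simpa only [sum_weight_eq] using h.2

lemma MemHs.inBall {s C : ℝ} {f : Torus → ℝ} (h : MemHs s f) (hC : hsNorm s f ≤ C) :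
    InBall s |C| (coeff f) := fun F => by
  have h1 := h.summable.sum_le_tsum F fun k _ => sq_nonneg _
  have h2 : hsNorm s f ^ 2 = ∑' k, (jap k ^ s * ‖coeff f k‖) ^ 2 := by
    simp only [hsNorm, sum_weight_eq]
    exact Real.sq_sqrt (tsum_nonneg fun k => sq_nonneg _)
  have h0 : 0 ≤ hsNorm s f := Real.sqrt_nonneg _
  rw [sq_abs]
  calc _ ≤ hsNorm s f ^ 2 := by rw [h2]; exact h1
    _ ≤ C ^ 2 := by gcongr

lemma integral_eq_re_add_im {F : Torus → ℂ} (hF : Integrable F volume) :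
    ∫ x, F x = ((∫ x, (F x).re : ℝ) : ℂ) + ((∫ x, (F x).im : ℝ) : ℂ) * Complex.I :=
  (integral_re_add_im hF).symm

lemma integrable_mul_char {f : Torus → ℝ} (hf : Integrable f volume) (k : Mode) :
    Integrable (fun x => (f x : ℂ) * char k x) volume :=
  (hf.ofReal (𝕜 := ℂ)).mul_bdd (c := 1) (char k).continuous.aestronglyMeasurable
    (Eventually.of_forall fun x => (norm_char k x).le)

lemma partialDeriv_re_char (k : Mode) (j : Fin 2) (x : Torus) :
    partialDeriv j (fun x => (char k x).re) x = (Complex.I * (k j : ℂ) * char k x).re :=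
  (Complex.reCLM.hasFDerivAt.comp_hasDerivAt (0 : ℝ) (hasDerivAt_char k j x)).deriv

lemma partialDeriv_im_char (k : Mode) (j : Fin 2) (x : Torus) :
    partialDeriv j (fun x => (char k x).im) x = (Complex.I * (k j : ℂ) * char k x).im :=
  (Complex.imCLM.hasFDerivAt.comp_hasDerivAt (0 : ℝ) (hasDerivAt_char k j x)).deriv

section Uniqueness

variable {s R T : ℝ} {θ₀ : Torus → ℝ} {θ : ℝ → Torus → ℝ} {u : Fin 2 → ℝ → Torus → ℝ}

/-- The Fourier coefficients of a weak solution satisfy the coefficient equation in integrated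
form. -/
lemma IsWeakSolution.coeff_eq (hs : 2 < s) (hR : 0 ≤ R) (hT : 0 < T)
    (h : IsWeakSolution 0 T θ₀ θ u) (hθ₀ : Integrable θ₀ volume)
    (hball : ∀ᵐ t ∂(volume.restrict (Ioo 0 T)), MemLp (θ t) 2 volume ∧ InBall s R (coeff (θ t)))
    (k : Mode) :
    IntegrableOn (fun τ => bil (coeff (θ τ)) (coeff (θ τ)) k) (Ioo 0 T) ∧
      ∀ᵐ t ∂(volume.restrict (Ioo 0 T)),
        coeff (θ t) k = coeff θ₀ k + ∫ τ in 0..t, bil (coeff (θ τ)) (coeff (θ τ)) k := by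
  -- Test functions are real valued, so the character is tested through its real and imaginary
  -- parts, which are recombined afterwards.
  set ψr : Torus → ℝ := fun x => (char (-k) x).re with hψr
  set ψi : Torus → ℝ := fun x => (char (-k) x).im with hψi
  have hr : ContDiff ℝ ∞ fun y => ψr (proj y) :=
    Complex.reCLM.contDiff.comp (contDiff_char_proj (-k))
  have hi : ContDiff ℝ ∞ fun y => ψi (proj y) :=
    Complex.imCLM.contDiff.comp (contDiff_char_proj (-k))
  have hpi : (0 : ℝ) < (2 * π) ^ 2 := by positivity
  have hpi' : (((2 * π) ^ 2 : ℝ) : ℂ) ≠ 0 := Complex.ofReal_ne_zero.2 hpi.ne'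
  have hflux : ∀ᵐ t ∂(volume.restrict (Ioo 0 T)),
      (((2 * π) ^ 2 : ℝ) : ℂ) * bil (coeff (θ t)) (coeff (θ t)) k =
        (fluxPairing u θ ψr t : ℂ) + (fluxPairing u θ ψi t : ℂ) * Complex.I := by
    filter_upwards [hball, h.velocity, h.ae_integrable] with t ht hv hint
    have hF : ∀ j, Integrable (fun x => (Complex.I * ((-k) j : ℤ)) *
        (((u j t x * θ t x : ℝ) : ℂ) * char (-k) x)) volume := fun j =>
      (integrable_mul_char (hint.2 j) (-k)).const_mul _
    rw [← integral_flux_char_eq hs hR ht.1 ht.2 hv k]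
    simp_rw [← integral_const_mul]
    rw [← integral_finsetSum _ fun j _ => hF j,
      integral_eq_re_add_im (integrable_finsetSum _ fun j _ => hF j), fluxPairing, fluxPairing]
    congr 2
    · refine integral_congr_ae (Eventually.of_forall fun x => ?_)
      simp only [hψr, partialDeriv_re_char, Fin.sum_univ_two, Complex.add_re]
      have : ∀ z w : ℂ, ∀ r : ℝ, (z * (r * w)).re = r * (z * w).re := fun z w r => by
        rw [mul_left_comm, Complex.re_ofReal_mul]
      rw [this, this]
      ring
    · congr 1
      refine integral_congr_ae (Eventually.of_forall fun x => ?_)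
      simp only [hψi, partialDeriv_im_char, Fin.sum_univ_two, Complex.add_im]
      have : ∀ z w : ℂ, ∀ r : ℝ, (z * (r * w)).im = r * (z * w).im := fun z w r => by
        rw [mul_left_comm, Complex.im_ofReal_mul]
      rw [this, this]
      ring
  have hDr := h.integrableOn_fluxPairing hr
  have hDi := h.integrableOn_fluxPairing hi
  have hbil : ∀ᵐ t ∂(volume.restrict (Ioo 0 T)), bil (coeff (θ t)) (coeff (θ t)) k =
      (((2 * π) ^ 2 : ℝ) : ℂ)⁻¹ *
        ((fluxPairing u θ ψr t : ℂ) + (fluxPairing u θ ψi t : ℂ) * Complex.I) := by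
    filter_upwards [hflux] with t ht
    rw [← ht, inv_mul_cancel_left₀ hpi']
  have hDc : IntegrableOn (fun t => (fluxPairing u θ ψr t : ℂ) +
      (fluxPairing u θ ψi t : ℂ) * Complex.I) (Ioo 0 T) :=
    (hDr.ofReal (𝕜 := ℂ)).add ((hDi.ofReal (𝕜 := ℂ)).mul_const _)
  refine ⟨(hDc.const_mul _).congr (by filter_upwards [hbil] with t ht; exact ht.symm), ?_⟩
  have hcoef : ∀ {f : Torus → ℝ}, Integrable f volume →
      (((2 * π) ^ 2 : ℝ) : ℂ) * coeff f k =
        ((∫ x, ψr x * f x : ℝ) : ℂ) + ((∫ x, ψi x * f x : ℝ) : ℂ) * Complex.I := fun {f} hf => by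
    rw [← integral_mul_char_neg, integral_eq_re_add_im (integrable_mul_char hf (-k))]
    simp only [Complex.re_ofReal_mul, Complex.im_ofReal_mul, hψr, hψi, mul_comm]
  filter_upwards [h.ae_integral_eq hT hr, h.ae_integral_eq hT hi, h.ae_integrable,
    ae_restrict_mem measurableSet_Ioo] with t h1 h2 h3 ht
  have hsub : Ioc 0 t ⊆ Ioo 0 T := fun τ hτ => ⟨hτ.1, hτ.2.trans_lt ht.2⟩
  have h4 : ∫ τ in 0..t, bil (coeff (θ τ)) (coeff (θ τ)) k =
      ∫ τ in 0..t, (((2 * π) ^ 2 : ℝ) : ℂ)⁻¹ *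
        ((fluxPairing u θ ψr τ : ℂ) + (fluxPairing u θ ψi τ : ℂ) * Complex.I) := by
    rw [intervalIntegral.integral_of_le ht.1.le, intervalIntegral.integral_of_le ht.1.le]
    exact integral_congr_ae (ae_restrict_of_ae_restrict_of_subset hsub hbil)
  have ir : IntervalIntegrable (fun τ => (fluxPairing u θ ψr τ : ℂ)) volume 0 t := by
    rw [intervalIntegrable_iff_integrableOn_Ioc_of_le ht.1.le]
    exact IntegrableOn.mono_set (hDr.ofReal (𝕜 := ℂ)) hsub
  have ii : IntervalIntegrable (fun τ => (fluxPairing u θ ψi τ : ℂ) * Complex.I) volume 0 t := by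
    rw [intervalIntegrable_iff_integrableOn_Ioc_of_le ht.1.le]
    exact IntegrableOn.mono_set ((hDi.ofReal (𝕜 := ℂ)).mul_const Complex.I) hsub
  rw [h4, intervalIntegral.integral_const_mul, intervalIntegral.integral_add ir ii,
    intervalIntegral.integral_mul_const, intervalIntegral.integral_ofReal,
    intervalIntegral.integral_ofReal]
  refine mul_left_cancel₀ hpi' ?_
  rw [mul_add, mul_inv_cancel_left₀ hpi', hcoef h3.1, hcoef hθ₀, h1, h2]
  push_cast
  ring

/-- The exceptional set is open and null, hence empty. This upgrades closed conditions on a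
continuous version from almost every time to every time. -/
lemma Ioo_subset_of_isClosed_of_ae {Z : Set ℝ} (hZ : IsClosed Z)
    (h : ∀ᵐ t ∂(volume.restrict (Ioo 0 T)), t ∈ Z) : Ioo 0 T ⊆ Z := by
  have h1 : volume (Zᶜ ∩ Ioo 0 T) = 0 := by
    rw [← Measure.restrict_apply' measurableSet_Ioo]; exact h
  have h2 := (hZ.isOpen_compl.inter isOpen_Ioo).eq_empty_of_measure_zero h1
  intro t ht
  by_contra hc
  have : t ∈ Zᶜ ∩ Ioo 0 T := ⟨hc, ht⟩
  rwa [h2] at this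

/-- A weak solution bounded in `H^s` has a version whose Fourier coefficients solve the
coefficient equation at every time. -/
lemma IsWeakSolution.exists_isCoeffSolutionAt (hs : 2 < s) (hR : 0 ≤ R) (hT : 0 < T)
    (h : IsWeakSolution 0 T θ₀ θ u) (hθ₀ : Integrable θ₀ volume)
    (hball : ∀ᵐ t ∂(volume.restrict (Ioo 0 T)), MemLp (θ t) 2 volume ∧ InBall s R (coeff (θ t))) :
    ∃ b : ℝ → Mode → ℂ, b 0 = coeff θ₀ ∧ (∀ k, Continuous fun t => b t k) ∧
      (∀ t ∈ Ioo 0 T, IsCoeffSolutionAt s R b t) ∧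
      ∀ᵐ t ∂(volume.restrict (Ioo 0 T)), coeff (θ t) = b t := by
  have hc := fun k => h.coeff_eq hs hR hT hθ₀ hball k
  -- Extension by zero makes the integrand integrable on the whole line, so its primitive `b` is
  -- continuous everywhere.
  let G : Mode → ℝ → ℂ := fun k => (Ioo 0 T).indicator fun τ => bil (coeff (θ τ)) (coeff (θ τ)) k
  have hGi : ∀ k, Integrable (G k) volume := fun k =>
    (integrable_indicator_iff measurableSet_Ioo).2 (hc k).1
  let b : ℝ → Mode → ℂ := fun t k => coeff θ₀ k + ∫ τ in 0..t, G k τ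
  have hbc : ∀ k, Continuous fun t => b t k := fun k =>
    continuous_const.add
      (intervalIntegral.continuous_primitive (fun _ _ => (hGi k).intervalIntegrable) 0)
  have hae : ∀ᵐ t ∂(volume.restrict (Ioo 0 T)), coeff (θ t) = b t := by
    have h1 := ae_all_iff.2 fun k => (hc k).2
    filter_upwards [h1, ae_restrict_mem measurableSet_Ioo] with t ht hmem
    ext k
    rw [ht k]
    simp only [b]
    congr 1
    rw [intervalIntegral.integral_of_le hmem.1.le, intervalIntegral.integral_of_le hmem.1.le]
    refine setIntegral_congr_fun measurableSet_Ioc fun τ hτ => ?_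
    have hmem' : τ ∈ Ioo 0 T := ⟨hτ.1, hτ.2.trans_lt hmem.2⟩
    simp only [G, indicator_of_mem hmem']
  have hbball : ∀ t ∈ Ioo 0 T, InBall s R (b t) := fun t ht F => by
    have hZ : IsClosed {t | ∑ k ∈ F, (jap k ^ s * ‖b t k‖) ^ 2 ≤ R ^ 2} :=
      isClosed_le (continuous_finsetSum F fun k _ => (continuous_const.mul (hbc k).norm).pow 2)
        continuous_const
    refine Ioo_subset_of_isClosed_of_ae hZ ?_ ht
    filter_upwards [hae, hball] with t h1 h2
    have := h2.2 F
    rwa [h1] at this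
  have hsymm : ∀ t ∈ Ioo 0 T, ∀ k, b t (-k) = conj (b t k) := fun t ht k => by
    have hZ : IsClosed {t | b t (-k) = conj (b t k)} :=
      isClosed_eq (hbc _) (Complex.continuous_conj.comp (hbc k))
    refine Ioo_subset_of_isClosed_of_ae hZ ?_ ht
    filter_upwards [hae] with t h1
    have := coeff_neg (θ t) k
    rwa [h1] at this
  have hbilc : ∀ k, ContinuousOn (fun t => bil (b t) (b t) k) (Ioo 0 T) := fun k t ht => by
    refine tendsto_bil hs hR ?_ (fun k => (hbc k).continuousWithinAt) k
    filter_upwards [self_mem_nhdsWithin] with τ hτ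
    exact (hbball τ hτ).norm_le hR
  refine ⟨b, ?_, hbc, fun t ht => ⟨hsymm t ht, hbball t ht, fun k => ?_⟩, hae⟩
  · ext k; simp [b]
  · have hmem : Ioo 0 T ∈ 𝓝 t := Ioo_mem_nhds ht.1 ht.2
    -- Replacing the coefficients of `θ` by `b` changes the integrand on a null set only and makes
    -- it continuous on `(0, T)`, so the primitive is differentiable at every time there.
    set g : ℝ → ℂ := (Ioo 0 T).indicator fun τ => bil (b τ) (b τ) k with hg
    have hgG : G k =ᵐ[volume] g := by
      have h1 := (ae_restrict_iff' measurableSet_Ioo).1 hae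
      filter_upwards [h1] with τ hτ
      by_cases hm : τ ∈ Ioo 0 T
      · simp only [G, hg, indicator_of_mem hm, hτ hm]
      · simp only [G, hg, indicator_of_notMem hm]
    have hgi : Integrable g volume := (hGi k).congr hgG
    have hgc : ContinuousOn g (Ioo 0 T) :=
      (hbilc k).congr fun τ hτ => indicator_of_mem hτ _
    have h1 : HasDerivAt (fun τ => ∫ σ in 0..τ, g σ) (g t) t :=
      intervalIntegral.integral_hasDerivAt_right hgi.intervalIntegrable
        (hgc.stronglyMeasurableAtFilter isOpen_Ioo t ht) (hgc.continuousAt hmem)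
    have h2 : g t = bil (b t) (b t) k := indicator_of_mem ht _
    rw [h2] at h1
    refine (h1.const_add (coeff θ₀ k)).congr_of_eventuallyEq (Eventually.of_forall fun τ => ?_)
    simp only [b]
    congr 1
    exact intervalIntegral.integral_congr_ae (hgG.mono fun σ hσ _ => hσ)

end Uniqueness

lemma InBall.mono {s R R' : ℝ} {c : Mode → ℂ} (h : InBall s R c) (hR : 0 ≤ R) (hRR' : R ≤ R') :
    InBall s R' c := fun F => (h F).trans (by gcongr)

lemma IsCoeffSolutionAt.mono {s R R' t : ℝ} {a : ℝ → Mode → ℂ} (h : IsCoeffSolutionAt s R a t)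
    (hR : 0 ≤ R) (hRR' : R ≤ R') : IsCoeffSolutionAt s R' a t :=
  ⟨h.symm, h.inBall.mono hR hRR', h.hasDerivAt⟩

/-! ### Norm, mean value and coefficients of the solution. -/

section Solution

variable {s R : ℝ} {a : ℝ → Mode → ℂ} {t : ℝ}

lemma coeff_scalarOf (hs : 2 < s) (hR : 0 ≤ R) (ha : IsCoeffSolutionAt s R a t) :
    coeff (scalarOf a t) = a t :=
  funext fun k => coeff_re_trig (ha.inBall.summable_norm hs hR) ha.symm k

lemma memLp_scalarOf (hs : 2 < s) (hR : 0 ≤ R) (ha : IsCoeffSolutionAt s R a t) :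
    MemLp (scalarOf a t) 2 volume :=
  (Complex.continuous_re.comp
    (continuous_trig (ha.inBall.summable_norm hs hR))).memLp_of_hasCompactSupport
      (HasCompactSupport.of_compactSpace _)

lemma memHs_scalarOf (hs : 2 < s) (hR : 0 ≤ R) (ha : IsCoeffSolutionAt s R a t) :
    MemHs s (scalarOf a t) ∧ hsNorm s (scalarOf a t) ≤ R := by
  refine ⟨⟨memLp_scalarOf hs hR ha, ?_⟩, ?_⟩
  · simp only [sum_weight_eq]
    rw [coeff_scalarOf hs hR ha]
    exact ha.inBall.summable
  · rw [hsNorm, Real.sqrt_le_left hR]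
    simp only [sum_weight_eq]
    rw [coeff_scalarOf hs hR ha]
    exact ha.inBall.tsum_le

lemma bil_zero_mode (c : Mode → ℂ) : bil c c 0 = 0 := by
  simp [bil, transportSymbol]

/-- Conservation of the mean: the symbol `M̂(p)·k` vanishes at `k = 0`. -/
lemma apply_zero_mode_eq {T : ℝ} (ha : ∀ t ∈ Ioo (-T) T, IsCoeffSolutionAt s R a t)
    (ht : t ∈ Ioo (-T) T) : a t 0 = a 0 0 := by
  have hd : ∀ t ∈ Ioo (-T) T, HasDerivAt (fun t => a t 0) 0 t := fun t ht => by
    have := (ha t ht).hasDerivAt 0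
    rwa [bil_zero_mode] at this
  exact isOpen_Ioo.is_const_of_deriv_eq_zero isPreconnected_Ioo
    (fun τ hτ => (hd τ hτ).differentiableAt.differentiableWithinAt)
    (fun τ hτ => (hd τ hτ).deriv) ht ⟨by linarith [ht.1.trans ht.2], by linarith [ht.1.trans ht.2]⟩

end Solution

/-! ### Assembly of existence and uniqueness. -/

section Global

variable {s R T T' : ℝ} {a : ℝ → Mode → ℂ} {θ₀ : Torus → ℝ}

lemma isClassicalSolution_scalarOf (hs : 2 < s) (hR : 0 ≤ R)
    (ha : ∀ t ∈ Ioo (-T) T, IsCoeffSolutionAt s R a t) (hT' : 0 < T') (hTT' : T' < T)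
    (h0 : scalarOf a 0 =ᵐ[volume] θ₀) :
    IsClassicalSolution 0 T' θ₀ (scalarOf a) (velocityOf a) := by
  have hsub : Icc 0 T' ⊆ Ioo (-T) T := fun t ht =>
    ⟨by linarith [ht.1, hT'], ht.2.trans_lt hTT'⟩
  refine ⟨(contDiffOn_scalarOf hs hR ha).mono (prod_mono_left hsub),
    fun j => (continuousOn_velocityOf hs hR ha j).mono (prod_mono_left hsub),
    fun t ht => isVelocity_velocityOf hs hR (ha t (hsub ht)), fun t ht x => ?_, h0⟩
  rw [((hasDerivAt_scalarOf hs hR ha (hsub ht) x).hasDerivWithinAt).derivWithin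
    (uniqueDiffOn_Icc hT' t ht)]
  simp only [partialDeriv_scalarOf hs hR (ha t (hsub ht))]
  exact neg_add_cancel _

lemma isWeakSolution_scalarOf (hs : 2 < s) (hR : 0 ≤ R)
    (ha : ∀ t ∈ Ioo (-T) T, IsCoeffSolutionAt s R a t) (hT' : 0 < T') (hTT' : T' < T)
    (h0 : scalarOf a 0 =ᵐ[volume] θ₀) :
    IsWeakSolution 0 T' θ₀ (scalarOf a) (velocityOf a) := by
  have hsub : Icc 0 T' ⊆ Ioo (-T) T := fun t ht =>
    ⟨by linarith [ht.1, hT'], ht.2.trans_lt hTT'⟩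
  have hθ := (continuousOn_scalarOf hs hR ha).mono (prod_mono_left (t := univ) hsub)
  refine ⟨integrable_prod_of_continuousOn hθ, fun j => integrable_prod_of_continuousOn
    (((continuousOn_velocityOf hs hR ha j).mono (prod_mono_left hsub)).mul hθ), ?_,
    fun φ hφ => ?_⟩
  · filter_upwards [ae_restrict_mem measurableSet_Ioo] with t ht
    exact isVelocity_velocityOf hs hR (ha t (hsub (Ioo_subset_Icc_self ht)))
  · have e : ∫ x, φ 0 x * θ₀ x = ∫ x, φ 0 x * scalarOf a 0 x := by
      refine integral_congr_ae ?_
      filter_upwards [h0] with x hx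
      rw [hx]
    rw [e]
    exact weak_eq_scalarOf hs hR ha hT' hTT' hφ

lemma memLinftyHs_scalarOf (hs : 2 < s) (hR : 0 ≤ R)
    (ha : ∀ t ∈ Ioo (-T) T, IsCoeffSolutionAt s R a t) (hT' : 0 < T') (hTT' : T' < T) :
    MemLinftyHs T' s (scalarOf a) := by
  have hsub : Icc 0 T' ⊆ Ioo (-T) T := fun t ht =>
    ⟨by linarith [ht.1, hT'], ht.2.trans_lt hTT'⟩
  refine ⟨(integrable_prod_of_continuousOn ((continuousOn_scalarOf hs hR ha).mono
    (prod_mono_left hsub))).aestronglyMeasurable, R, ?_⟩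
  filter_upwards [ae_restrict_mem measurableSet_Ioo] with t ht
  exact memHs_scalarOf hs hR (ha t (hsub (Ioo_subset_Icc_self ht)))

/-- Weak solutions bounded in `H^s` coincide with the solution built from its coefficients. -/
lemma IsWeakSolution.ae_eq_scalarOf (hs : 2 < s) (hR : 0 ≤ R)
    (ha : ∀ t ∈ Ioo (-T) T, IsCoeffSolutionAt s R a t) (hT' : 0 < T') (hTT' : T' < T)
    (h0 : a 0 = coeff θ₀) (hθ₀ : Integrable θ₀ volume) {θ : ℝ → Torus → ℝ}
    {u : Fin 2 → ℝ → Torus → ℝ} (h : IsWeakSolution 0 T' θ₀ θ u) (hθ : MemLinftyHs T' s θ) :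
    ∀ᵐ t ∂(volume.restrict (Ioo 0 T')), θ t =ᵐ[volume] scalarOf a t := by
  have hsub : Ico 0 T' ⊆ Ioo (-T) T := fun t ht =>
    ⟨by linarith [ht.1, hT'], ht.2.trans hTT'⟩
  obtain ⟨-, C, hC⟩ := hθ
  obtain ⟨b, hb0, hbc, hb, hae⟩ := h.exists_isCoeffSolutionAt hs (abs_nonneg C) hT' hθ₀
    (hC.mono fun t ht => ⟨ht.1.1, ht.1.inBall ht.2⟩)
  -- The competitor may live in a larger ball than the constructed solution; the uniqueness argument
  -- needs a common radius.
  have hmax : 0 ≤ max R |C| := hR.trans (le_max_left _ _)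
  filter_upwards [hC, hae, ae_restrict_mem measurableSet_Ioo] with t h1 h2 ht
  have hat := ha t (hsub (Ioo_subset_Ico_self ht))
  refine ae_eq_of_coeff_eq h1.1.1 (memLp_scalarOf hs hR hat) fun k => ?_
  rw [coeff_scalarOf hs hR hat, h2]
  refine congrFun (eq_of_isCoeffSolutionAt hs hmax
    (fun t ht => (ha t (hsub (Ioo_subset_Ico_self ht))).mono hR (le_max_left _ _))
    (fun t ht => (hb t ht).mono (abs_nonneg C) (le_max_right _ _))
    (fun k => (continuousOn_coeff ha k).mono hsub) (fun k => (hbc k).continuousOn)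
    (h0.trans hb0.symm) ?_ ht).symm k
  exact (ha 0 (hsub ⟨le_rfl, hT'⟩)).inBall.mono hR (le_max_left _ _)

end Global

end IPM

theorem theorem6p10 (s : ℝ) (hs : 2 < s) (θ₀ : IPM.Torus → ℝ)
    (hθ₀ : IPM.MemHs s θ₀) (hmean : ∫ x : IPM.Torus, θ₀ x = 0) :
    ∃ T : ℝ, 0 < T ∧
      ∃ (θ : ℝ → IPM.Torus → ℝ) (u : Fin 2 → ℝ → IPM.Torus → ℝ),
        IPM.IsClassicalSolution 0 T θ₀ θ u ∧
        IPM.IsWeakSolution 0 T θ₀ θ u ∧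
        IPM.MemLinftyHs T s θ ∧
        (∀ t ∈ Icc 0 T, ∫ x : IPM.Torus, θ t x = 0) ∧
        ∀ (θ' : ℝ → IPM.Torus → ℝ) (u' : Fin 2 → ℝ → IPM.Torus → ℝ),
          IPM.IsWeakSolution 0 T θ₀ θ' u' → IPM.MemLinftyHs T s θ' →
            ∀ᵐ t ∂(volume.restrict (Ioo 0 T)), θ' t =ᵐ[volume] θ t := by
  obtain ⟨T, R, hT, hR, a, ha0, ha⟩ :=
    IPM.exists_isCoeffSolutionAt hs (IPM.coeff_neg θ₀) hθ₀.summable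
  -- Halving the time puts the closed interval inside the open one on which the trajectory is
  -- controlled.
  have hT' : 0 < T / 2 := by linarith
  have hTT' : T / 2 < T := by linarith
  have h0 : IPM.scalarOf a 0 =ᵐ[volume] θ₀ := by
    have hat := ha 0 ⟨by linarith, hT⟩
    refine IPM.ae_eq_of_coeff_eq (IPM.memLp_scalarOf hs hR hat) hθ₀.1 fun k => ?_
    rw [IPM.coeff_scalarOf hs hR hat, ha0]
  refine ⟨T / 2, hT', IPM.scalarOf a, IPM.velocityOf a,
    IPM.isClassicalSolution_scalarOf hs hR ha hT' hTT' h0,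
    IPM.isWeakSolution_scalarOf hs hR ha hT' hTT' h0,
    IPM.memLinftyHs_scalarOf hs hR ha hT' hTT', fun t ht => ?_, fun θ' u' h hθ' =>
    h.ae_eq_scalarOf hs hR ha hT' hTT' ha0 (hθ₀.1.integrable (by norm_num)) hθ'⟩
  have htT : t ∈ Ioo (-T) T := ⟨by linarith [ht.1], ht.2.trans_lt hTT'⟩
  have h1 := IPM.integral_eq_coeff_zero θ₀
  rw [hmean, Complex.ofReal_zero, ← ha0] at h1
  have h2 := IPM.integral_eq_coeff_zero (IPM.scalarOf a t)
  rw [IPM.coeff_scalarOf hs hR (ha t htT), IPM.apply_zero_mode_eq ha htT, ← h1] at h2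
  exact_mod_cast h2
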